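/- **Model.** A longest-chain protocol runs in slots $1,2,\dots$ among a set $\mathcal H$ of honest parties and one adversary $\mathcal A$. A block other than genesis has a parent, a timestamp larger than that of its parent, a proposer and further content; genesis has timestamp $0$. A chain is the path from genesis to a block, its length is the number of non-genesis blocks, and $\mathcal C[a:b]$ is the part of a chain $\mathcal C$ with timestamps in $\{a,\dots,b\}$. In each slot $i$ a set of leaders in $\mathcal H\cup\{\mathcal A\}$ is elected. Each honest leader appends one block with timestamp $i$ to the chain it holds and broadcasts the resulting chain; the message from $h$ to $h'$ gets a random delay. Then $\mathcal A$ may create any number of blocks, extending existing blocks, with timestamps of slots $\le i$ for which it was elected. Every honest message is delivered at the latest in the slot given by its delay ($\mathcal A$ may deliver it earlier; a message with infinite delay need never be delivered), and $\mathcal A$ may deliver any existing chains to any honest parties. Finally each honest party that received a chain strictly longer than its own adopts a longest received one, with ties broken by $\mathcal A$. $\mathcal C^h_i$ denotes the chain held by $h$ at the end of slot $i$. Let $N_s$ be the number of honest leaders of slot $s$ and $A_s$ the indicator that $\mathcal A$ is a leader of slot $s$. All delays are i.i.d., distributed as $\Delta$, and independent of the leader election, and one of the following holds. * *i.i.d.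 leader model*: the leader sets of the slots are i.i.d., $\Delta$ takes values in $\mathbb Z_{\ge 0}$, and its failure rate $s\mapsto\mathbb P(\Delta=s\mid\Delta\ge s)$ (set to $1$ where $\mathbb P(\Delta\ge s)=0$) is non-decreasing. * *one-time leader model*: a sequence of distinct honest parties $m_1,m_2,\dots$ is elected in this order, $N_s$ of them in slot $s$, each at most once; the pairs $(N_s,A_s)$ are i.i.d.; $\Delta$ has an arbitrary distribution on $\mathbb Z_{\ge 0}\cup\{\infty\}$. Put $f=\mathbb P(N_1+A_1>0)$ and $\alpha=\mathbb P(N_1=1,\,A_1=0\mid N_1+A_1>0)$, let $G$ be geometric on $\{1,2,\dots\}$ with parameter $f$ and independent of $\Delta$, and $p=\alpha\,\mathbb P(\Delta<G)$. The protocol has *$\epsilon$-honest majority* if $p>1/2$ and $p=(1+\epsilon)/2$. **Properties.** Let $\mathcal I\subseteq\mathcal H$. The *$(T,k,\mathcal I)$-common prefix property* holds if $\mathcal C^{h_1}_{i_1}[1:s]=\mathcal C^{h_2}_{i_2}[1:s]$ for all $h_1,h_2\in\mathcal I$ and all slots $s,i_1,i_2$ with $1\le s\le T$ and $s+k\le i_1\le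 i_2$. For $\mu\in(0,1)$, the *$(\mu,T,k,\mathcal I)$-extensive chain quality property* holds if $\mathcal C^h_i[s+1:s+k]$ contains more than $kf\mu$ honestly mined blocks for all $h\in\mathcal I$ and all slots $s,i$ with $1\le s\le T$ and $i\ge s+k$. **Corollary.** Suppose the protocol has $\epsilon$-honest majority. Then for all $\mathcal I\subseteq\mathcal H$ and $T,k\in\mathbb N$, and whatever the adversary does (its actions may depend arbitrarily on all random outcomes), $$\mathbb P\big((T,k,\mathcal I)\text{-common prefix is violated}\big)\le T\,\big(p_{\mathsf{settlement}}+|\mathcal I|\,p_{\mathsf{unheard}}\big),$$ and for all $\mu\in(0,1)$ with $\mu<\epsilon$, $$\mathbb P\big((\mu,T,k,\mathcal I)\text{-extensive chain quality is violated}\big)\le T\,\big(p_{\mathsf{CQ}}+|\mathcal I|\,\tilde p_{\mathsf{unheard}}\big),$$ where $$p_{\mathsf{settlement}}=e^{-kf\epsilon^3/12}+3e^{-kf\epsilon^2/32},\qquad p_{\mathsf{unheard}}=\frac{2}{1-(1/2)^{\epsilon/2}}\,e^{-kf\epsilon/16},$$ $$p_{\mathsf{CQ}}=4e^{-kf(\epsilon-\mu)^2/48},\qquad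 \tilde p_{\mathsf{unheard}}=\frac{2}{1-(1/2)^{\epsilon/2}}\,e^{-kf(\epsilon-\mu)/8}.$$ -/

import Mathlib

open MeasureTheory ProbabilityTheory

noncomputable section

namespace LongestChain

/-! ### Blocks and chains -/

/-- A block is the genesis block or has a parent, a timestamp, a proposer (`some h` for the honest
party `h`, `none` for the adversary) and further content. A block determines all its ancestors, so
a chain is represented by its tip. -/
inductive Block (H : Type*) (Data : Type*) where
  | genesis : Block H Data
  | child (parent : Block H Data) (time : ℕ) (proposer : Option H) (content : Data) : Block H Data

namespace Block

variable {H Data : Type*}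

/-- The timestamp of a block. -/
def time : Block H Data → ℕ
  | genesis => 0
  | child _ t _ _ => t

/-- The length of the chain that ends at a block (number of edges from genesis). -/
def depth : Block H Data → ℕ
  | genesis => 0
  | child b _ _ _ => b.depth + 1

/-- The chain that ends at a block, listed from the tip down to genesis. -/
def chain : Block H Data → List (Block H Data)
  | genesis => [genesis]
  | child b t o d => child b t o d :: b.chain

/-- The block was mined by an honest party. -/
def IsHonest : Block H Data → Prop
  | genesis => False
  | child _ _ o _ => o.isSome

open Classical in
/-- `C[a : b]`: the blocks with timestamps in `{a, …, b}` of the chain with tip `C`. -/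
def segment (C : Block H Data) (a b : ℕ) : List (Block H Data) :=
  C.chain.filter fun B => a ≤ B.time ∧ B.time ≤ b

open Classical in
/-- The number of honestly mined blocks in `C[a : b]`. -/
def honestCount (C : Block H Data) (a b : ℕ) : ℕ :=
  ((C.segment a b).filter fun B => B.IsHonest).length

end Block

/-! ### Executions -/

/-- An outcome of the random components: in slot `s` the honest leaders are `leaders s`, the
adversary is a leader iff `adv s`, and a message sent by `h` to `h'` in slot `s` is assigned the
delay `delay s h h'`. Slots are numbered from `1`; index `0` is not used. -/
structure Outcome (H : Type*) where
  leaders : ℕ → Set H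
  adv : ℕ → Prop
  delay : ℕ → H → H → ℕ∞

/-- The record of what happens in a run of the protocol: the tip of the chain held by each honest
party at the end of each slot (slot `0`: the start of the protocol), the content that honest
leaders put in their blocks, the blocks created by the adversary in each slot, and the chains
delivered to each honest party in each slot. -/
structure Trace (H : Type*) (Data : Type*) where
  tip : ℕ → H → Block H Data
  content : ℕ → H → Data
  advBlocks : ℕ → Set (Block H Data)
  received : ℕ → H → Set (Block H Data)

namespace Trace

variable {H Data : Type*} (τ : Trace H Data) (ρ : Outcome H)

/-- The block that `h` creates in slot `s` if `h` is a leader of that slot. -/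
def honestBlock (s : ℕ) (h : H) : Block H Data :=
  Block.child (τ.tip (s - 1) h) s (some h) (τ.content s h)

/-- The set of all blocks generated up to slot `i`, public or private. -/
def tree (i : ℕ) : Set (Block H Data) :=
  {b | b = Block.genesis ∨
    (∃ s h, 1 ≤ s ∧ s ≤ i ∧ h ∈ ρ.leaders s ∧ b = τ.honestBlock s h) ∨
    (∃ s, 1 ≤ s ∧ s ≤ i ∧ b ∈ τ.advBlocks s)}

open Classical in
/-- The chain of `h` in slot `i` after the send phase and before the adopt phase. -/
def ownTip (i : ℕ) (h : H) : Block H Data :=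
  if h ∈ ρ.leaders i then τ.honestBlock i h else τ.tip (i - 1) h

/-- The trace obeys the rules of the longest-chain protocol for the outcome `ρ`. Everything that
these rules leave open is the choice of the adversary. -/
structure IsExecution : Prop where
  /-- All parties start with the genesis block. -/
  init : ∀ h, τ.tip 0 h = Block.genesis
  /-- The adversary extends existing blocks, in its own name, with increasing timestamps, and uses
  only timestamps of present or past slots for which it was elected. -/
  adv_valid : ∀ i, 1 ≤ i → ∀ b ∈ τ.advBlocks i, ∃ parent t d,
    b = Block.child parent t none d ∧ parent ∈ τ.tree ρ i ∧ parent.time < t ∧ t ≤ i ∧ ρ.adv t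
  /-- Only existing chains are delivered. -/
  received_mem : ∀ i, 1 ≤ i → ∀ h, τ.received i h ⊆ τ.tree ρ i
  /-- An honest message is delivered on schedule or earlier. With delay `⊤` the adversary may
  deliver it at any time or never. -/
  deliver : ∀ s, 1 ≤ s → ∀ h ∈ ρ.leaders s, ∀ h', h' ≠ h → ∀ d : ℕ, ρ.delay s h h' = d →
    ∃ i, s ≤ i ∧ i ≤ s + d ∧ τ.honestBlock s h ∈ τ.received i h'
  /-- A party keeps its chain unless it receives a strictly longer one; then it adopts a longest
  received chain, with arbitrary tie-breaking. -/
  adopt : ∀ i, 1 ≤ i → ∀ h,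
    (τ.tip i h = τ.ownTip ρ i h ∨
      (τ.tip i h ∈ τ.received i h ∧ (τ.ownTip ρ i h).depth < (τ.tip i h).depth)) ∧
    ∀ b ∈ τ.received i h, b.depth ≤ (τ.tip i h).depth

/-- The common prefix property with parameters `T`, `k`, `I`. -/
def CommonPrefix (T k : ℕ) (I : Set H) : Prop :=
  ∀ h₁ ∈ I, ∀ h₂ ∈ I, ∀ s i₁ i₂ : ℕ, 1 ≤ s → s ≤ T → s + k ≤ i₁ → i₁ ≤ i₂ →
    (τ.tip i₁ h₁).segment 1 s = (τ.tip i₂ h₂).segment 1 s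

/-- The extensive chain quality property with parameters `μ`, `T`, `k`, `I` at mining rate `f`. -/
def ExtensiveChainQuality (f μ : ℝ) (T k : ℕ) (I : Set H) : Prop :=
  ∀ h ∈ I, ∀ s i : ℕ, 1 ≤ s → s ≤ T → s + k ≤ i →
    (k : ℝ) * f * μ < ((τ.tip i h).honestCount (s + 1) (s + k) : ℝ)

end Trace

/-! ### The random components -/

section Model

variable {Ω H : Type*} [MeasurableSpace Ω] (P : Measure Ω) (R : Ω → Outcome H) (Δ : Measure ℕ∞)

/-- All message delays are i.i.d. with distribution `Δ` and independent of the leader election. -/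
structure HasRandomDelays : Prop where
  measurable_delay : ∀ s h h', Measurable fun ω => (R ω).delay (s + 1) h h'
  law_delay : ∀ s h h', P.map (fun ω => (R ω).delay (s + 1) h h') = Δ
  indep_delay : iIndepFun (fun (x : ℕ × H × H) ω => (R ω).delay (x.1 + 1) x.2.1 x.2.2) P
  indep_leaders : IndepFun
    (fun ω (s : ℕ) => ((R ω).leaders (s + 1), (R ω).adv (s + 1)))
    (fun ω (x : ℕ × H × H) => (R ω).delay (x.1 + 1) x.2.1 x.2.2) P

/-- The failure rate function of a delay distribution. -/
def failureRate (s : ℕ) : ℝ :=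
  if 0 < Δ.real (Set.Ici (s : ℕ∞)) then Δ.real {(s : ℕ∞)} / Δ.real (Set.Ici (s : ℕ∞)) else 1

/-- The i.i.d. leader model: the sets of leaders are i.i.d., delays are finite and have a
non-decreasing failure rate. The set of honest parties is arbitrary; those that can ever be elected
form a countable set. -/
structure IsIIDLeaderModel : Prop where
  countable_leaders : ∃ M : Set H, M.Countable ∧ ∀ s ω, (R ω).leaders (s + 1) ⊆ M
  measurable_leaders : ∀ s, Measurable fun ω => (R ω).leaders (s + 1)
  measurable_adv : ∀ s, Measurable fun ω => (R ω).adv (s + 1)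
  indep : iIndepFun (fun (s : ℕ) ω => ((R ω).leaders (s + 1), (R ω).adv (s + 1))) P
  ident : ∀ s, IdentDistrib (fun ω => ((R ω).leaders (s + 1), (R ω).adv (s + 1)))
    (fun ω => ((R ω).leaders 1, (R ω).adv 1)) P P
  delays : HasRandomDelays P R Δ
  delay_finite : Δ {⊤} = 0
  failureRate_mono : Monotone (failureRate Δ)

/-- The one-time leader model: the honest parties `m 0, m 1, …` are elected in this order, each at
most once, with `N s` of them in slot `s`; the pairs of `N s` and the adversary's election are
i.i.d.; the delay distribution is arbitrary and may charge `⊤`. -/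
structure IsOneTimeLeaderModel : Prop where
  election : ∃ (m : ℕ → H) (N : ℕ → Ω → ℕ), Function.Injective m ∧
    (∀ s ω, (R ω).leaders (s + 1) =
      m '' Set.Ico (∑ t ∈ Finset.Icc 1 s, N t ω) (∑ t ∈ Finset.Icc 1 (s + 1), N t ω)) ∧
    (∀ s, Measurable (N (s + 1))) ∧
    (∀ s, Measurable fun ω => (R ω).adv (s + 1)) ∧
    iIndepFun (fun (s : ℕ) ω => (N (s + 1) ω, (R ω).adv (s + 1))) P ∧
    ∀ s, IdentDistrib (fun ω => (N (s + 1) ω, (R ω).adv (s + 1)))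
      (fun ω => (N 1 ω, (R ω).adv 1)) P P
  delays : HasRandomDelays P R Δ

/-- The event that the first slot has at least one leader. -/
def nonemptySlot : Set Ω := {ω | ((R ω).leaders 1).Nonempty ∨ (R ω).adv 1}

/-- The event that the first slot has a unique leader, who is honest. -/
def uniquelyHonestSlot : Set Ω := {ω | ((R ω).leaders 1).encard = 1 ∧ ¬ (R ω).adv 1}

/-- The mining rate `f`: the probability of a non-empty slot. -/
def miningRate : ℝ := P.real (nonemptySlot R)

/-- `α`: the probability that a slot is uniquely honest given that it is non-empty. -/
def uniqueHonestProb : ℝ := (ProbabilityTheory.cond P (nonemptySlot R)).real (uniquelyHonestSlot R)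

/-- The probability mass function of the geometric distribution on `{1, 2, …}`. -/
def geomPMF (f : ℝ) (g : ℕ) : ℝ := if g = 0 then 0 else (1 - f) ^ (g - 1) * f

/-- `ℙ(Δ < G)` for `G` geometric with parameter `f` and independent of `Δ`. -/
def probDelayLtGeom (f : ℝ) : ℝ := ∑' g : ℕ, geomPMF f g * Δ.real (Set.Iio (g : ℕ∞))

/-- `ε`-honest majority: `p = α ℙ(Δ < G)` satisfies `p > 1/2` and `p = (1 + ε) / 2`. -/
def EpsHonestMajority (ε : ℝ) : Prop :=
  1 / 2 < uniqueHonestProb P R * probDelayLtGeom Δ (miningRate P R) ∧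
    uniqueHonestProb P R * probDelayLtGeom Δ (miningRate P R) = (1 + ε) / 2

end Model

/-! ### The error terms -/

def pSettlement (f ε : ℝ) (k : ℕ) : ℝ :=
  Real.exp (-(k * f * ε ^ 3 / 12)) + 3 * Real.exp (-(k * f * ε ^ 2 / 32))

def pUnheard (f ε : ℝ) (k : ℕ) : ℝ :=
  2 / (1 - (1 / 2 : ℝ) ^ (ε / 2)) * Real.exp (-(k * f * ε / 16))

def pCQ (f ε μ : ℝ) (k : ℕ) : ℝ :=
  4 * Real.exp (-(k * f * (ε - μ) ^ 2 / 48))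

def pUnheardCQ (f ε μ : ℝ) (k : ℕ) : ℝ :=
  2 / (1 - (1 / 2 : ℝ) ^ (ε / 2)) * Real.exp (-(k * f * (ε - μ) / 8))

end LongestChain

end

open MeasureTheory ProbabilityTheory

noncomputable section

namespace LongestChain

/-! Call a slot special if its only leader is honest and, before the slot begins, that leader has
received (or itself mined) the block of the preceding special slot; the first special slot only
needs to be uniquely honest. The longest-chain rule then makes every special block strictly deeper
than the preceding one. A special slot carries exactly one block, and a chain has at most one block
per non-empty slot because timestamps increase. So a chain can avoid the special blocks of an
interval only where the other non-empty slots keep up with the special ones. With the walk that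
steps up at special slots and down at other non-empty slots, this becomes `exists_walk_le`: few
special blocks of a window in a chain force a small increment of the walk over an interval around
the window, up to the number of recent special blocks that the holder may not have heard of.

Two deterministic consequences follow. If a special slot `c` is a strict record of the walk that is
never undercut later (a pivot), then every chain held by a party that has heard of a recent special
block contains the block of `c`, and all these chains share their prefix (`segment_eq_of_pivot`). If
the walk gains a lot over all intervals around a window, every such chain has many honest blocks in
it (`lt_honestCount`). The adversary enters only here, so it may be clairvoyant and non-measurable;
all that remains concerns leaders and delays.

The probabilistic input is that, given the past, the next non-empty slot is not special with
probability at most `1 - p` (`SlotLaw.next_other_le`). If `g` empty slots come before it, the leader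
misses the last special block with probability at most that of `g + 1 ≤ Δ`
(`SymbolModel.measure_miss_le`): earlier failed attempts of the same leader reveal only a lower
bound on one delay, which does no harm for non-decreasing failure rates and never occurs if leaders
are fresh. Averaging over the geometric gap yields `p = (1 + ε) / 2`, so the walk has drift at least
`ε`.

Every estimate on the walk uses a potential, a function of a finite state that is non-increasing in
expectation at each step, together with a maximal inequality (`exists_runState_le`). This gives the
chance that no pivot appears among the first steps and a linear lower bound from some step on. A
Chernoff bound handles the number of non-empty slots, and the distance from the running maximum has
geometric tails by induction over the last non-empty slot. Finally, a special block is still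
undelivered to a given party at the next non-empty slot with conditional probability at most one
half, so long runs of unheard special blocks are exponentially unlikely (`exists_unheardRun_le`). A
union bound over slots and parties concludes. -/

/-! ### Marked slots and their counts -/

/-- The number of special slots (`some true`) in `(a, b]`. -/
def numSpecial (w : ℕ → Option Bool) (a b : ℕ) : ℕ :=
  ((Finset.Ioc a b).filter fun i => w i = some true).card

/-- The number of non-empty slots that are not special (`some false`) in `(a, b]`. -/
def numOther (w : ℕ → Option Bool) (a b : ℕ) : ℕ :=
  ((Finset.Ioc a b).filter fun i => w i = some false).card

/-- The excess of special over other non-empty slots in `(0, i]`. -/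
def walk (w : ℕ → Option Bool) (i : ℕ) : ℤ := numSpecial w 0 i - numOther w 0 i

theorem card_filter_Ioc_add (Q : ℕ → Prop) [DecidablePred Q] {a b c : ℕ} (hab : a ≤ b)
    (hbc : b ≤ c) : ((Finset.Ioc a b).filter Q).card + ((Finset.Ioc b c).filter Q).card =
      ((Finset.Ioc a c).filter Q).card := by
  rw [← Finset.card_union_of_disjoint, ← Finset.filter_union, Finset.Ioc_union_Ioc_eq_Ioc hab hbc]
  refine Finset.disjoint_filter_filter (Finset.disjoint_left.2 fun x hx hy => ?_)
  simp only [Finset.mem_Ioc] at hx hy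
  omega

theorem numSpecial_add (w : ℕ → Option Bool) {a b c : ℕ} (hab : a ≤ b) (hbc : b ≤ c) :
    numSpecial w a b + numSpecial w b c = numSpecial w a c := card_filter_Ioc_add _ hab hbc

theorem numOther_add (w : ℕ → Option Bool) {a b c : ℕ} (hab : a ≤ b) (hbc : b ≤ c) :
    numOther w a b + numOther w b c = numOther w a c := card_filter_Ioc_add _ hab hbc

theorem walk_sub (w : ℕ → Option Bool) {a b : ℕ} (hab : a ≤ b) :
    walk w b - walk w a = numSpecial w a b - numOther w a b := by
  have h1 := numSpecial_add w (Nat.zero_le a) hab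
  have h2 := numOther_add w (Nat.zero_le a) hab
  unfold walk
  omega

theorem card_filter_Ioc_succ (Q : ℕ → Prop) [DecidablePred Q] {a b : ℕ} (hab : a ≤ b) :
    ((Finset.Ioc a (b + 1)).filter Q).card =
      ((Finset.Ioc a b).filter Q).card + if Q (b + 1) then 1 else 0 := by
  rw [← card_filter_Ioc_add Q hab (Nat.le_succ b)]
  congr 1
  have : Finset.Ioc b (b + 1) = {b + 1} := by ext; simp only [Finset.mem_Ioc, Finset.mem_singleton]; omega
  rw [this, Finset.filter_singleton]
  split_ifs <;> simp

theorem numSpecial_succ (w : ℕ → Option Bool) {a b : ℕ} (hab : a ≤ b) :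
    numSpecial w a (b + 1) = numSpecial w a b + if w (b + 1) = some true then 1 else 0 :=
  card_filter_Ioc_succ _ hab

theorem numOther_succ (w : ℕ → Option Bool) {a b : ℕ} (hab : a ≤ b) :
    numOther w a (b + 1) = numOther w a b + if w (b + 1) = some false then 1 else 0 :=
  card_filter_Ioc_succ _ hab

@[simp] theorem numSpecial_self (w : ℕ → Option Bool) (a : ℕ) : numSpecial w a a = 0 := by
  simp [numSpecial]

@[simp] theorem numOther_self (w : ℕ → Option Bool) (a : ℕ) : numOther w a a = 0 := by
  simp [numOther]

/-! ### Chains as sets of timestamps -/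

namespace Block

variable {H Data : Type*}

/-- The timestamps of the non-genesis blocks of a chain. -/
def times : Block H Data → Finset ℕ
  | genesis => ∅
  | child b t _ _ => insert t b.times

/-- Every block of the chain is later than its parent and has the timestamp of a non-empty slot;
a block with the timestamp of a special slot `t` is `B t`. -/
def Valid (w : ℕ → Option Bool) (B : ℕ → Block H Data) : Block H Data → Prop
  | genesis => True
  | child b t o d => b.Valid w B ∧ b.time < t ∧ w t ≠ none ∧
      (w t = some true → child b t o d = B t)

variable {w : ℕ → Option Bool} {B : ℕ → Block H Data}

theorem Valid.le_time {C : Block H Data} (hC : C.Valid w B) {t : ℕ} (ht : t ∈ C.times) :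
    t ≤ C.time := by
  induction C with
  | genesis => simp [times] at ht
  | child b t' o d ih =>
    simp only [times, Finset.mem_insert] at ht
    simp only [time]
    rcases ht with rfl | ht
    · rfl
    · exact (ih hC.1 ht).trans hC.2.1.le

theorem Valid.pos_of_mem {C : Block H Data} (hC : C.Valid w B) {t : ℕ} (ht : t ∈ C.times) :
    0 < t := by
  induction C with
  | genesis => simp [times] at ht
  | child b t' o d ih =>
    simp only [times, Finset.mem_insert] at ht
    rcases ht with rfl | ht
    · exact Nat.zero_lt_of_lt hC.2.1
    · exact ih hC.1 ht

/-- Timestamps strictly increase along a valid chain, so no two of its blocks share one. This turns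
depth into a count of slots. -/
theorem Valid.card_times {C : Block H Data} (hC : C.Valid w B) : C.times.card = C.depth := by
  induction C with
  | genesis => simp [times, depth]
  | child b t' o d ih =>
    simp only [times, depth]
    rw [Finset.card_insert_of_notMem, ih hC.1]
    intro h
    exact absurd (hC.1.le_time h) (not_le.2 hC.2.1)

theorem Valid.ne_none {C : Block H Data} (hC : C.Valid w B) {t : ℕ} (ht : t ∈ C.times) :
    w t ≠ none := by
  induction C with
  | genesis => simp [times] at ht
  | child b t' o d ih =>
    simp only [times, Finset.mem_insert] at ht
    rcases ht with rfl | ht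
    · exact hC.2.2.1
    · exact ih hC.1 ht

theorem Valid.special_mem_chain {C : Block H Data} (hC : C.Valid w B) {t : ℕ} (ht : t ∈ C.times)
    (hw : w t = some true) : B t ∈ C.chain := by
  induction C with
  | genesis => simp [times] at ht
  | child b t' o d ih =>
    simp only [times, Finset.mem_insert] at ht
    simp only [chain, List.mem_cons]
    rcases ht with rfl | ht
    · exact Or.inl (hC.2.2.2 hw).symm
    · exact Or.inr (ih hC.1 ht)

theorem Valid.of_mem_chain {C b : Block H Data} (hC : C.Valid w B) (hb : b ∈ C.chain) :
    b.Valid w B := by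
  induction C with
  | genesis => simp only [chain, List.mem_singleton] at hb; subst hb; exact hC
  | child b' t' o d ih =>
    simp only [chain, List.mem_cons] at hb
    rcases hb with rfl | hb
    · exact hC
    · exact ih hC.1 hb

theorem Valid.time_le_of_mem_chain {C b : Block H Data} (hC : C.Valid w B) (hb : b ∈ C.chain) :
    b.time ≤ C.time := by
  induction C with
  | genesis => simp only [chain, List.mem_singleton] at hb; subst hb; exact le_rfl
  | child b' t' o d ih =>
    simp only [chain, List.mem_cons] at hb
    rcases hb with rfl | hb
    · exact le_rfl
    · exact (ih hC.1 hb).trans hC.2.1.le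

theorem Valid.times_of_mem_chain {C b : Block H Data} (hC : C.Valid w B) (hb : b ∈ C.chain) :
    b.times = C.times.filter (· ≤ b.time) := by
  induction C with
  | genesis => simp only [chain, List.mem_singleton] at hb; subst hb; simp [times]
  | child b' t' o d ih =>
    simp only [chain, List.mem_cons] at hb
    rcases hb with rfl | hb
    · rw [Finset.filter_true_of_mem]
      intro t ht
      exact hC.le_time ht
    · have := hC.1.time_le_of_mem_chain hb
      have h2 := hC.2.1
      rw [ih hC.1 hb, times, Finset.filter_insert, if_neg (by omega)]

/-- The blocks of `C` above `b` are later than `b`, hence later than `s`, and the segment does not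
see them. -/
theorem Valid.segment_eq {C b : Block H Data} (hC : C.Valid w B) (hb : b ∈ C.chain) {s : ℕ}
    (hs : s ≤ b.time) (a : ℕ) : C.segment a s = b.segment a s := by
  induction C with
  | genesis => simp only [chain, List.mem_singleton] at hb; subst hb; rfl
  | child b' t' o d ih =>
    simp only [chain, List.mem_cons] at hb
    rcases hb with rfl | hb
    · rfl
    · have := hC.1.time_le_of_mem_chain hb
      have h2 := hC.2.1
      rw [← ih hC.1 hb]
      unfold segment
      rw [chain, List.filter_cons_of_neg]
      intro h
      have := of_decide_eq_true h
      simp only [time] at this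
      omega

theorem Valid.card_special_le_honestCount {C : Block H Data} (hC : C.Valid w B)
    (hB : ∀ t, w t = some true → (B t).IsHonest) (a b : ℕ) :
    (C.times.filter fun t => w t = some true ∧ a ≤ t ∧ t ≤ b).card ≤ C.honestCount a b := by
  classical
  induction C with
  | genesis => simp [times]
  | child b' t' o d ih =>
    have ih := ih hC.1
    unfold honestCount segment at ih ⊢
    rw [times, Finset.filter_insert, chain]
    split_ifs with h
    · rw [List.filter_cons_of_pos, List.filter_cons_of_pos, List.length_cons]
      · exact (Finset.card_insert_le _ _).trans (Nat.add_le_add_right ih 1)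
      · rw [decide_eq_true_eq, hC.2.2.2 h.1]
        exact hB _ h.1
      · exact decide_eq_true h.2
    · refine ih.trans (List.Sublist.length_le ?_)
      exact ((List.sublist_cons_self _ _).filter _).filter _

end Block

/-! ### Executions with special slots -/

/-- `w` marks the slots of the outcome `ρ`: empty slots by `none`, special slots by `some true`.
A special slot `i` has the unique honest leader `ld i`, and `ld i` knows the block of the
preceding special slot. -/
structure Marking {H : Type*} (ρ : Outcome H) (w : ℕ → Option Bool) (ld : ℕ → H) : Prop where
  zero : w 0 = none
  empty : ∀ i, 1 ≤ i → w i = none → ρ.leaders i = ∅ ∧ ¬ ρ.adv i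
  uniq : ∀ i, w i = some true → ρ.leaders i = {ld i} ∧ ¬ ρ.adv i
  hears : ∀ j i, j < i → w j = some true → w i = some true →
    (∀ t, j < t → t < i → w t ≠ some true) →
    ld j = ld i ∨ ρ.delay j (ld j) (ld i) < ((i - j : ℕ) : ℕ∞)

/-- By the end of slot `i`, party `h` is guaranteed to know the block of the special slot `j`;
index `0` stands for genesis. -/
def Heard {H : Type*} (ρ : Outcome H) (ld : ℕ → H) (h : H) (j i : ℕ) : Prop :=
  j = 0 ∨ ld j = h ∨ ρ.delay j (ld j) h ≤ ((i - j : ℕ) : ℕ∞)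

namespace Trace.IsExecution

variable {H Data : Type*} {τ : Trace H Data} {ρ : Outcome H}

theorem tree_mono {i j : ℕ} (hij : i ≤ j) : τ.tree ρ i ⊆ τ.tree ρ j := by
  rintro b (h | ⟨s, h, h1, h2, h3⟩ | ⟨s, h1, h2, h3⟩)
  · exact Or.inl h
  · exact Or.inr (Or.inl ⟨s, h, h1, h2.trans hij, h3⟩)
  · exact Or.inr (Or.inr ⟨s, h1, h2.trans hij, h3⟩)

theorem tip_mem_tree (hτ : τ.IsExecution ρ) (i : ℕ) (h : H) : τ.tip i h ∈ τ.tree ρ i := by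
  induction i generalizing h with
  | zero => exact Or.inl (hτ.1 h)
  | succ i ih =>
    rcases (hτ.adopt (i + 1) (by omega) h).1 with h1 | h1
    · rw [h1, Trace.ownTip]
      split_ifs with h2
      · exact Or.inr (Or.inl ⟨i + 1, h, by omega, le_rfl, h2, rfl⟩)
      · exact tree_mono (Nat.le_succ i) (ih h)
    · exact hτ.received_mem _ (by omega) h h1.1

theorem depth_ownTip_le (hτ : τ.IsExecution ρ) {i : ℕ} (hi : 1 ≤ i) (h : H) :
    (τ.ownTip ρ i h).depth ≤ (τ.tip i h).depth := by
  rcases (hτ.adopt i hi h).1 with h1 | h1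
  · rw [h1]
  · exact h1.2.le

theorem depth_tip_mono (hτ : τ.IsExecution ρ) (h : H) : Monotone fun i => (τ.tip i h).depth := by
  refine monotone_nat_of_le_succ fun i => ?_
  refine le_trans ?_ (hτ.depth_ownTip_le (Nat.le_add_left 1 i) h)
  rw [Trace.ownTip]
  split_ifs
  · simp [Trace.honestBlock, Block.depth]
  · rfl

theorem time_le_of_mem_tree (hτ : τ.IsExecution ρ) {i : ℕ} {b : Block H Data}
    (hb : b ∈ τ.tree ρ i) : b.time ≤ i := by
  rcases hb with rfl | ⟨s, h, _, h2, _, rfl⟩ | ⟨s, h1, h2, h3⟩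
  · simp [Block.time]
  · exact h2
  · obtain ⟨_, t, _, rfl, _, _, h4, _⟩ := hτ.adv_valid s h1 b h3
    exact h4.trans h2

variable {w : ℕ → Option Bool} {ld : ℕ → H}

/-- The adversary may backdate blocks, but only to slots that it leads, and these are neither empty
nor special. A special slot therefore has the block of its unique leader and no other. -/
theorem valid_of_mem_tree (hτ : τ.IsExecution ρ) (hw : Marking ρ w ld) {i : ℕ}
    {b : Block H Data} (hb : b ∈ τ.tree ρ i) :
    b.Valid w fun t => τ.honestBlock t (ld t) := by
  induction b generalizing i with
  | genesis => trivial
  | child b t o d ih =>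
    rcases hb with hb | ⟨s, h, h1, h2, h3, h4⟩ | ⟨s, h1, h2, h3⟩
    · cases hb
    · simp only [Trace.honestBlock, Block.child.injEq] at h4
      obtain ⟨rfl, rfl, rfl, rfl⟩ := h4
      have hmem := hτ.tip_mem_tree (t - 1) h
      refine ⟨ih hmem, ?_, ?_, fun hs => ?_⟩
      · have := hτ.time_le_of_mem_tree hmem
        omega
      · intro hn
        simp [(hw.empty t h1 hn).1] at h3
      · rw [(hw.uniq t hs).1, Set.mem_singleton_iff] at h3
        subst h3
        rfl
    · obtain ⟨p, t', d', h4, h5, h6, h7, h8⟩ := hτ.adv_valid s h1 _ h3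
      simp only [Block.child.injEq] at h4
      obtain ⟨rfl, rfl, rfl, rfl⟩ := h4
      refine ⟨ih h5, h6, fun hn => ?_, fun hs => ?_⟩
      · exact (hw.empty t (by omega) hn).2 h8
      · exact absurd h8 (hw.uniq t hs).2

/-- After receiving a chain a party never holds a shorter one: adoption makes its chain at least as
deep as everything received, and the depth of its chain is monotone in time. -/
theorem depth_le_of_heard (hτ : τ.IsExecution ρ) (hw : Marking ρ w ld) {h : H} {j i : ℕ}
    (hj : w j = some true) (hji : j ≤ i)
    (hh : ld j = h ∨ ρ.delay j (ld j) h ≤ ((i - j : ℕ) : ℕ∞)) :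
    (τ.honestBlock j (ld j)).depth ≤ (τ.tip i h).depth := by
  have hj1 : 1 ≤ j := Nat.one_le_iff_ne_zero.2 fun h0 => by simp [h0, hw.zero] at hj
  have hmem : ld j ∈ ρ.leaders j := by simp [(hw.uniq j hj).1]
  by_cases hl : ld j = h
  · refine le_trans ?_ (hτ.depth_tip_mono h hji)
    refine le_trans ?_ (hτ.depth_ownTip_le hj1 h)
    rw [Trace.ownTip, if_pos (hl ▸ hmem), hl]
  · replace hh := hh.resolve_left hl
    obtain ⟨d, hd⟩ := ENat.ne_top_iff_exists.1 (ne_top_of_le_ne_top (ENat.natCast_ne_top _) hh)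
    rw [← hd, Nat.cast_le] at hh
    obtain ⟨i', h1, h2, h3⟩ := hτ.deliver j hj1 _ hmem h (Ne.symm hl) d hd.symm
    exact ((hτ.adopt i' (by omega) h).2 _ h3).trans (hτ.depth_tip_mono h (by omega))

theorem depth_special_lt (hτ : τ.IsExecution ρ) (hw : Marking ρ w ld) {j i : ℕ} (hji : j < i)
    (hj : w j = some true) (hi : w i = some true)
    (hbetween : ∀ t, j < t → t < i → w t ≠ some true) :
    (τ.honestBlock j (ld j)).depth < (τ.honestBlock i (ld i)).depth := by
  -- The leader of slot `i` mines on the chain held at the end of slot `i - 1`. The strict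
  -- inequality in `hears` says precisely that the message has arrived by then.
  refine Nat.lt_succ_of_le (hτ.depth_le_of_heard hw hj (by omega) ?_)
  refine (hw.hears j i hji hj hi hbetween).imp id fun h => ?_
  have h' : i - j = (i - 1 - j) + 1 := by omega
  rw [h', Nat.cast_add, Nat.cast_one] at h
  exact Order.le_of_lt_add_one h

/-- Each special slot adds at least one to the depth of the preceding special block; induction
passes from `i` to the last special slot before it. -/
theorem depth_add_numSpecial_le (hτ : τ.IsExecution ρ) (hw : Marking ρ w ld) {j i : ℕ}
    (hji : j ≤ i) (hj : w j = some true) (hi : w i = some true) :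
    (τ.honestBlock j (ld j)).depth + numSpecial w j i ≤ (τ.honestBlock i (ld i)).depth := by
  induction i using Nat.strong_induction_on with
  | _ i ih =>
    rcases hji.eq_or_lt with rfl | hlt
    · simp
    obtain ⟨l, ⟨hl1, hl2⟩, hl3⟩ : ∃ l, ((j ≤ l ∧ l < i) ∧ w l = some true) ∧
        ∀ t, l < t → t < i → w t ≠ some true := by
      have hne : ((Finset.Ico j i).filter fun t => w t = some true).Nonempty :=
        ⟨j, by simp [hlt, hj]⟩
      have hm := Finset.max'_mem _ hne
      rw [Finset.mem_filter, Finset.mem_Ico] at hm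
      refine ⟨_, hm, fun t h1 h2 h3 => ?_⟩
      have := Finset.le_max' ((Finset.Ico j i).filter fun t => w t = some true) t
        (by simp only [Finset.mem_filter, Finset.mem_Ico]; exact ⟨⟨by omega, h2⟩, h3⟩)
      omega
    have h1 := ih l hl1.2 hl1.1 hl2
    have h2 := hτ.depth_special_lt hw hl1.2 hl2 hi hl3
    have h3 := numSpecial_add w hl1.1 hl1.2.le
    have h4 : numSpecial w l i ≤ 1 := by
      refine Finset.card_le_one.2 fun a ha b hb => ?_
      simp only [Finset.mem_filter, Finset.mem_Ioc] at ha hb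
      have ha' := hl3 a ha.1.1
      have hb' := hl3 b hb.1.1
      have : a = i := by by_contra h; exact ha' (by omega) ha.2
      have : b = i := by by_contra h; exact hb' (by omega) hb.2
      omega
    omega

/-- The version that starts from genesis: the first special block has depth at least one. -/
theorem numSpecial_le_depth (hτ : τ.IsExecution ρ) (hw : Marking ρ w ld) {i : ℕ}
    (hi : w i = some true) : numSpecial w 0 i ≤ (τ.honestBlock i (ld i)).depth := by
  have hne : ((Finset.Ioc 0 i).filter fun t => w t = some true).Nonempty := by
    refine ⟨i, ?_⟩
    simp only [Finset.mem_filter, Finset.mem_Ioc, le_refl, and_true, hi]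
    exact Nat.pos_of_ne_zero fun h0 => by simp [h0, hw.zero] at hi
  have hm := Finset.min'_mem _ hne
  set l := Finset.min' _ hne with hl
  simp only [Finset.mem_filter, Finset.mem_Ioc] at hm
  have h1 := hτ.depth_add_numSpecial_le hw hm.1.2 hm.2 hi
  have h2 := numSpecial_add w (Nat.zero_le l) hm.1.2
  have h3 : numSpecial w 0 l ≤ 1 := by
    refine Finset.card_le_one.2 fun a ha b hb => ?_
    simp only [Finset.mem_filter, Finset.mem_Ioc] at ha hb
    have h4 : ∀ x, (0 < x ∧ x ≤ l) ∧ w x = some true → l ≤ x := fun x hx =>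
      Finset.min'_le _ x (by simp only [Finset.mem_filter, Finset.mem_Ioc]; exact ⟨⟨hx.1.1, by omega⟩, hx.2⟩)
    have := h4 a ha
    have := h4 b hb
    omega
  have h5 : 1 ≤ (τ.honestBlock l (ld l)).depth := by simp [Trace.honestBlock, Block.depth]
  omega

end Trace.IsExecution

/-! ### Chains that miss special blocks -/

namespace Trace.IsExecution

variable {H Data : Type*} {τ : Trace H Data} {ρ : Outcome H} {w : ℕ → Option Bool} {ld : ℕ → H}

theorem card_filter_le_eq_depth {B : ℕ → Block H Data} {C : Block H Data} (hC : C.Valid w B)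
    {r : ℕ} (hr : r ∈ C.times) (hw : w r = some true) (hB : (B r).time = r) :
    (C.times.filter (· ≤ r)).card = (B r).depth := by
  have hmem := hC.special_mem_chain hr hw
  have h := hC.times_of_mem_chain hmem
  rw [hB] at h
  rw [← h, (hC.of_mem_chain hmem).card_times]

/-- The blocks of `C` up to `l` account for exactly the depth of the special block `l` (of genesis
if `l = 0`), so the rest of `S` must make up the depth gained by the special slots in `(l, r]`. It
is applied with the timestamps up to `r` when the block of `r` lies on `C`, and with all timestamps
when that block is merely no deeper than `C`. -/
theorem numSpecial_le_card_times (hτ : τ.IsExecution ρ) (hw : Marking ρ w ld) {C : Block H Data}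
    (hC : C.Valid w fun t => τ.honestBlock t (ld t)) {l r : ℕ} (hlr : l ≤ r)
    (hl : l = 0 ∨ l ∈ C.times ∧ w l = some true) (hr : w r = some true)
    {S : Finset ℕ} (hS : S ⊆ C.times) (hS' : ∀ t ∈ C.times, t ≤ l → t ∈ S)
    (hd : (τ.honestBlock r (ld r)).depth ≤ S.card) :
    numSpecial w l r ≤ (S.filter (l < ·)).card := by
  have hsplit := Finset.card_filter_add_card_filter_not (s := S) (fun t => t ≤ l)
  simp only [not_le] at hsplit
  have hSl : S.filter (· ≤ l) = C.times.filter (· ≤ l) := by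
    ext t
    simp only [Finset.mem_filter]
    exact ⟨fun h => ⟨hS h.1, h.2⟩, fun h => ⟨hS' t h.1 h.2, h.2⟩⟩
  rcases hl with rfl | ⟨hl1, hl2⟩
  · have h1 := hτ.numSpecial_le_depth hw hr
    have h2 : (S.filter (· ≤ 0)).card = 0 := by
      rw [hSl, Finset.card_eq_zero, Finset.filter_eq_empty_iff]
      intro t ht
      have := hC.pos_of_mem ht
      omega
    omega
  · have h1 := hτ.depth_add_numSpecial_le hw hlr hl2 hr
    have h2 := card_filter_le_eq_depth hC hl1 hl2 rfl
    rw [← hSl] at h2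
    omega

/-- The chain of `h` in slot `i` lacks enough special blocks with timestamps in `(a, b]` only if
the special slots have a small majority on an interval that contains `(a, b]`. -/
theorem exists_walk_le (hτ : τ.IsExecution ρ) (hw : Marking ρ w ld) {a b i : ℕ} (hab : a ≤ b)
    (hbi : b ≤ i) (h : H) {x : ℕ}
    (hx : ((τ.tip i h).times.filter fun t => w t = some true ∧ a < t ∧ t ≤ b).card ≤ x) :
    ∃ l ≤ a, (∃ r, b ≤ r ∧ walk w r - walk w l ≤ x) ∨
      ∀ j ≤ i, j = 0 ∨ w j = some true → Heard ρ ld h j i →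
        walk w i - walk w l ≤ x + numSpecial w j i := by
  have hmemtree := hτ.tip_mem_tree i h
  have hC := hτ.valid_of_mem_tree hw hmemtree
  have hCi := hτ.time_le_of_mem_tree hmemtree
  have hdepth : ∀ j ≤ i, w j = some true → Heard ρ ld h j i →
      (τ.honestBlock j (ld j)).depth ≤ (τ.tip i h).depth := fun j hji hj hh =>
    hτ.depth_le_of_heard hw hj hji
      (hh.resolve_left fun h0 => by simp [h0, hw.zero] at hj)
  set C := τ.tip i h with hCdef
  -- `l` is the last special timestamp of the chain up to `a`, or genesis. Special blocks of the
  -- chain after `l` are then later than `a`.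
  obtain ⟨l, hla, hl, hl'⟩ : ∃ l ≤ a, (l = 0 ∨ l ∈ C.times ∧ w l = some true) ∧
      ∀ t ∈ C.times, w t = some true → l < t → a < t := by
    by_cases hne : (C.times.filter fun t => w t = some true ∧ t ≤ a).Nonempty
    · have hm := Finset.max'_mem _ hne
      rw [Finset.mem_filter] at hm
      refine ⟨_, hm.2.2, Or.inr ⟨hm.1, hm.2.1⟩, fun t h1 h2 h3 => ?_⟩
      by_contra h4
      exact absurd (Finset.le_max' _ t (Finset.mem_filter.2 ⟨h1, h2, not_lt.1 h4⟩)) (not_le.2 h3)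
    · refine ⟨0, Nat.zero_le a, Or.inl rfl, fun t h1 h2 h3 => ?_⟩
      by_contra h4
      exact hne ⟨t, Finset.mem_filter.2 ⟨h1, h2, not_lt.1 h4⟩⟩
  -- A block of the chain in `(l, r]` is either special, hence in `(a, b]` and one of at most `x`,
  -- or it uses up one of the other non-empty slots.
  have hcount : ∀ r, (∀ t ∈ C.times, w t = some true → t ≤ r → t ≤ b) →
      (C.times.filter fun t => l < t ∧ t ≤ r).card ≤ x + numOther w l r := by
    intro r hr
    refine le_trans ?_ (Nat.add_le_add_right hx _)
    refine le_trans (Finset.card_le_card ?_) (Finset.card_union_le _ _)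
    intro t ht
    simp only [Finset.mem_filter] at ht
    simp only [Finset.mem_union, Finset.mem_filter, Finset.mem_Ioc]
    obtain ⟨ht1, ht2, ht3⟩ := ht
    rcases hwt : w t with _ | _ | _
    · exact absurd hwt (hC.ne_none ht1)
    · exact Or.inr ⟨⟨ht2, ht3⟩, rfl⟩
    · exact Or.inl ⟨ht1, rfl, hl' t ht1 hwt ht2, hr t ht1 hwt ht3⟩
  refine ⟨l, hla, ?_⟩
  -- If the chain has a special block after `b`, let `r` be the first one: its depth is known
  -- exactly, and removing `r` itself leaves the interval `(l, r - 1]`. Otherwise the depth of the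
  -- chain is compared with a special block `j` that `h` has heard of.
  by_cases hne : (C.times.filter fun t => w t = some true ∧ b < t).Nonempty
  · left
    have hm := Finset.min'_mem _ hne
    set r := Finset.min' _ hne with hrdef
    rw [Finset.mem_filter] at hm
    obtain ⟨hr1, hr2, hr3⟩ := hm
    refine ⟨r - 1, by omega, ?_⟩
    have hcr := hcount (r - 1) (fun t h1 h2 h3 => by
      by_contra h4
      have := Finset.min'_le (C.times.filter fun t => w t = some true ∧ b < t) t
        (Finset.mem_filter.2 ⟨h1, h2, not_le.1 h4⟩)
      rw [← hrdef] at this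
      omega)
    have h1 := hτ.numSpecial_le_card_times hw hC (show l ≤ r by omega) hl hr2
      (Finset.filter_subset (· ≤ r) C.times)
      (fun t ht htl => Finset.mem_filter.2 ⟨ht, by omega⟩)
      (card_filter_le_eq_depth hC hr1 hr2 rfl).ge
    have h2 : (((C.times.filter (· ≤ r)).filter (l < ·))).card ≤
        (C.times.filter fun t => l < t ∧ t ≤ r - 1).card + 1 := by
      refine le_trans (Finset.card_le_card ?_) (Finset.card_insert_le r _)
      intro t ht
      simp only [Finset.mem_filter, Finset.mem_insert] at ht ⊢
      by_cases htr : t = r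
      · exact Or.inl htr
      · exact Or.inr ⟨ht.1.1, ht.2, by omega⟩
    have h3 : numSpecial w l r = numSpecial w l (r - 1) + 1 := by
      conv_lhs => rw [show r = (r - 1) + 1 by omega]
      rw [numSpecial_succ w (by omega), if_pos (by rwa [show r - 1 + 1 = r by omega])]
    rw [walk_sub w (by omega)]
    omega
  · right
    intro j hji hj hh
    have hci := hcount i (fun t h1 h2 h3 => by
      by_contra h4
      exact hne ⟨t, Finset.mem_filter.2 ⟨h1, h2, not_le.1 h4⟩⟩)
    rw [walk_sub w (by omega)]
    -- For `j ≤ l` the bound is trivial: the walk cannot gain more over `(l, i]` than the number of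
    -- special slots in it.
    rcases le_or_gt j l with hjl | hjl
    · have := numSpecial_add w hjl (show l ≤ i by omega)
      omega
    · replace hj := hj.resolve_left (by omega)
      have h1 := hτ.numSpecial_le_card_times hw hC hjl.le hl hj (Finset.Subset.refl _)
        (fun t ht _ => ht) ((hdepth j hji hj hh).trans hC.card_times.ge)
      have h2 : (C.times.filter (l < ·)).card ≤
          (C.times.filter fun t => l < t ∧ t ≤ i).card := by
        refine Finset.card_le_card fun t ht => ?_
        simp only [Finset.mem_filter] at ht ⊢
        exact ⟨ht.1, ht.2, (hC.le_time ht.1).trans hCi⟩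
      have h3 := numSpecial_add w hjl.le hji
      omega

/-- A special slot with a majority of special slots on all intervals around it fixes the prefix of
all chains that are long enough. -/
theorem segment_eq_of_pivot (hτ : τ.IsExecution ρ) (hw : Marking ρ w ld) {s c i : ℕ}
    (hsc : s < c) (hci : c ≤ i) (hc : w c = some true)
    (hpast : ∀ a < c, walk w a < walk w c) (hfut : ∀ b, c ≤ b → walk w c ≤ walk w b) (h : H)
    (hh : ∃ j ≤ i, (j = 0 ∨ w j = some true) ∧ Heard ρ ld h j i ∧
      numSpecial w j i ≤ walk w i - walk w c) :
    (τ.tip i h).segment 1 s = (τ.honestBlock c (ld c)).segment 1 s := by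
  have hC := hτ.valid_of_mem_tree hw (hτ.tip_mem_tree i h)
  have hmem : c ∈ (τ.tip i h).times := by
    by_contra hnot
    -- The window is the single slot `c`. An interval around it without a gain of the walk
    -- contradicts the strict record from the past together with the lower bound on the future; the
    -- second alternative is excluded by the recent block that `h` has heard of.
    obtain ⟨l, hl, hor⟩ := hτ.exists_walk_le hw (Nat.sub_le c 1) hci h (x := 0) (by
      rw [Nat.le_zero, Finset.card_eq_zero, Finset.filter_eq_empty_iff]
      rintro t ht ⟨_, h1, h2⟩
      exact hnot ((show t = c by omega) ▸ ht))
    have hlc := hpast l (by omega)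
    rcases hor with ⟨r, hr, hrl⟩ | hor
    · have := hfut r hr
      simp only [Nat.cast_zero] at hrl
      omega
    · obtain ⟨j, hji, hj, hj2, hj3⟩ := hh
      have := hor j hji hj hj2
      simp only [Nat.cast_zero] at this
      omega
  exact hC.segment_eq (hC.special_mem_chain hmem hc) hsc.le 1

/-- A large majority of special slots on all intervals around `(s, s + k]` yields many honestly
mined blocks in this window. -/
theorem lt_honestCount (hτ : τ.IsExecution ρ) (hw : Marking ρ w ld) {s k i : ℕ} (hi : s + k ≤ i)
    (h : H) (y : ℝ) (hint : ∀ a ≤ s, ∀ b, s + k ≤ b → y < walk w b - walk w a)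
    (hh : ∃ j ≤ i, (j = 0 ∨ w j = some true) ∧ Heard ρ ld h j i ∧
      ∀ a ≤ s, y + numSpecial w j i < walk w i - walk w a) :
    y < ((τ.tip i h).honestCount (s + 1) (s + k) : ℝ) := by
  have hC := hτ.valid_of_mem_tree hw (hτ.tip_mem_tree i h)
  refine lt_of_lt_of_le ?_ (Nat.cast_le.2 (hC.card_special_le_honestCount (fun t _ => rfl) _ _))
  obtain ⟨l, hl, hor⟩ := hτ.exists_walk_le hw (Nat.le_add_right s k) hi h le_rfl
  simp only [Nat.lt_iff_add_one_le] at hor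
  rcases hor with ⟨r, hr, hrl⟩ | hor
  · have h1 := hint l hl r hr
    have h2 := (Int.cast_le (R := ℝ)).2 hrl
    push_cast at h2
    exact h1.trans_le h2
  · obtain ⟨j, hji, hj, hj2, hj3⟩ := hh
    have h1 := hj3 l hl
    have h2 := (Int.cast_le (R := ℝ)).2 (hor j hji hj hj2)
    push_cast at h2
    linarith

end Trace.IsExecution

/-! ### Potentials of processes driven by biased steps -/

section Potential

variable {Ω 𝒵 : Type*} [MeasurableSpace Ω] {P : Measure Ω} {Z : ℕ → Ω → 𝒵} {X : ℕ → Ω → Bool}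
  {upd : 𝒵 → Bool → 𝒵} {q l : ℝ} {V : 𝒵 → ℝ}

/-- If an unfavourable step has conditional probability at most `q` and `V` decreases by the
factor `l` in expectation under independent steps, then so it does for the process. -/
theorem lintegral_potential_succ_le (hZ : ∀ n (S : Set 𝒵), MeasurableSet {ω | Z n ω ∈ S})
    (hX : ∀ n, MeasurableSet {ω | X n ω = false})
    (hupd : ∀ n ω, Z (n + 1) ω = upd (Z n ω) (X n ω))
    (hq0 : 0 ≤ q) (hl : 0 ≤ l)
    (n : ℕ) (hstep : ∀ S : Set 𝒵, P {ω | Z n ω ∈ S ∧ X n ω = false} ≤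
      ENNReal.ofReal q * P {ω | Z n ω ∈ S})
    (hV0 : ∀ z, 0 ≤ V z) (hmono : ∀ z, V (upd z true) ≤ V (upd z false))
    (hV : ∀ z, (1 - q) * V (upd z true) + q * V (upd z false) ≤ l * V z) :
    ∫⁻ ω, ENNReal.ofReal (V (Z (n + 1) ω)) ∂P ≤
      ENNReal.ofReal l * ∫⁻ ω, ENNReal.ofReal (V (Z n ω)) ∂P := by
  let _ : MeasurableSpace 𝒵 := ⊤
  have hZm : Measurable (Z n) := fun S _ => hZ n S
  have hmeas : ∀ φ : 𝒵 → ENNReal, Measurable φ := fun φ => measurable_from_top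
  have hcomp : ∀ φ : 𝒵 → ENNReal, Measurable fun ω => φ (Z n ω) := fun φ => (hmeas φ).comp hZm
  set B : Set Ω := {ω | X n ω = false}
  -- The hypothesis on conditional probabilities, restated as a domination of measures on the state
  -- space. An upper bound on unfavourable steps suffices because `V` is larger after such a step,
  -- so the excess `ψ` below is non-negative.
  have hle : (P.restrict B).map (Z n) ≤ ENNReal.ofReal q • P.map (Z n) := by
    refine Measure.le_iff.2 fun S hS => ?_
    rw [Measure.map_apply hZm hS, Measure.smul_apply, Measure.map_apply hZm hS,
      Measure.restrict_apply (hZm hS), smul_eq_mul]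
    exact hstep S
  set φ : 𝒵 → ENNReal := fun z => ENNReal.ofReal (V (upd z true)) with hφ
  set ψ : 𝒵 → ENNReal := fun z => ENNReal.ofReal (V (upd z false) - V (upd z true)) with hψ
  calc ∫⁻ ω, ENNReal.ofReal (V (Z (n + 1) ω)) ∂P
      ≤ ∫⁻ ω, (φ (Z n ω) + B.indicator (fun ω => ψ (Z n ω)) ω) ∂P := by
        refine lintegral_mono fun ω => ?_
        simp only [hupd n ω]
        rcases hx : X n ω with _ | _
        · rw [Set.indicator_of_mem (show ω ∈ B from hx), hφ, hψ]
          simp only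
          rw [← ENNReal.ofReal_add (hV0 _) (by linarith [hmono (Z n ω)])]
          exact ENNReal.ofReal_le_ofReal (by linarith)
        · simp [hφ]
    _ = ∫⁻ ω, φ (Z n ω) ∂P + ∫⁻ z, ψ z ∂((P.restrict B).map (Z n)) := by
        rw [lintegral_add_left (hcomp φ), lintegral_indicator (hX n),
          lintegral_map (hmeas ψ) hZm]
    _ ≤ ∫⁻ ω, φ (Z n ω) ∂P + ENNReal.ofReal q * ∫⁻ z, ψ z ∂(P.map (Z n)) := by
        gcongr
        exact (lintegral_mono' hle le_rfl).trans_eq (by rw [lintegral_smul_measure, smul_eq_mul])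
    _ = ∫⁻ ω, (φ (Z n ω) + ENNReal.ofReal q * ψ (Z n ω)) ∂P := by
        rw [lintegral_map (hmeas ψ) hZm, lintegral_add_left (hcomp φ),
          lintegral_const_mul _ (hcomp ψ)]
    _ ≤ ∫⁻ ω, ENNReal.ofReal l * ENNReal.ofReal (V (Z n ω)) ∂P := by
        refine lintegral_mono fun ω => ?_
        simp only [hφ, hψ]
        have h1 := hmono (Z n ω)
        rw [← ENNReal.ofReal_mul hq0, ← ENNReal.ofReal_mul hl, ← ENNReal.ofReal_add (hV0 _)
          (mul_nonneg hq0 (by linarith))]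
        refine ENNReal.ofReal_le_ofReal ?_
        have := hV (Z n ω)
        linarith
    _ = ENNReal.ofReal l * ∫⁻ ω, ENNReal.ofReal (V (Z n ω)) ∂P :=
        lintegral_const_mul _ (hcomp fun z => ENNReal.ofReal (V z))

theorem lintegral_potential_le (hZ : ∀ n (S : Set 𝒵), MeasurableSet {ω | Z n ω ∈ S})
    (hX : ∀ n, MeasurableSet {ω | X n ω = false})
    (hupd : ∀ n ω, Z (n + 1) ω = upd (Z n ω) (X n ω))
    (hq0 : 0 ≤ q) (hl : 0 ≤ l)
    (hstep : ∀ n (S : Set 𝒵), P {ω | Z n ω ∈ S ∧ X n ω = false} ≤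
      ENNReal.ofReal q * P {ω | Z n ω ∈ S})
    (hV0 : ∀ z, 0 ≤ V z) (hmono : ∀ z, V (upd z true) ≤ V (upd z false))
    (hV : ∀ z, (1 - q) * V (upd z true) + q * V (upd z false) ≤ l * V z) (n : ℕ) :
    ∫⁻ ω, ENNReal.ofReal (V (Z n ω)) ∂P ≤
      ENNReal.ofReal (l ^ n) * ∫⁻ ω, ENNReal.ofReal (V (Z 0 ω)) ∂P := by
  induction n with
  | zero => simp
  | succ n ih =>
    refine (lintegral_potential_succ_le hZ hX hupd hq0 hl n (hstep n) hV0 hmono hV).trans ?_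
    refine (mul_le_mul_right ih _).trans ?_
    rw [← mul_assoc, ← ENNReal.ofReal_mul hl, ← pow_succ']

/-- Markov's inequality. -/
theorem measure_le_lintegral_potential (hZ : ∀ n (S : Set 𝒵), MeasurableSet {ω | Z n ω ∈ S}) (n : ℕ)
    {S : Set 𝒵} (hS : ∀ z ∈ S, 1 ≤ V z) :
    P {ω | Z n ω ∈ S} ≤ ∫⁻ ω, ENNReal.ofReal (V (Z n ω)) ∂P := by
  rw [← lintegral_indicator_one (hZ n S)]
  refine lintegral_mono fun ω => ?_
  by_cases h : Z n ω ∈ S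
  · rw [Set.indicator_of_mem (show ω ∈ {ω | Z n ω ∈ S} from h)]
    simpa using hS _ h
  · rw [Set.indicator_of_notMem (show ω ∉ {ω | Z n ω ∈ S} from h)]
    exact bot_le

end Potential

/-! ### The law of the marked slots -/

/-- The set of sequences depends only on the slots up to `t`. -/
def DependsUpTo (t : ℕ) (𝒜 : Set (ℕ → Option Bool)) : Prop :=
  ∀ w v : ℕ → Option Bool, (∀ i ≤ t, w i = v i) → w ∈ 𝒜 → v ∈ 𝒜

/-- All slots in `(t, t + g]` are empty. -/
def EmptyGap (w : ℕ → Option Bool) (t g : ℕ) : Prop := ∀ i, t < i → i ≤ t + g → w i = none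

/-- Non-empty slots occur independently with probability `f`. Given the past, a non-empty slot
that is preceded by at least `g` empty ones is special with probability at least `π (g + 1)`; the
first one is special with probability at least `α`. -/
structure SlotLaw {Ω : Type*} [MeasurableSpace Ω] (P : Measure Ω) (o : Ω → ℕ → Option Bool)
    (f α p : ℝ) (π : ℕ → ℝ) : Prop where
  meas : ∀ i v, MeasurableSet {ω | o ω i = v}
  f_pos : 0 < f
  f_le : f ≤ 1
  pi_nonneg : ∀ g, 0 ≤ π g
  pi_le : ∀ g, π g ≤ α
  alpha_le : α ≤ 1
  hasSum : HasSum (fun g : ℕ => (1 - f) ^ g * f * π (g + 1)) p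
  empty_gap : ∀ t g 𝒜, DependsUpTo t 𝒜 →
    P.real {ω | o ω ∈ 𝒜 ∧ EmptyGap (o ω) t g} = P.real {ω | o ω ∈ 𝒜} * (1 - f) ^ g
  other_gap : ∀ t g 𝒜, DependsUpTo t 𝒜 →
    P.real {ω | o ω ∈ 𝒜 ∧ EmptyGap (o ω) t g ∧ o ω (t + g + 1) = some false} ≤
      P.real {ω | o ω ∈ 𝒜} * ((1 - f) ^ g * f * (1 - π (g + 1)))
  first_other : ∀ g, P.real {ω | EmptyGap (o ω) 0 g ∧ o ω (0 + g + 1) = some false} ≤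
    (1 - f) ^ g * f * (1 - α)

namespace SlotLaw

variable {Ω : Type*} [MeasurableSpace Ω] {P : Measure Ω}
  {o : Ω → ℕ → Option Bool} {f α p : ℝ} {π : ℕ → ℝ}

theorem measurableSet (h : SlotLaw P o f α p π) {t : ℕ} {𝒜 : Set (ℕ → Option Bool)}
    (hA : DependsUpTo t 𝒜) : MeasurableSet {ω | o ω ∈ 𝒜} := by
  have : {ω | o ω ∈ 𝒜} = ⋃ v ∈ {v : Fin (t + 1) → Option Bool |
      (fun i => if hi : i < t + 1 then v ⟨i, hi⟩ else none) ∈ 𝒜}, ⋂ i : Fin (t + 1), {ω | o ω i = v i} := by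
    ext ω
    simp only [Set.mem_ofPred_eq, Set.mem_iUnion, Set.mem_iInter, exists_prop]
    constructor
    · intro hω
      refine ⟨fun i => o ω i, hA _ _ (fun i hi => ?_) hω, fun i => rfl⟩
      simp [Nat.lt_succ_of_le hi]
    · rintro ⟨v, hv, hv2⟩
      refine hA _ _ (fun i hi => ?_) hv
      simp [Nat.lt_succ_of_le hi, hv2 ⟨i, Nat.lt_succ_of_le hi⟩]
  rw [this]
  exact MeasurableSet.biUnion (Set.to_countable _) fun v _ => MeasurableSet.iInter fun i =>
    h.meas i _

theorem hasSum_geom (h : SlotLaw P o f α p π) : HasSum (fun g : ℕ => (1 - f) ^ g * f) 1 := by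
  have := (hasSum_geometric_of_lt_one (by linarith [h.f_le]) (show 1 - f < 1 by linarith [h.f_pos])).mul_right f
  rwa [show (1 - (1 - f))⁻¹ * f = 1 by field_simp [h.f_pos.ne']; simp] at this

theorem hasSum_compl (h : SlotLaw P o f α p π) :
    HasSum (fun g : ℕ => (1 - f) ^ g * f * (1 - π (g + 1))) (1 - p) := by
  have := h.hasSum_geom.sub h.hasSum
  simpa only [mul_sub, mul_one] using this

theorem p_le_one (h : SlotLaw P o f α p π) : p ≤ 1 := by
  have := h.hasSum_compl.nonneg fun g => mul_nonneg (mul_nonneg (pow_nonneg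
    (by linarith [h.f_le]) _) h.f_pos.le) (by linarith [h.pi_le (g + 1), h.alpha_le])
  linarith

/-- The next non-empty slot is not special with conditional probability at most `1 - p`. -/
theorem next_other_le [IsProbabilityMeasure P] (h : SlotLaw P o f α p π) {t : ℕ}
    {𝒜 : Set (ℕ → Option Bool)} (hA : DependsUpTo t 𝒜) :
    P {ω | o ω ∈ 𝒜 ∧ ∃ g, EmptyGap (o ω) t g ∧ o ω (t + g + 1) = some false} ≤
      ENNReal.ofReal (1 - p) * P {ω | o ω ∈ 𝒜} := by
  have hsub : {ω | o ω ∈ 𝒜 ∧ ∃ g, EmptyGap (o ω) t g ∧ o ω (t + g + 1) = some false} ⊆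
      ⋃ g, {ω | o ω ∈ 𝒜 ∧ EmptyGap (o ω) t g ∧ o ω (t + g + 1) = some false} := by
    rintro ω ⟨h1, g, h2⟩
    exact Set.mem_iUnion.2 ⟨g, h1, h2⟩
  have hnn : ∀ g : ℕ, 0 ≤ (1 - f) ^ g * f * (1 - π (g + 1)) := fun g => mul_nonneg (mul_nonneg
    (pow_nonneg (by linarith [h.f_le]) _) h.f_pos.le) (by linarith [h.pi_le (g + 1), h.alpha_le])
  refine (measure_mono hsub).trans ((measure_iUnion_le _).trans ?_)
  -- The bounds for the gap lengths `g` are geometric weights times `1 - π (g + 1)`, and these sum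
  -- to `1 - p`.
  rw [← h.hasSum_compl.tsum_eq, ENNReal.ofReal_tsum_of_nonneg hnn h.hasSum_compl.summable,
    ← ENNReal.tsum_mul_right]
  refine ENNReal.tsum_le_tsum fun g => ?_
  rw [← ofReal_measureReal, ← ofReal_measureReal, ← ENNReal.ofReal_mul (hnn g), mul_comm]
  exact ENNReal.ofReal_le_ofReal (h.other_gap t g 𝒜 hA)

end SlotLaw

/-! ### The walk after a given slot -/

/-- The number of non-empty slots in `(a, b]`. -/
def numNonempty (w : ℕ → Option Bool) (a b : ℕ) : ℕ := numSpecial w a b + numOther w a b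

theorem numNonempty_add (w : ℕ → Option Bool) {a b c : ℕ} (hab : a ≤ b) (hbc : b ≤ c) :
    numNonempty w a b + numNonempty w b c = numNonempty w a c := by
  have h1 := numSpecial_add w hab hbc
  have h2 := numOther_add w hab hbc
  unfold numNonempty
  omega

theorem numNonempty_succ (w : ℕ → Option Bool) {a b : ℕ} (hab : a ≤ b) :
    numNonempty w a (b + 1) = numNonempty w a b + if w (b + 1) = none then 0 else 1 := by
  unfold numNonempty
  rw [numSpecial_succ w hab, numOther_succ w hab]
  rcases w (b + 1) with _ | _ | _ <;> simp <;> omega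

theorem numNonempty_mono (w : ℕ → Option Bool) {a b c : ℕ} (hab : a ≤ b) (hbc : b ≤ c) :
    numNonempty w a b ≤ numNonempty w a c := by
  rw [← numNonempty_add w hab hbc]
  exact Nat.le_add_right _ _

theorem numNonempty_lt (w : ℕ → Option Bool) {a b c : ℕ} (hab : a ≤ b) (hbc : b < c)
    (hc : w c ≠ none) : numNonempty w a b < numNonempty w a c := by
  obtain ⟨c, rfl⟩ : ∃ c', c = c' + 1 := ⟨c - 1, by omega⟩
  rw [numNonempty_succ w (by omega), if_neg hc]
  exact Nat.lt_succ_of_le (numNonempty_mono w hab (by omega))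

theorem numSpecial_congr {w w' : ℕ → Option Bool} {a b : ℕ} (h : ∀ i ≤ b, w i = w' i) :
    numSpecial w a b = numSpecial w' a b := by
  unfold numSpecial
  congr 1
  refine Finset.filter_congr fun i hi => ?_
  rw [h i (Finset.mem_Ioc.1 hi).2]

theorem numOther_congr {w w' : ℕ → Option Bool} {a b : ℕ} (h : ∀ i ≤ b, w i = w' i) :
    numOther w a b = numOther w' a b := by
  unfold numOther
  congr 1
  refine Finset.filter_congr fun i hi => ?_
  rw [h i (Finset.mem_Ioc.1 hi).2]

theorem numNonempty_congr {w w' : ℕ → Option Bool} {a b : ℕ} (h : ∀ i ≤ b, w i = w' i) :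
    numNonempty w a b = numNonempty w' a b := by
  rw [numNonempty, numNonempty, numSpecial_congr h, numOther_congr h]

/-- Slot `t` is the `n`-th non-empty slot after slot `s`; slot `s` itself counts as number `0`. -/
def IsNth (w : ℕ → Option Bool) (s n t : ℕ) : Prop :=
  (n = 0 ∧ t = s) ∨ (s < t ∧ w t ≠ none ∧ numNonempty w s t = n)

theorem IsNth.le {w : ℕ → Option Bool} {s n t : ℕ} (h : IsNth w s n t) : s ≤ t := by
  rcases h with h | h <;> omega

theorem IsNth.numNonempty_eq {w : ℕ → Option Bool} {s n t : ℕ} (h : IsNth w s n t) :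
    numNonempty w s t = n := by
  rcases h with ⟨rfl, rfl⟩ | h
  · simp [numNonempty]
  · exact h.2.2

theorem IsNth.congr {w w' : ℕ → Option Bool} {s n t : ℕ} (h : IsNth w s n t)
    (hw : ∀ i ≤ t, w i = w' i) : IsNth w' s n t := by
  refine h.imp id fun h => ⟨h.1, ?_, ?_⟩
  · rw [← hw t le_rfl]; exact h.2.1
  · rw [← numNonempty_congr hw]; exact h.2.2

theorem IsNth.unique {w : ℕ → Option Bool} {s n t t' : ℕ} (h : IsNth w s n t)
    (h' : IsNth w s n t') : t = t' := by
  wlog hlt : t < t' generalizing t t'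
  · rcases lt_trichotomy t t' with h1 | h1 | h1
    · exact absurd h1 hlt
    · exact h1
    · exact (this h' h h1).symm
  have h1 := h.le
  have hne : w t' ≠ none := by
    rcases h' with h' | h'
    · omega
    · exact h'.2.1
  have := numNonempty_lt w h1 hlt hne
  rw [h.numNonempty_eq, h'.numNonempty_eq] at this
  omega

theorem exists_isNth (w : ℕ → Option Bool) {s n b : ℕ} (hb : s ≤ b) (hn : n ≤ numNonempty w s b) :
    ∃ t ≤ b, IsNth w s n t := by
  induction b, hb using Nat.le_induction with
  | base => exact ⟨s, le_rfl, Or.inl ⟨by simpa [numNonempty] using hn, rfl⟩⟩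
  | succ b hb ih =>
    by_cases h1 : n ≤ numNonempty w s b
    · obtain ⟨t, h2, h3⟩ := ih h1
      exact ⟨t, by omega, h3⟩
    · rw [numNonempty_succ w hb] at hn
      refine ⟨b + 1, le_rfl, Or.inr ⟨by omega, ?_, ?_⟩⟩
      · intro h0
        rw [if_pos h0] at hn
        omega
      · rw [numNonempty_succ w hb]
        split_ifs at hn ⊢ <;> omega

open Classical in
/-- Step `n` of the walk after slot `s`: it is unfavourable if the `(n + 1)`-st non-empty slot
after `s` exists and is not special. -/
def step (w : ℕ → Option Bool) (s n : ℕ) : Bool :=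
  decide (¬ ∃ t, IsNth w s (n + 1) t ∧ w t = some false)

theorem step_eq_false {w : ℕ → Option Bool} {s n : ℕ} :
    step w s n = false ↔ ∃ t, IsNth w s (n + 1) t ∧ w t = some false := by
  simp only [step, decide_eq_false_iff_not, not_not]

/-- The first `n` steps are read off from the slots up to the `n`-th non-empty one. This makes the
state after `n` steps part of the past at that slot. -/
theorem IsNth.step_congr {w w' : ℕ → Option Bool} {s n t : ℕ} (h : IsNth w s n t)
    (hw : ∀ i ≤ t, w i = w' i) {m : ℕ} (hm : m < n) : step w s m = step w' s m := by
  have key : ∀ {w w' : ℕ → Option Bool}, IsNth w s n t → (∀ i ≤ t, w i = w' i) →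
      step w s m = false → step w' s m = false := by
    intro w w' h hw h1
    rw [step_eq_false] at h1 ⊢
    obtain ⟨t', h2, h3⟩ := h1
    have ht' : t' ≤ t := by
      by_contra hlt
      have := numNonempty_lt w h.le (not_le.1 hlt) (by simp [h3])
      rw [h.numNonempty_eq, h2.numNonempty_eq] at this
      omega
    exact ⟨t', h2.congr fun i hi => hw i (hi.trans ht'), by rw [← hw t' ht', h3]⟩
  have h1 := key h hw
  have h2 := key (h.congr hw) (fun i hi => (hw i hi).symm)
  cases h3 : step w s m <;> cases h4 : step w' s m <;> simp_all

/-- The state after `n` steps of a process that is driven by the walk after slot `s`. -/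
def runState {𝒵 : Type*} (upd : 𝒵 → Bool → 𝒵) (z₀ : 𝒵) (w : ℕ → Option Bool) (s : ℕ) : ℕ → 𝒵
  | 0 => z₀
  | n + 1 => upd (runState upd z₀ w s n) (step w s n)

theorem IsNth.runState_congr {𝒵 : Type*} {upd : 𝒵 → Bool → 𝒵} {z₀ : 𝒵}
    {w w' : ℕ → Option Bool} {s n t : ℕ} (h : IsNth w s n t) (hw : ∀ i ≤ t, w i = w' i)
    {m : ℕ} (hm : m ≤ n) : runState upd z₀ w s m = runState upd z₀ w' s m := by
  induction m with
  | zero => rfl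
  | succ m ih => rw [runState, runState, ih (by omega), h.step_congr hw (by omega)]

namespace SlotLaw

variable {Ω 𝒵 : Type*} [MeasurableSpace Ω] {P : Measure Ω}
  {o : Ω → ℕ → Option Bool} {f α p : ℝ} {π : ℕ → ℝ}

theorem measurableSet_step (h : SlotLaw P o f α p π) (s n : ℕ) :
    MeasurableSet {ω | step (o ω) s n = false} := by
  have : {ω | step (o ω) s n = false} =
      ⋃ t, {ω | o ω ∈ {w | IsNth w s (n + 1) t ∧ w t = some false}} := by
    ext ω
    simp only [step_eq_false, Set.mem_ofPred_eq, Set.mem_iUnion]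
  rw [this]
  refine MeasurableSet.iUnion fun t => h.measurableSet (t := t) fun w w' hw hA => ?_
  exact ⟨hA.1.congr hw, by rw [← hw t le_rfl]; exact hA.2⟩

theorem measurableSet_runState (h : SlotLaw P o f α p π) (upd : 𝒵 → Bool → 𝒵) (s : ℕ)
    {z₀ : (ℕ → Option Bool) → 𝒵} (hz : ∀ w w', (∀ i ≤ s, w i = w' i) → z₀ w = z₀ w') (n : ℕ)
    (S : Set 𝒵) : MeasurableSet {ω | runState upd (z₀ (o ω)) (o ω) s n ∈ S} := by
  induction n generalizing S with
  | zero =>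
    refine h.measurableSet (t := s) (𝒜 := {w | z₀ w ∈ S}) fun w w' hw hA => ?_
    rw [Set.mem_ofPred_eq, ← hz w w' hw]
    exact hA
  | succ n ih =>
    have hst := h.measurableSet_step s n
    have : {ω | runState upd (z₀ (o ω)) (o ω) s (n + 1) ∈ S} =
        ({ω | runState upd (z₀ (o ω)) (o ω) s n ∈ {z | upd z false ∈ S}} ∩
          {ω | step (o ω) s n = false}) ∪
        ({ω | runState upd (z₀ (o ω)) (o ω) s n ∈ {z | upd z true ∈ S}} ∩
          {ω | step (o ω) s n = false}ᶜ) := by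
      ext ω
      simp only [runState, Set.mem_ofPred_eq, Set.mem_union, Set.mem_inter_iff, Set.mem_compl_iff]
      cases step (o ω) s n <;> simp
    rw [this]
    exact ((ih _).inter hst).union ((ih _).inter hst.compl)

/-- Given the past, a step of the walk is unfavourable with probability at most `1 - p`. -/
theorem step_le [IsProbabilityMeasure P] (h : SlotLaw P o f α p π) (upd : 𝒵 → Bool → 𝒵) (s : ℕ)
    {z₀ : (ℕ → Option Bool) → 𝒵} (hz : ∀ w w', (∀ i ≤ s, w i = w' i) → z₀ w = z₀ w') (n : ℕ)
    (S : Set 𝒵) :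
    P {ω | runState upd (z₀ (o ω)) (o ω) s n ∈ S ∧ step (o ω) s n = false} ≤
      ENNReal.ofReal (1 - p) * P {ω | runState upd (z₀ (o ω)) (o ω) s n ∈ S} := by
  -- The random time of the `n`-th non-empty slot is decomposed by its value `t`, as for a stopping
  -- time. These events are disjoint in `t`, so the bounds add up again below. An unfavourable step
  -- presupposes that the next non-empty slot, hence also the `n`-th, exists.
  set 𝒜 : ℕ → Set (ℕ → Option Bool) := fun t => {w | runState upd (z₀ w) w s n ∈ S ∧ IsNth w s n t}
  have hA : ∀ t, DependsUpTo t (𝒜 t) := by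
    rintro t w w' hw ⟨h1, h2⟩
    refine ⟨?_, h2.congr hw⟩
    rw [← hz w w' fun i hi => hw i (hi.trans h2.le), ← h2.runState_congr hw le_rfl]
    exact h1
  have hsub : {ω | runState upd (z₀ (o ω)) (o ω) s n ∈ S ∧ step (o ω) s n = false} ⊆
      ⋃ t, {ω | o ω ∈ 𝒜 t ∧ ∃ g, EmptyGap (o ω) t g ∧ o ω (t + g + 1) = some false} := by
    rintro ω ⟨h1, h2⟩
    obtain ⟨t', h3, h4⟩ := step_eq_false.1 h2
    have hlt : s < t' := by
      rcases h3 with h3 | h3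
      · omega
      · exact h3.1
    have h5 : numNonempty (o ω) s t' = n + 1 := h3.numNonempty_eq
    obtain ⟨t, h6, h7⟩ := exists_isNth (o ω) (n := n) hlt.le (by omega)
    have hne : t ≠ t' := by
      rintro rfl
      have := h7.numNonempty_eq
      omega
    refine Set.mem_iUnion.2 ⟨t, ⟨h1, h7⟩, t' - t - 1, fun i h8 h9 => ?_, ?_⟩
    · by_contra hi
      have h10 := numNonempty_lt (o ω) h7.le h8 hi
      have h11 := numNonempty_lt (o ω) (a := s) (b := i) (c := t') (by have := h7.le; omega)
        (by omega)
        (by simp [h4])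
      have := h7.numNonempty_eq
      omega
    · rw [show t + (t' - t - 1) + 1 = t' by omega, h4]
  refine (measure_mono hsub).trans ((measure_iUnion_le _).trans ?_)
  refine (ENNReal.tsum_le_tsum fun t => h.next_other_le (hA t)).trans ?_
  rw [ENNReal.tsum_mul_left, ← measure_iUnion]
  · gcongr
    exact Set.iUnion_subset fun t ω hω => hω.1
  · intro t t' hne
    refine Set.disjoint_left.2 fun ω h1 h2 => hne (h1.2.unique h2.2)
  · exact fun t => h.measurableSet (hA t)

/-- Expected potential of a process that is driven by the walk after slot `s`. -/
theorem lintegral_runState_le [IsProbabilityMeasure P] (h : SlotLaw P o f α p π)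
    (upd : 𝒵 → Bool → 𝒵) (s : ℕ)
    {z₀ : (ℕ → Option Bool) → 𝒵} (hz : ∀ w w', (∀ i ≤ s, w i = w' i) → z₀ w = z₀ w')
    {V : 𝒵 → ℝ} {l : ℝ} (hl : 0 ≤ l) (hV0 : ∀ z, 0 ≤ V z)
    (hmono : ∀ z, V (upd z true) ≤ V (upd z false))
    (hV : ∀ z, p * V (upd z true) + (1 - p) * V (upd z false) ≤ l * V z) (n : ℕ) :
    ∫⁻ ω, ENNReal.ofReal (V (runState upd (z₀ (o ω)) (o ω) s n)) ∂P ≤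
      ENNReal.ofReal (l ^ n) * ∫⁻ ω, ENNReal.ofReal (V (z₀ (o ω))) ∂P :=
  lintegral_potential_le (Z := fun n ω => runState upd (z₀ (o ω)) (o ω) s n)
    (X := fun n ω => step (o ω) s n) (upd := upd) (q := 1 - p)
    (h.measurableSet_runState upd s hz) (h.measurableSet_step s) (fun _ _ => rfl)
    (by linarith [h.p_le_one]) hl (h.step_le upd s hz) hV0 hmono
    (fun z => by simpa using hV z) n

end SlotLaw

/-! ### The drawdown of the walk -/

/-- The distance of the walk from its running maximum. -/
def drawdown (w : ℕ → Option Bool) : ℕ → ℕ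
  | 0 => 0
  | t + 1 => match w (t + 1) with
    | none => drawdown w t
    | some true => drawdown w t - 1
    | some false => drawdown w t + 1

theorem drawdown_congr {w w' : ℕ → Option Bool} {s : ℕ} (h : ∀ i ≤ s, w i = w' i) :
    drawdown w s = drawdown w' s := by
  induction s with
  | zero => rfl
  | succ s ih =>
    rw [drawdown, drawdown, ih fun i hi => h i (by omega), h (s + 1) le_rfl]

theorem walk_succ (w : ℕ → Option Bool) (i : ℕ) : walk w (i + 1) = walk w i +
    match w (i + 1) with
    | none => 0
    | some true => 1
    | some false => -1 := by
  unfold walk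
  rw [numSpecial_succ w (Nat.zero_le i), numOther_succ w (Nat.zero_le i)]
  rcases w (i + 1) with _ | _ | _ <;> simp <;> omega

theorem walk_le_add_drawdown (w : ℕ → Option Bool) {a s : ℕ} (h : a ≤ s) :
    walk w a ≤ walk w s + drawdown w s := by
  induction s, h using Nat.le_induction with
  | base => omega
  | succ s _ ih =>
    rw [walk_succ, drawdown]
    rcases w (s + 1) with _ | _ | _ <;> simp <;> omega

theorem drawdown_of_emptyGap {w : ℕ → Option Bool} {t g : ℕ} (h : EmptyGap w t g) :
    drawdown w (t + g) = drawdown w t := by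
  induction g with
  | zero => rfl
  | succ g ih =>
    rw [← add_assoc, drawdown, h (t + g + 1) (by omega) (by omega)]
    exact ih fun i h1 h2 => h i h1 (by omega)

theorem EmptyGap.succ {w : ℕ → Option Bool} {t g : ℕ} :
    EmptyGap w t (g + 1) ↔ EmptyGap w t g ∧ w (t + g + 1) = none := by
  refine ⟨fun h => ⟨fun i h1 h2 => h i h1 (by omega), h _ (by omega) (by omega)⟩, fun h i h1 h2 => ?_⟩
  rcases Nat.lt_or_ge i (t + g + 1) with h3 | h3
  · exact h.1 i h1 (by omega)
  · rw [show i = t + g + 1 by omega]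
    exact h.2

/-- Slot `t` is empty or preceded by a maximal run of empty slots. -/
theorem exists_emptyGap (w : ℕ → Option Bool) (T : ℕ) :
    ∃ t g, T = t + g ∧ EmptyGap w t g ∧ (t = 0 ∨ w t ≠ none) := by
  induction T with
  | zero => exact ⟨0, 0, rfl, fun i h1 h2 => by omega, Or.inl rfl⟩
  | succ T ih =>
    by_cases h : w (T + 1) = none
    · obtain ⟨t, g, h1, h2, h3⟩ := ih
      exact ⟨t, g + 1, by omega, EmptyGap.succ.2 ⟨h2, by rw [← h1]; exact h⟩, h3⟩
    · exact ⟨T + 1, 0, rfl, fun i h1 h2 => by omega, Or.inr h⟩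

namespace SlotLaw

variable {Ω : Type*} [MeasurableSpace Ω] {P : Measure Ω}
  {o : Ω → ℕ → Option Bool} {f α p : ℝ} {π : ℕ → ℝ}

/-- The difference of `empty_gap` for `g` and for `g + 1`. -/
theorem nonempty_gap [IsProbabilityMeasure P] (h : SlotLaw P o f α p π) {t : ℕ} (g : ℕ)
    {𝒜 : Set (ℕ → Option Bool)} (hA : DependsUpTo t 𝒜) :
    P.real {ω | o ω ∈ 𝒜 ∧ EmptyGap (o ω) t g ∧ o ω (t + g + 1) ≠ none} =
      P.real {ω | o ω ∈ 𝒜} * ((1 - f) ^ g * f) := by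
  have h1 := h.empty_gap t g 𝒜 hA
  have h2 := h.empty_gap t (g + 1) 𝒜 hA
  have h3 := measureReal_inter_add_sdiff (μ := P) (s := {ω | o ω ∈ 𝒜 ∧ EmptyGap (o ω) t g})
    (h.meas (t + g + 1) none)
  have e1 : {ω | o ω ∈ 𝒜 ∧ EmptyGap (o ω) t g} ∩ {ω | o ω (t + g + 1) = none} =
      {ω | o ω ∈ 𝒜 ∧ EmptyGap (o ω) t (g + 1)} := by
    ext ω
    simp only [Set.mem_inter_iff, Set.mem_ofPred_eq, EmptyGap.succ]
    tauto
  have e2 : {ω | o ω ∈ 𝒜 ∧ EmptyGap (o ω) t g} \ {ω | o ω (t + g + 1) = none} =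
      {ω | o ω ∈ 𝒜 ∧ EmptyGap (o ω) t g ∧ o ω (t + g + 1) ≠ none} := by
    ext ω
    simp only [Set.mem_sdiff, Set.mem_ofPred_eq]
    tauto
  rw [e1, e2, h1, h2] at h3
  rw [eq_sub_of_add_eq' h3, pow_succ]
  ring

/-- On `𝒜'` either kind of non-empty slot counts, and its probability is known; on the rest of `𝒜`
only the other slots count. Thus only the upper bound on other slots is used. The intended sets say
that the drawdown is at least `m`, respectively `m + 2`, from which it reaches `m + 1` by a step
down, respectively remains there after a step up. -/
theorem gap_step_le [IsProbabilityMeasure P] (h : SlotLaw P o f α p π) {t : ℕ} (g : ℕ)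
    {𝒜 𝒜' : Set (ℕ → Option Bool)} (hA : DependsUpTo t 𝒜) (hA' : DependsUpTo t 𝒜')
    (hsub : 𝒜' ⊆ 𝒜) :
    P.real {ω | o ω ∈ 𝒜 ∧ EmptyGap (o ω) t g ∧ o ω (t + g + 1) = some false} +
      P.real {ω | o ω ∈ 𝒜' ∧ EmptyGap (o ω) t g ∧ o ω (t + g + 1) = some true} ≤
      (1 - f) ^ g * f * ((1 - π (g + 1)) * P.real {ω | o ω ∈ 𝒜} +
        π (g + 1) * P.real {ω | o ω ∈ 𝒜'}) := by
  have hD : DependsUpTo t (𝒜 \ 𝒜') := fun w w' hw hd =>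
    ⟨hA w w' hw hd.1, fun h' => hd.2 (hA' w' w (fun i hi => (hw i hi).symm) h')⟩
  have m' : MeasurableSet {ω | o ω ∈ 𝒜'} := h.measurableSet hA'
  have h1 := h.nonempty_gap g hA'
  have h2 := h.other_gap t g _ hD
  have h3 := measureReal_inter_add_sdiff (μ := P) (s := {ω | o ω ∈ 𝒜}) m'
  have h4 := measureReal_inter_add_sdiff (μ := P)
    (s := {ω | o ω ∈ 𝒜 ∧ EmptyGap (o ω) t g ∧ o ω (t + g + 1) = some false}) m'
  have h5 := measureReal_inter_add_sdiff (μ := P)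
    (s := {ω | o ω ∈ 𝒜' ∧ EmptyGap (o ω) t g ∧ o ω (t + g + 1) ≠ none})
    (h.meas (t + g + 1) (some false))
  have e1 : {ω | o ω ∈ 𝒜} ∩ {ω | o ω ∈ 𝒜'} = {ω | o ω ∈ 𝒜'} := by
    ext ω
    exact ⟨fun hω => hω.2, fun hω => ⟨hsub hω, hω⟩⟩
  have e2 : {ω | o ω ∈ 𝒜} \ {ω | o ω ∈ 𝒜'} = {ω | o ω ∈ 𝒜 \ 𝒜'} := rfl
  have e3 : {ω | o ω ∈ 𝒜 ∧ EmptyGap (o ω) t g ∧ o ω (t + g + 1) = some false} ∩ {ω | o ω ∈ 𝒜'} =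
      {ω | o ω ∈ 𝒜' ∧ EmptyGap (o ω) t g ∧ o ω (t + g + 1) ≠ none} ∩
        {ω | o ω (t + g + 1) = some false} := by
    ext ω
    simp only [Set.mem_inter_iff, Set.mem_ofPred_eq]
    constructor
    · rintro ⟨⟨_, h2, h3⟩, h4⟩
      exact ⟨⟨h4, h2, by simp [h3]⟩, h3⟩
    · rintro ⟨⟨h1, h2, _⟩, h4⟩
      exact ⟨⟨hsub h1, h2, h4⟩, h1⟩
  have e4 : {ω | o ω ∈ 𝒜 ∧ EmptyGap (o ω) t g ∧ o ω (t + g + 1) = some false} \ {ω | o ω ∈ 𝒜'} =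
      {ω | o ω ∈ 𝒜 \ 𝒜' ∧ EmptyGap (o ω) t g ∧ o ω (t + g + 1) = some false} := by
    ext ω
    simp only [Set.mem_sdiff, Set.mem_ofPred_eq]
    tauto
  have e5 : {ω | o ω ∈ 𝒜' ∧ EmptyGap (o ω) t g ∧ o ω (t + g + 1) ≠ none} \
        {ω | o ω (t + g + 1) = some false} =
      {ω | o ω ∈ 𝒜' ∧ EmptyGap (o ω) t g ∧ o ω (t + g + 1) = some true} := by
    ext ω
    simp only [Set.mem_sdiff, Set.mem_ofPred_eq]
    rcases o ω (t + g + 1) with _ | _ | _ <;> simp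
  rw [e1, e2] at h3
  rw [e3, e4] at h4
  rw [e5, h1] at h5
  have h6 : P.real {ω | o ω ∈ 𝒜 \ 𝒜'} = P.real {ω | o ω ∈ 𝒜} - P.real {ω | o ω ∈ 𝒜'} := by
    linarith
  rw [h6] at h2
  nlinarith

/-- Induction over the last non-empty slot before `T + 1`. The tail `r ^ m` with `r = (1 - p) / p`
is preserved because `(1 - p) + p * r ^ 2 = r`; the factor `f` is the chance that the slot under
consideration is non-empty. Since the probability of a special slot depends on the gap, the
recursion has to be averaged over the gap before `p` appears. -/
theorem nonempty_drawdown_le [IsProbabilityMeasure P] (h : SlotLaw P o f α p π) (hp : 1 / 2 < p)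
    (T m : ℕ) :
    P.real {ω | o ω (T + 1) ≠ none ∧ m ≤ drawdown (o ω) (T + 1)} ≤ f * ((1 - p) / p) ^ m := by
  set r := (1 - p) / p with hr
  have hp0 : 0 < p := by linarith
  have hp1 := h.p_le_one
  have hr0 : 0 ≤ r := div_nonneg (by linarith) hp0.le
  have hrp : r * p = 1 - p := div_mul_cancel₀ _ hp0.ne'
  have hf0 := h.f_pos
  have hf1 : 0 ≤ 1 - f := by linarith [h.f_le]
  have hall : ∀ T, P.real {ω | o ω (T + 1) ≠ none} = f := fun T => by
    have := h.nonempty_gap (t := T) 0 (𝒜 := Set.univ) (fun _ _ _ _ => trivial)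
    have h0 : ∀ w, EmptyGap w T 0 := fun w i h1 h2 => by omega
    simpa [h0] using this
  induction T using Nat.strong_induction_on generalizing m with
  | _ T ih =>
  rcases m with _ | m
  · simpa using (hall T).le
  -- The bound on the contribution of a gap of length `g`, given the bound of the induction at the
  -- slot before the gap.
  set a : ℕ → ℝ := fun g => (1 - f) ^ g * f * (f * ((1 - π (g + 1)) * r ^ m +
    π (g + 1) * r ^ (m + 2))) with ha
  have hsum : HasSum a (f * r ^ (m + 1)) := by
    have h1 := (h.hasSum_compl.mul_left (f * r ^ m)).add (h.hasSum.mul_left (f * r ^ (m + 2)))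
    have h2 : f * r ^ m * (1 - p) + f * r ^ (m + 2) * p = f * r ^ (m + 1) := by
      calc f * r ^ m * (1 - p) + f * r ^ (m + 2) * p
          = f * r ^ m * (r * p) + f * r ^ (m + 1) * (r * p) := by rw [hrp]; rw [← hrp]; ring
        _ = f * r ^ (m + 1) * (p + r * p) := by ring
        _ = f * r ^ (m + 1) := by rw [hrp]; ring
    rw [h2] at h1
    refine h1.congr_fun fun g => ?_
    simp only [ha]
    ring
  have hterm : ∀ g < T, P.real {ω | (o ω (T - g) ≠ none ∧ EmptyGap (o ω) (T - g) g) ∧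
      o ω (T + 1) ≠ none ∧ m + 1 ≤ drawdown (o ω) (T + 1)} ≤ a g := by
    intro g hg
    obtain ⟨t, rfl⟩ : ∃ t, T = t + 1 + g := ⟨T - 1 - g, by omega⟩
    have hdep : ∀ m, DependsUpTo (t + 1)
        {w : ℕ → Option Bool | w (t + 1) ≠ none ∧ m ≤ drawdown w (t + 1)} := by
      rintro m w w' hw ⟨h1, h2⟩
      exact ⟨by rw [← hw _ le_rfl]; exact h1, by rw [← drawdown_congr hw]; exact h2⟩
    have h1 := h.gap_step_le g (hdep m) (hdep (m + 2)) (fun w hw => ⟨hw.1, by have := hw.2; omega⟩)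
    have h2 : {ω | (o ω (t + 1 + g - g) ≠ none ∧ EmptyGap (o ω) (t + 1 + g - g) g) ∧
        o ω (t + 1 + g + 1) ≠ none ∧ m + 1 ≤ drawdown (o ω) (t + 1 + g + 1)} ⊆
        {ω | o ω ∈ {w : ℕ → Option Bool | w (t + 1) ≠ none ∧ m ≤ drawdown w (t + 1)} ∧
          EmptyGap (o ω) (t + 1) g ∧ o ω (t + 1 + g + 1) = some false} ∪
        {ω | o ω ∈ {w : ℕ → Option Bool | w (t + 1) ≠ none ∧ m + 2 ≤ drawdown w (t + 1)} ∧
          EmptyGap (o ω) (t + 1) g ∧ o ω (t + 1 + g + 1) = some true} := by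
      rintro ω ⟨⟨h3, h4⟩, h5, h6⟩
      rw [Nat.add_sub_cancel] at h3 h4
      rw [drawdown, drawdown_of_emptyGap h4] at h6
      rcases h7 : o ω (t + 1 + g + 1) with _ | _ | _
      · exact absurd h7 h5
      · rw [h7] at h6
        exact Or.inl ⟨⟨h3, by simpa using h6⟩, h4, h7⟩
      · rw [h7] at h6
        simp only at h6
        exact Or.inr ⟨⟨h3, by omega⟩, h4, h7⟩
    refine (measureReal_mono h2).trans ((measureReal_union_le _ _).trans (h1.trans ?_))
    have i1 := ih t (by omega) m
    have i2 := ih t (by omega) (m + 2)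
    have hπ0 := h.pi_nonneg (g + 1)
    have hπ1 : 0 ≤ 1 - π (g + 1) := by linarith [h.pi_le (g + 1), h.alpha_le]
    have hρ : 0 ≤ (1 - f) ^ g * f := by positivity
    have : (1 - π (g + 1)) * P.real {ω | o ω (t + 1) ≠ none ∧ m ≤ drawdown (o ω) (t + 1)} +
        π (g + 1) * P.real {ω | o ω (t + 1) ≠ none ∧ m + 2 ≤ drawdown (o ω) (t + 1)} ≤
        f * ((1 - π (g + 1)) * r ^ m + π (g + 1) * r ^ (m + 2)) := by
      have j1 := mul_le_mul_of_nonneg_left i1 hπ1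
      have j2 := mul_le_mul_of_nonneg_left i2 hπ0
      linarith
    exact mul_le_mul_of_nonneg_left this hρ
  -- If slot `T + 1` is the first non-empty one, its drawdown is at most one, and it is one only if
  -- the slot is not special. By `first_other` and `π ≤ α` this costs no more than the unused gaps
  -- of length at least `T`.
  have hfirst : P.real {ω | EmptyGap (o ω) 0 T ∧
      o ω (T + 1) ≠ none ∧ m + 1 ≤ drawdown (o ω) (T + 1)} ≤ ∑' g, a (g + T) := by
    have hann : ∀ g, 0 ≤ a g := fun g => by
      have hπ0 := h.pi_nonneg (g + 1)
      have hπ1 : 0 ≤ 1 - π (g + 1) := by linarith [h.pi_le (g + 1), h.alpha_le]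
      simp only [ha]
      positivity
    have hsumT : Summable fun g => a (g + T) := (summable_nat_add_iff T).2 hsum.summable
    have hsub : {ω | EmptyGap (o ω) 0 T ∧ o ω (T + 1) ≠ none ∧ m + 1 ≤ drawdown (o ω) (T + 1)} ⊆
        {ω | (EmptyGap (o ω) 0 T ∧ o ω (0 + T + 1) = some false) ∧ m = 0} := by
      rintro ω ⟨h1, h2, h3⟩
      have h4 := drawdown_of_emptyGap h1
      rw [zero_add, drawdown] at h4
      rw [drawdown, h4] at h3
      rw [Set.mem_ofPred_eq, zero_add]
      rcases h7 : o ω (T + 1) with _ | _ | _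
      · exact absurd h7 h2
      · rw [h7] at h3
        simp only at h3
        exact ⟨⟨h1, rfl⟩, by omega⟩
      · rw [h7] at h3
        simp at h3
    refine (measureReal_mono hsub).trans ?_
    rcases Nat.eq_zero_or_pos m with rfl | hm
    · simp only [and_true]
      refine (h.first_other T).trans ?_
      have hb : HasSum (fun g : ℕ => (1 - f) ^ (g + T) * f * (f * (1 - α)))
          ((1 - f) ^ T * f * (1 - α)) := by
        have := h.hasSum_geom.mul_right ((1 - f) ^ T * f * (1 - α))
        rw [one_mul] at this
        refine this.congr_fun fun g => ?_
        rw [pow_add]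
        ring
      rw [← hb.tsum_eq]
      refine hb.summable.tsum_le_tsum (fun g => ?_) hsumT
      simp only [ha]
      refine mul_le_mul_of_nonneg_left ?_ (by positivity)
      refine mul_le_mul_of_nonneg_left ?_ hf0.le
      have := h.pi_le (g + T + 1)
      have h0 := mul_nonneg (h.pi_nonneg (g + T + 1)) (pow_nonneg hr0 (0 + 2))
      simp only [pow_zero, mul_one]
      linarith
    · simp only [hm.ne', and_false, Set.ofPred_false, measureReal_empty]
      exact tsum_nonneg fun g => hann _
  have hcover : {ω | o ω (T + 1) ≠ none ∧ m + 1 ≤ drawdown (o ω) (T + 1)} ⊆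
      (⋃ g ∈ Finset.range T, {ω | (o ω (T - g) ≠ none ∧ EmptyGap (o ω) (T - g) g) ∧
        o ω (T + 1) ≠ none ∧ m + 1 ≤ drawdown (o ω) (T + 1)}) ∪
      {ω | EmptyGap (o ω) 0 T ∧ o ω (T + 1) ≠ none ∧ m + 1 ≤ drawdown (o ω) (T + 1)} := by
    intro ω hω
    obtain ⟨t, g, h1, h2, h3⟩ := exists_emptyGap (o ω) T
    by_cases ht : t = 0
    · refine Or.inr ⟨?_, hω⟩
      rw [h1, ht, zero_add]
      rwa [ht] at h2
    · refine Or.inl (Set.mem_iUnion₂.2 ⟨g, Finset.mem_range.2 (by omega), ?_, hω⟩)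
      rw [show T - g = t by omega]
      exact ⟨h3.resolve_left ht, h2⟩
  refine (measureReal_mono hcover).trans ((measureReal_union_le _ _).trans ?_)
  rw [← hsum.tsum_eq, ← hsum.summable.sum_add_tsum_nat_add T]
  refine add_le_add ((measureReal_biUnion_finset_le _ _).trans ?_) hfirst
  exact Finset.sum_le_sum fun g hg => hterm g (Finset.mem_range.1 hg)

/-- The drawdown has geometric tails. -/
theorem drawdown_le [IsProbabilityMeasure P] (h : SlotLaw P o f α p π) (hp : 1 / 2 < p)
    (s m : ℕ) : P.real {ω | m ≤ drawdown (o ω) s} ≤ ((1 - p) / p) ^ m := by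
  set r := (1 - p) / p with hr
  have hr0 : 0 ≤ r := div_nonneg (by linarith [h.p_le_one]) (by linarith)
  have hf0 := h.f_pos
  have hf1 : 0 ≤ 1 - f := by linarith [h.f_le]
  rcases Nat.eq_zero_or_pos m with rfl | hm
  · simp
  -- The drawdown is that of the last non-empty slot, which exists since `m` is positive. Its
  -- distance `g` from `s` carries the weight `(1 - f) ^ g * f`, and these weights add up to at most
  -- one.
  have hcover : {ω | m ≤ drawdown (o ω) s} ⊆
      ⋃ g ∈ Finset.range s, {ω | o ω ∈ {w : ℕ → Option Bool | w (s - g) ≠ none ∧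
        m ≤ drawdown w (s - g)} ∧ EmptyGap (o ω) (s - g) g} := by
    intro ω hω
    obtain ⟨t, g, h1, h2, h3⟩ := exists_emptyGap (o ω) s
    rw [Set.mem_ofPred_eq, h1, drawdown_of_emptyGap h2] at hω
    have ht : t ≠ 0 := by
      rintro rfl
      rw [drawdown] at hω
      omega
    refine Set.mem_iUnion₂.2 ⟨g, Finset.mem_range.2 (by omega), ?_⟩
    rw [show s - g = t by omega]
    exact ⟨⟨h3.resolve_left ht, hω⟩, h2⟩
  refine (measureReal_mono hcover (measure_ne_top _ _)).trans
    ((measureReal_biUnion_finset_le _ _).trans ?_)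
  have hterm : ∀ g ∈ Finset.range s, P.real {ω | o ω ∈ {w : ℕ → Option Bool | w (s - g) ≠ none ∧
        m ≤ drawdown w (s - g)} ∧ EmptyGap (o ω) (s - g) g} ≤ (1 - f) ^ g * f * r ^ m := by
    intro g hg
    rw [h.empty_gap]
    · have := h.nonempty_drawdown_le hp (s - g - 1) m
      rw [show s - g - 1 + 1 = s - g by have := Finset.mem_range.1 hg; omega] at this
      have h2 := mul_le_mul_of_nonneg_right this (pow_nonneg hf1 g)
      refine h2.trans_eq ?_
      ring
    · rintro w w' hw ⟨h1, h2⟩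
      exact ⟨by rw [← hw _ le_rfl]; exact h1, by rw [← drawdown_congr hw]; exact h2⟩
  refine (Finset.sum_le_sum hterm).trans ?_
  rw [← Finset.sum_mul]
  have : ∑ g ∈ Finset.range s, (1 - f) ^ g * f ≤ 1 := by
    refine sum_le_hasSum _ (fun g _ => ?_) h.hasSum_geom
    positivity
  nlinarith [pow_nonneg hr0 m]

end SlotLaw

/-! ### Maximal inequality and deviations of the walk -/

/-- The position of the walk after slot `s` after `n` steps. -/
def stepSum (w : ℕ → Option Bool) (s n : ℕ) : ℤ :=
  ∑ m ∈ Finset.range n, if step w s m then 1 else -1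

theorem stepSum_succ (w : ℕ → Option Bool) (s n : ℕ) :
    stepSum w s (n + 1) = stepSum w s n + if step w s n then 1 else -1 :=
  Finset.sum_range_succ _ _

theorem IsNth.step_eq {w : ℕ → Option Bool} {s n t : ℕ} (h : IsNth w s (n + 1) t) :
    w t = some (step w s n) := by
  have hne : w t ≠ none := by
    rcases h with h | h
    · omega
    · exact h.2.1
  rcases h1 : w t with _ | _ | _
  · exact absurd h1 hne
  · rw [step_eq_false.2 ⟨t, h, h1⟩]
  · cases h2 : step w s n with
    | true => rfl
    | false =>
      obtain ⟨t', h3, h4⟩ := step_eq_false.1 h2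
      rw [h3.unique h, h1] at h4
      simp at h4

theorem walk_eq_add_stepSum (w : ℕ → Option Bool) {s i : ℕ} (hi : s ≤ i) :
    walk w i = walk w s + stepSum w s (numNonempty w s i) := by
  induction i, hi using Nat.le_induction with
  | base => simp [numNonempty, stepSum]
  | succ i hi ih =>
    rw [walk_succ, numNonempty_succ w hi, ih]
    by_cases h : w (i + 1) = none
    · simp [h]
    · have hN : IsNth w s (numNonempty w s i + 1) (i + 1) :=
        Or.inr ⟨by omega, h, by rw [numNonempty_succ w hi, if_neg h]⟩
      rw [if_neg h, stepSum_succ, hN.step_eq]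
      cases step w s (numNonempty w s i) <;> simp <;> ring

open Classical in
/-- The process with update `upd` that is stopped on entering `S`. -/
def stopUpd {𝒵 : Type*} (upd : 𝒵 → Bool → 𝒵) (S : Set 𝒵) : Option 𝒵 → Bool → Option 𝒵
  | none, _ => none
  | some z, b => if upd z b ∈ S then none else some (upd z b)

open Classical in
theorem runState_stopUpd {𝒵 : Type*} (upd : 𝒵 → Bool → 𝒵) (S : Set 𝒵) (z₀ : 𝒵)
    (w : ℕ → Option Bool) (s n : ℕ) :
    runState (stopUpd upd S) (if z₀ ∈ S then none else some z₀) w s n =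
      if ∃ m ≤ n, runState upd z₀ w s m ∈ S then none else some (runState upd z₀ w s n) := by
  induction n with
  | zero => simp [runState]
  | succ n ih =>
    rw [runState, ih]
    by_cases h : ∃ m ≤ n, runState upd z₀ w s m ∈ S
    · obtain ⟨m, h1, h2⟩ := h
      rw [if_pos ⟨m, h1, h2⟩, if_pos ⟨m, by omega, h2⟩, stopUpd]
    · rw [if_neg h, stopUpd]
      change (if runState upd z₀ w s (n + 1) ∈ S then none else
        some (runState upd z₀ w s (n + 1))) = _
      congr 1
      rw [eq_iff_iff]
      refine ⟨fun h1 => ⟨n + 1, le_rfl, h1⟩, fun ⟨m, h1, h2⟩ => ?_⟩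
      rcases h1.eq_or_lt with rfl | h1
      · exact h2
      · exact absurd ⟨m, by omega, h2⟩ h

namespace SlotLaw

variable {Ω 𝒵 : Type*} [MeasurableSpace Ω] {P : Measure Ω}
  {o : Ω → ℕ → Option Bool} {f α p : ℝ} {π : ℕ → ℝ}

/-- The maximal inequality for non-negative supermartingales. -/
theorem exists_runState_le [IsProbabilityMeasure P] (h : SlotLaw P o f α p π) (hp : 0 ≤ p)
    (upd : 𝒵 → Bool → 𝒵) (s : ℕ)
    {z₀ : (ℕ → Option Bool) → 𝒵} (hz : ∀ w w', (∀ i ≤ s, w i = w' i) → z₀ w = z₀ w')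
    {V : 𝒵 → ℝ} (hV0 : ∀ z, 0 ≤ V z)
    (hmono : ∀ z, V (upd z true) ≤ V (upd z false))
    (hV : ∀ z, p * V (upd z true) + (1 - p) * V (upd z false) ≤ V z)
    {S : Set 𝒵} (hS : ∀ z ∈ S, 1 ≤ V z) :
    P {ω | ∃ n, runState upd (z₀ (o ω)) (o ω) s n ∈ S} ≤
      ∫⁻ ω, ENNReal.ofReal (V (z₀ (o ω))) ∂P := by
  classical
  have hp1 := h.p_le_one
  -- The process is frozen on entering `S`, where the potential is set to `1`. Truncation at `1`
  -- makes the value on entering exactly `1` and keeps the potential monotone even if the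
  -- unfavourable step enters `S` and the favourable one does not.
  set V' : Option 𝒵 → ℝ := fun x => x.elim 1 fun z => min (V z) 1 with hV'
  have hfrozen : ∀ z b, V' (stopUpd upd S (some z) b) = min (V (upd z b)) 1 := by
    intro z b
    rw [stopUpd]
    split_ifs with hb
    · rw [min_eq_right (hS _ hb)]; rfl
    · rfl
  set z₁ : (ℕ → Option Bool) → Option 𝒵 := fun w => if z₀ w ∈ S then none else some (z₀ w)
  have hz₁ : ∀ w w', (∀ i ≤ s, w i = w' i) → z₁ w = z₁ w' := fun w w' hw => by
    simp only [z₁, hz w w' hw]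
  have hstart : ∀ w, V' (z₁ w) ≤ V (z₀ w) := fun w => by
    by_cases h1 : z₀ w ∈ S
    · simpa [z₁, h1, hV'] using hS _ h1
    · simp [z₁, h1, hV']
  have hbound : ∀ N, P {ω | runState (stopUpd upd S) (z₁ (o ω)) (o ω) s N ∈ ({none} : Set (Option 𝒵))} ≤
      ∫⁻ ω, ENNReal.ofReal (V (z₀ (o ω))) ∂P := by
    intro N
    refine (measure_le_lintegral_potential (V := V')
      (Z := fun n ω => runState (stopUpd upd S) (z₁ (o ω)) (o ω) s n)
      (h.measurableSet_runState _ s hz₁) N (S := {none}) ?_).trans ?_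
    · rintro z rfl
      simp [hV']
    refine (h.lintegral_runState_le (stopUpd upd S) s hz₁ (V := V') (l := 1) zero_le_one ?_ ?_ ?_
      N).trans ?_
    · rintro (_ | z)
      · simp [hV']
      · exact le_min (hV0 z) zero_le_one
    · rintro (_ | z)
      · rfl
      · rw [hfrozen, hfrozen]
        exact min_le_min (hmono z) le_rfl
    · rintro (_ | z)
      · simp [hV', stopUpd]
      · rw [hfrozen, hfrozen, one_mul]
        have hq : 0 ≤ 1 - p := by linarith
        refine le_min ?_ ?_
        · refine le_trans ?_ (hV z)
          exact add_le_add (mul_le_mul_of_nonneg_left (min_le_left _ _) hp)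
            (mul_le_mul_of_nonneg_left (min_le_left _ _) hq)
        · have h1 := mul_le_mul_of_nonneg_left (min_le_right (V (upd z true)) 1) hp
          have h2 := mul_le_mul_of_nonneg_left (min_le_right (V (upd z false)) 1) hq
          linarith
    · rw [one_pow, ENNReal.ofReal_one, one_mul]
      exact lintegral_mono fun ω => ENNReal.ofReal_le_ofReal (hstart _)
  have hiff : ∀ N ω, runState (stopUpd upd S) (z₁ (o ω)) (o ω) s N = none ↔
      ∃ m ≤ N, runState upd (z₀ (o ω)) (o ω) s m ∈ S := fun N ω => by
    have := runState_stopUpd upd S (z₀ (o ω)) (o ω) s N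
    simp only [z₁]
    rw [this]
    split_ifs with h1
    · simp only [true_iff]; exact h1
    · simp only [false_iff]; exact h1
  have hun : {ω | ∃ n, runState upd (z₀ (o ω)) (o ω) s n ∈ S} =
      ⋃ N, {ω | runState (stopUpd upd S) (z₁ (o ω)) (o ω) s N ∈ ({none} : Set (Option 𝒵))} := by
    ext ω
    simp only [Set.mem_ofPred_eq, Set.mem_iUnion, Set.mem_singleton_iff, hiff]
    exact ⟨fun ⟨n, hn⟩ => ⟨n, n, le_rfl, hn⟩, fun ⟨_, m, _, hm⟩ => ⟨m, hm⟩⟩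
  rw [hun, Monotone.measure_iUnion]
  · exact iSup_le hbound
  · intro N N' hN ω hω
    simp only [Set.mem_ofPred_eq, Set.mem_singleton_iff, hiff] at hω ⊢
    obtain ⟨m, h1, h2⟩ := hω
    exact ⟨m, h1.trans hN, h2⟩

/-- Reciprocal of `1 + x + x ^ 2 / 2 ≤ exp x`, because `(1 - x + x ^ 2 / 2) * (1 + x + x ^ 2 / 2) =
1 + x ^ 4 / 4`. -/
theorem exp_neg_le_quadratic {x : ℝ} (hx : 0 ≤ x) : Real.exp (-x) ≤ 1 - x + x ^ 2 / 2 := by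
  have h1 := Real.quadratic_le_exp_of_nonneg hx
  have h2 : Real.exp (-x) * Real.exp x = 1 := by rw [← Real.exp_add]; simp
  have h3 := Real.exp_pos (-x)
  have h4 : 0 ≤ 1 - x + x ^ 2 / 2 := by nlinarith [sq_nonneg (x - 1)]
  by_contra hlt
  push Not at hlt
  have h5 : 0 < Real.exp x := Real.exp_pos x
  have h6 : (1 - x + x ^ 2 / 2) * Real.exp x < 1 := by
    exact (mul_lt_mul_of_pos_right hlt h5).trans_eq h2
  have h7 : (1 - x + x ^ 2 / 2) * (1 + x + x ^ 2 / 2) ≤ (1 - x + x ^ 2 / 2) * Real.exp x :=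
    mul_le_mul_of_nonneg_left h1 h4
  nlinarith [sq_nonneg (x ^ 2)]

/-- Chernoff bound for the number of non-empty slots. -/
theorem numNonempty_le [IsProbabilityMeasure P] (h : SlotLaw P o f α p π) (s k : ℕ) {η : ℝ}
    (hη : 0 ≤ η) :
    P {ω | (numNonempty (o ω) s (s + k) : ℝ) ≤ (1 - η) * (k * f)} ≤
      ENNReal.ofReal (Real.exp (-(k * f * η ^ 2 / 2))) := by
  classical
  have hf0 := h.f_pos
  have hf1 : 0 ≤ 1 - f := by linarith [h.f_le]
  set x : ℝ := (1 - η) * (k * f)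
  set V : ℕ → ℝ := fun c => Real.exp (η * (x - c)) with hVdef
  set upd : ℕ → Bool → ℕ := fun c b => if b then c + 1 else c with hupd
  set l : ℝ := 1 - f + f * Real.exp (-η) with hl
  have hl0 : 0 ≤ l := by positivity
  have hdep : ∀ n (S : Set ℕ), DependsUpTo (s + n) {w | numNonempty w s (s + n) ∈ S} := by
    intro n S w w' hw hA
    rw [Set.mem_ofPred_eq, ← numNonempty_congr hw]
    exact hA
  have hZ : ∀ n (S : Set ℕ), MeasurableSet {ω | numNonempty (o ω) s (s + n) ∈ S} := fun n S =>
    h.measurableSet (hdep n S)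
  have hXiff : ∀ n ω, decide (o ω (s + n + 1) ≠ none) = false ↔ o ω (s + n + 1) = none :=
    fun n ω => by simp
  have hlV : ∀ c, V (upd c true) = Real.exp (-η) * V c := fun c => by
    simp only [hVdef, hupd]
    rw [← Real.exp_add]
    congr 1
    simp only [if_true]
    push_cast
    ring
  have hexp1 : Real.exp (-η) ≤ 1 := Real.exp_le_one_iff.2 (by linarith)
  -- Here time runs through all slots, and the unfavourable step is an empty slot, of probability
  -- exactly `1 - f`. The potential is the exponential tilt of the count with parameter `η`.
  have key := lintegral_potential_le (P := P) (Z := fun n ω => numNonempty (o ω) s (s + n))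
    (X := fun n ω => decide (o ω (s + n + 1) ≠ none)) (upd := upd) (q := 1 - f) (l := l) (V := V)
    hZ (fun n => by simp only [hXiff]; exact h.meas _ _)
    (fun n ω => by
      rw [← add_assoc, numNonempty_succ _ (by omega)]
      by_cases h1 : o ω (s + n + 1) = none <;> simp [h1, hupd])
    hf1 hl0
    (fun n S => by
      have h1 := h.empty_gap (s + n) 1 _ (hdep n S)
      have h2 : {ω | numNonempty (o ω) s (s + n) ∈ S ∧ decide (o ω (s + n + 1) ≠ none) = false} =
          {ω | o ω ∈ {w | numNonempty w s (s + n) ∈ S} ∧ EmptyGap (o ω) (s + n) 1} := by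
        ext ω
        simp only [hXiff, Set.mem_ofPred_eq]
        refine and_congr_right fun _ => ⟨fun h3 i h4 h5 => ?_, fun h3 => h3 _ (by omega) (by omega)⟩
        rwa [show i = s + n + 1 by omega]
      rw [h2, ← ofReal_measureReal, ← ofReal_measureReal, ← ENNReal.ofReal_mul hf1, h1, pow_one,
        mul_comm]
      rfl)
    (fun c => (Real.exp_pos _).le)
    (fun c => by
      rw [hlV]
      simp only [hupd]
      exact mul_le_of_le_one_left (Real.exp_pos _).le hexp1)
    (fun c => by
      rw [hlV]
      simp only [hupd, hl, sub_sub_cancel]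
      simp only [Bool.false_eq_true, if_false]
      apply le_of_eq
      ring) k
  refine le_trans (measure_le_lintegral_potential (V := V) hZ k (S := {c | (c : ℝ) ≤ x}) ?_)
    (key.trans ?_)
  · intro c hc
    exact Real.one_le_exp (mul_nonneg hη (sub_nonneg.2 hc))
  simp only [add_zero]
  have h0 : ∀ ω, numNonempty (o ω) s s = 0 := fun ω => by simp [numNonempty]
  simp only [h0, lintegral_const, measure_univ, mul_one]
  rw [← ENNReal.ofReal_mul (pow_nonneg hl0 _)]
  refine ENNReal.ofReal_le_ofReal ?_
  have hl1 : l ≤ Real.exp (-(f * (η - η ^ 2 / 2))) := by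
    refine le_trans ?_ (Real.add_one_le_exp _)
    have := exp_neg_le_quadratic hη
    nlinarith
  calc l ^ k * V 0 ≤ Real.exp (-(f * (η - η ^ 2 / 2))) ^ k * V 0 := by
        gcongr
    _ = Real.exp (-(k * f * η ^ 2 / 2)) := by
        rw [← Real.exp_nat_mul, hVdef, ← Real.exp_add]
        congr 1
        simp only [x, Nat.cast_zero]
        ring

/-- Hoeffding's lemma for a step of the walk. -/
theorem hoeffding_step {p : ℝ} (hp0 : 0 ≤ p) (hp1 : p ≤ 1) (ξ : ℝ) :
    p * Real.exp (-ξ) + (1 - p) * Real.exp ξ ≤ Real.exp (-(ξ * (2 * p - 1)) + ξ ^ 2 / 2) := by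
  have hq : 0 ≤ 1 - p := by linarith
  -- The law of the step with reversed sign. Its support lies in `[-1, 1]`, so the centred variable
  -- is sub-Gaussian with constant `1`; its mean is `1 - 2 * p`.
  set μ : Measure ℝ := ENNReal.ofReal p • Measure.dirac (-1) +
    ENNReal.ofReal (1 - p) • Measure.dirac 1 with hμ
  have hprob : IsProbabilityMeasure μ := ⟨by
    simp only [hμ, Measure.add_apply, Measure.smul_apply, measure_univ, smul_eq_mul, mul_one]
    rw [← ENNReal.ofReal_add hp0 hq]
    simp⟩
  have hint : ∀ g : ℝ → ℝ, ∫ x, g x ∂μ = p * g (-1) + (1 - p) * g 1 := fun g => by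
    rw [hμ, integral_add_measure, integral_smul_measure, integral_smul_measure, integral_dirac,
      integral_dirac, ENNReal.toReal_ofReal hp0, ENNReal.toReal_ofReal hq, smul_eq_mul,
      smul_eq_mul]
    · exact (integrable_dirac (by simp)).smul_measure ENNReal.ofReal_ne_top
    · exact (integrable_dirac (by simp)).smul_measure ENNReal.ofReal_ne_top
  have hIcc : ∀ᵐ x ∂μ, x ∈ Set.Icc (-1 : ℝ) 1 := by
    rw [hμ, ae_add_measure_iff]
    exact ⟨Measure.ae_smul_measure (by rw [ae_dirac_eq]; exact ⟨le_rfl, by norm_num⟩) _,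
      Measure.ae_smul_measure (by rw [ae_dirac_eq]; exact ⟨by norm_num, le_rfl⟩) _⟩
  have h := (hasSubgaussianMGF_of_mem_Icc (X := fun x : ℝ => x) measurable_id.aemeasurable
    hIcc).mgf_le ξ
  rw [mgf, hint, hint] at h
  have h2 : (((‖(1 : ℝ) - -1‖₊ / 2) ^ 2 : NNReal) : ℝ) = 1 := by
    push_cast
    norm_num
  rw [h2, one_mul] at h
  calc p * Real.exp (-ξ) + (1 - p) * Real.exp ξ
      = Real.exp (-(ξ * (2 * p - 1))) * (p * Real.exp (ξ * (-1 - (p * -1 + (1 - p) * 1))) +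
        (1 - p) * Real.exp (ξ * (1 - (p * -1 + (1 - p) * 1)))) := by
        rw [mul_add, mul_left_comm, mul_left_comm _ (1 - p), ← Real.exp_add, ← Real.exp_add]
        ring_nf
    _ ≤ Real.exp (-(ξ * (2 * p - 1))) * Real.exp (ξ ^ 2 / 2) :=
        mul_le_mul_of_nonneg_left h (Real.exp_pos _).le
    _ = _ := by rw [← Real.exp_add]

/-- From step `a + M` on, the walk after `a` steps stays above a line of slope `2 p - 1 - ξ`. -/
theorem exists_stepSum_lt_le [IsProbabilityMeasure P] (h : SlotLaw P o f α p π) (hp : 0 ≤ p)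
    (s a M : ℕ) {ξ : ℝ} (hξ : 0 ≤ ξ) :
    P {ω | ∃ m, M ≤ m ∧ ((stepSum (o ω) s (a + m) - stepSum (o ω) s a : ℤ) : ℝ) <
      (2 * p - 1 - ξ) * m} ≤ ENNReal.ofReal (Real.exp (-(M * ξ ^ 2 / 2))) := by
  set σ : ℝ := 2 * p - 1 - ξ with hσ
  have hp1 := h.p_le_one
  set upd : ℕ × ℤ → Bool → ℕ × ℤ := fun z b =>
    (z.1 + 1, if z.1 < a then z.2 else z.2 + if b then 1 else -1) with hupd
  -- A step multiplies the mean of `exp (-ξ * (z.2 - σ * m))` by at most `exp (-ξ ^ 2 / 2)`, by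
  -- `hoeffding_step` and the choice of `σ`; here `m` counts the steps after step `a`. The second
  -- factor spends this gain during the first `M` of them, so the potential starts at `exp (-M * ξ ^
  -- 2 / 2)`. The first `a` steps leave it unchanged by truncated subtraction.
  set V : ℕ × ℤ → ℝ := fun z =>
    Real.exp (-(ξ * (z.2 - σ * (z.1 - a : ℕ))) - ξ ^ 2 / 2 * (M - (z.1 - a) : ℕ)) with hV
  have hrun : ∀ w : ℕ → Option Bool, ∀ n, runState upd (0, 0) w s n =
      (n, stepSum w s (a + (n - a)) - stepSum w s a) := by
    intro w n
    induction n with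
    | zero => simp [runState]
    | succ n ih =>
      rw [runState, ih, hupd]
      simp only [Prod.mk.injEq, true_and]
      by_cases h1 : n < a
      · rw [if_pos h1, show n + 1 - a = 0 by omega, show n - a = 0 by omega]
      · rw [if_neg h1, show a + (n + 1 - a) = a + (n - a) + 1 by omega, stepSum_succ,
          show a + (n - a) = n by omega]
        ring
  have key := h.exists_runState_le hp upd s (z₀ := fun _ => (0, 0)) (fun _ _ _ => rfl) (V := V)
    (fun z => (Real.exp_pos _).le)
    (fun z => by
      simp only [hV, hupd]
      refine Real.exp_le_exp.2 (sub_le_sub_right (neg_le_neg ?_) _)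
      refine mul_le_mul_of_nonneg_left ?_ hξ
      by_cases h1 : z.1 < a
      · simp [h1]
      · simp only [h1, if_false, Bool.false_eq_true, if_true]
        push_cast
        linarith)
    (fun z => by
      simp only [hV, hupd]
      by_cases h1 : z.1 < a
      · simp only [h1, if_true]
        rw [show z.1 + 1 - a = 0 by omega, show z.1 - a = 0 by omega]
        apply le_of_eq
        ring
      · simp only [h1, if_false, Bool.false_eq_true, if_true]
        have hh := hoeffding_step hp hp1 ξ
        set m := z.1 - a with hm
        rw [show z.1 + 1 - a = m + 1 by omega]
        have hM : ((M - m : ℕ) : ℝ) ≤ ((M - (m + 1) : ℕ) : ℝ) + 1 := by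
          exact_mod_cast (by omega : M - m ≤ M - (m + 1) + 1)
        set u := ((M - (m + 1) : ℕ) : ℝ)
        set E := Real.exp (-(ξ * (z.2 - σ * m)) + ξ * σ - ξ ^ 2 / 2 * u) with hE
        have e1 : Real.exp (-(ξ * (((z.2 + 1 : ℤ) : ℝ) - σ * ((m + 1 : ℕ) : ℝ))) -
            ξ ^ 2 / 2 * u) = E * Real.exp (-ξ) := by
          rw [hE, ← Real.exp_add]; congr 1; push_cast; ring
        have e2 : Real.exp (-(ξ * (((z.2 + -1 : ℤ) : ℝ) - σ * ((m + 1 : ℕ) : ℝ))) -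
            ξ ^ 2 / 2 * u) = E * Real.exp ξ := by
          rw [hE, ← Real.exp_add]; congr 1; push_cast; ring
        rw [e1, e2]
        calc p * (E * Real.exp (-ξ)) + (1 - p) * (E * Real.exp ξ)
            = E * (p * Real.exp (-ξ) + (1 - p) * Real.exp ξ) := by ring
          _ ≤ E * Real.exp (-(ξ * (2 * p - 1)) + ξ ^ 2 / 2) :=
              mul_le_mul_of_nonneg_left hh (Real.exp_pos _).le
          _ ≤ _ := by
              rw [hE, ← Real.exp_add]
              refine Real.exp_le_exp.2 ?_
              rw [hσ]
              nlinarith [sq_nonneg ξ])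
    (S := {z | a + M ≤ z.1 ∧ (z.2 : ℝ) < σ * (z.1 - a : ℕ)})
    (by
      rintro z ⟨h1, h2⟩
      refine Real.one_le_exp ?_
      rw [show M - (z.1 - a) = 0 by omega]
      simp only [Nat.cast_zero, mul_zero, sub_zero]
      nlinarith)
  refine le_trans (measure_mono ?_) (key.trans ?_)
  · rintro ω ⟨m, h1, h2⟩
    refine ⟨a + m, ?_⟩
    rw [hrun, Set.mem_ofPred_eq]
    refine ⟨by simp only; omega, ?_⟩
    simp only [show a + m - a = m by omega]
    exact h2
  · simp only [lintegral_const, measure_univ, mul_one]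
    refine ENNReal.ofReal_le_ofReal (Real.exp_le_exp.2 ?_)
    simp
    linarith

end SlotLaw

/-! ### The search for a pivot -/

/-- State of the search for a record of the walk that is never undercut: `waiting d` if the walk
is `d` below its maximum and there is no candidate; `alive h e` if the walk is `h` above the
candidate and `e` below its maximum. -/
inductive PivotState
  | waiting (d : ℕ)
  | alive (h e : ℕ)

namespace PivotState

/-- The update while new candidates are accepted. -/
def search : PivotState → Bool → PivotState
  | waiting 0, true => alive 0 0
  | waiting (d + 1), true => waiting d
  | waiting d, false => waiting (d + 1)
  | alive h e, true => alive (h + 1) (e - 1)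
  | alive 0 e, false => waiting (e + 1)
  | alive (h + 1) e, false => alive h (e + 1)

/-- The update when no new candidates are accepted. -/
def keep : PivotState → Bool → PivotState
  | waiting d, _ => waiting d
  | alive h e, true => alive (h + 1) e
  | alive 0 _, false => waiting 0
  | alive (h + 1) e, false => alive h e

/-- Parameters of the potential of the search. -/
structure IsPotential (p r u θ ζ c l : ℝ) : Prop where
  p_nonneg : 0 ≤ p
  p_le : p ≤ 1
  r_nonneg : 0 ≤ r
  pr : p * r = 1 - p
  uθ : u * θ = 1
  one_le : 1 ≤ θ
  u_nonneg : 0 ≤ u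
  hζ : ζ = r * θ ^ 2
  l_eq : l = p * u + (1 - p) * θ
  c_nonneg : 0 ≤ c
  c_le : c ≤ 1
  ζθ_le : ζ * θ ≤ 1
  start : c * (1 - ζ) + θ * ζ ≤ 1
  decay : (θ - 1) * ζ ^ 2 ≤ c * u * (1 - θ * ζ) * (1 - ζ ^ 2)

/-- The potential of `alive h e` with `K = h + e`. -/
def potAlive (u θ ζ c : ℝ) (h K : ℕ) : ℝ :=
  u ^ h * (c * (θ * ζ) ^ K * (1 - ζ ^ (h + 1)) + θ ^ (K + 1) * ζ ^ (h + 1))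

/-- The potential while new candidates are accepted. -/
def potSearch (u θ ζ c : ℝ) : PivotState → ℝ
  | waiting d => θ ^ (d + 1)
  | alive h e => potAlive u θ ζ c h (h + e)

/-- The probability that the candidate is ever undercut by an independent walk. -/
def potKeep (r : ℝ) : PivotState → ℝ
  | waiting _ => 1
  | alive h _ => r ^ (h + 1)

variable {p r u θ ζ c l : ℝ}

namespace IsPotential

theorem θ_pos (H : IsPotential p r u θ ζ c l) : 0 < θ := by linarith [H.one_le]

theorem ζ_nonneg (H : IsPotential p r u θ ζ c l) : 0 ≤ ζ := by
  rw [H.hζ]; exact mul_nonneg H.r_nonneg (sq_nonneg _)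

theorem ζ_le (H : IsPotential p r u θ ζ c l) : ζ ≤ 1 := by
  nlinarith [H.ζθ_le, H.one_le, H.ζ_nonneg]

theorem u_le (H : IsPotential p r u θ ζ c l) : u ≤ 1 := by
  nlinarith [H.uθ, H.one_le, H.u_nonneg]

theorem puζ (H : IsPotential p r u θ ζ c l) : p * u * ζ = (1 - p) * θ := by
  rw [H.hζ, ← H.pr]
  linear_combination p * r * θ * H.uθ

theorem l_nonneg (H : IsPotential p r u θ ζ c l) : 0 ≤ l := by
  rw [H.l_eq]
  have := H.p_nonneg
  have := H.p_le
  have := H.u_nonneg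
  have := H.θ_pos
  have : 0 ≤ 1 - p := by linarith
  positivity

theorem l_le (H : IsPotential p r u θ ζ c l) : p + (1 - p) * θ ^ 2 = l * θ := by
  rw [H.l_eq]
  linear_combination -p * H.uθ

theorem coeff_le (H : IsPotential p r u θ ζ c l) (K : ℕ) :
    0 ≤ c * (θ * ζ) ^ K ∧ c * (θ * ζ) ^ K ≤ θ ^ (K + 1) := by
  have h1 : 0 ≤ θ * ζ := mul_nonneg H.θ_pos.le H.ζ_nonneg
  have h2 : (θ * ζ) ^ K ≤ 1 := pow_le_one₀ h1 (by linarith [H.ζθ_le])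
  refine ⟨mul_nonneg H.c_nonneg (pow_nonneg h1 K), ?_⟩
  refine le_trans ?_ (one_le_pow₀ H.one_le)
  exact mul_le_one₀ H.c_le (pow_nonneg h1 K) h2

theorem potAlive_nonneg (H : IsPotential p r u θ ζ c l) (h K : ℕ) :
    0 ≤ potAlive u θ ζ c h K := by
  have h1 := (H.coeff_le K).1
  have h2 : ζ ^ (h + 1) ≤ 1 := pow_le_one₀ H.ζ_nonneg H.ζ_le
  have h3 := H.u_nonneg
  have h4 := H.ζ_nonneg
  have h5 := H.θ_pos
  have h6 : 0 ≤ 1 - ζ ^ (h + 1) := by linarith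
  unfold potAlive
  refine mul_nonneg (pow_nonneg h3 _) (add_nonneg (mul_nonneg h1 h6) (by positivity))

/-- Needed at the end of the search: replacing the search potential by the probability of ruin must
not increase it. The part of `potAlive` with the factor `ζ ^ (h + 1)` suffices. -/
theorem pow_le_potAlive (H : IsPotential p r u θ ζ c l) (h K : ℕ) :
    r ^ (h + 1) ≤ potAlive u θ ζ c h K := by
  have h1 := (H.coeff_le K).1
  have h2 : ζ ^ (h + 1) ≤ 1 := pow_le_one₀ H.ζ_nonneg H.ζ_le
  have h4 := H.ζ_nonneg
  have h6 : 0 ≤ c * (θ * ζ) ^ K * (1 - ζ ^ (h + 1)) := mul_nonneg h1 (by linarith)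
  have h7 : 1 ≤ θ ^ (K + 1) := one_le_pow₀ H.one_le
  have huz : r ≤ u * ζ := by
    rw [H.hζ]
    have : u * (r * θ ^ 2) = r * θ := by linear_combination r * θ * H.uθ
    rw [this]
    exact le_mul_of_one_le_right H.r_nonneg H.one_le
  have hrz : r ≤ ζ := by
    rw [H.hζ]
    exact le_mul_of_one_le_right H.r_nonneg (one_le_pow₀ H.one_le)
  calc r ^ (h + 1) = r ^ h * r := pow_succ _ _
    _ ≤ (u * ζ) ^ h * ζ := mul_le_mul (pow_le_pow_left₀ H.r_nonneg huz h) hrz H.r_nonneg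
        (pow_nonneg (mul_nonneg H.u_nonneg h4) h)
    _ = u ^ h * (1 * ζ ^ (h + 1)) := by rw [mul_pow]; ring
    _ ≤ potAlive u θ ζ c h K := by
        unfold potAlive
        refine mul_le_mul_of_nonneg_left ?_ (pow_nonneg H.u_nonneg h)
        have := mul_le_mul_of_nonneg_right h7 (pow_nonneg h4 (h + 1))
        linarith

theorem potAlive_succ_le (H : IsPotential p r u θ ζ c l) (h K : ℕ) :
    potAlive u θ ζ c (h + 1) K ≤ potAlive u θ ζ c h K := by
  obtain ⟨h1, h2⟩ := H.coeff_le K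
  set A := c * (θ * ζ) ^ K
  set B := θ ^ (K + 1)
  have h4 := H.ζ_nonneg
  have h5 : ζ ^ (h + 2) ≤ ζ ^ (h + 1) := pow_le_pow_of_le_one h4 H.ζ_le (by omega)
  have h6 : u ^ (h + 1) ≤ u ^ h := pow_le_pow_of_le_one H.u_nonneg H.u_le (by omega)
  have h7 : (0 : ℝ) ≤ ζ ^ (h + 2) := pow_nonneg h4 _
  unfold potAlive
  refine mul_le_mul h6 ?_ ?_ (pow_nonneg H.u_nonneg _)
  · change A * (1 - ζ ^ (h + 2)) + B * ζ ^ (h + 2) ≤ A * (1 - ζ ^ (h + 1)) + B * ζ ^ (h + 1)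
    nlinarith
  · change 0 ≤ A * (1 - ζ ^ (h + 2)) + B * ζ ^ (h + 2)
    nlinarith

theorem potAlive_zero_le (H : IsPotential p r u θ ζ c l) (K : ℕ) :
    potAlive u θ ζ c 0 K ≤ θ ^ (K + 1) := by
  obtain ⟨h1, h2⟩ := H.coeff_le K
  unfold potAlive
  simp only [pow_zero, one_mul, zero_add, pow_one]
  nlinarith [H.ζ_le]

/-- The potential is harmonic up to the factor `l` while the maximum does not change. -/
theorem potAlive_step (H : IsPotential p r u θ ζ c l) (h K : ℕ) :
    p * potAlive u θ ζ c (h + 2) K + (1 - p) * potAlive u θ ζ c h K =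
      l * potAlive u θ ζ c (h + 1) K := by
  unfold potAlive
  rw [H.l_eq]
  set A := c * (θ * ζ) ^ K
  set B := θ ^ (K + 1)
  have e := H.puζ
  have e' := H.uθ
  have : (1 - p) * u ^ h = (1 - p) * θ * u ^ (h + 1) := by
    rw [pow_succ]; linear_combination (-(1 - p) * u ^ h) * e'
  calc p * (u ^ (h + 2) * (A * (1 - ζ ^ (h + 2 + 1)) + B * ζ ^ (h + 2 + 1))) +
        (1 - p) * (u ^ h * (A * (1 - ζ ^ (h + 1)) + B * ζ ^ (h + 1)))
      = p * u ^ (h + 2) * (A * (1 - ζ ^ (h + 2 + 1)) + B * ζ ^ (h + 2 + 1)) +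
        (1 - p) * u ^ h * (A * (1 - ζ ^ (h + 1)) + B * ζ ^ (h + 1)) := by ring
    _ = p * u ^ (h + 2) * (A * (1 - ζ ^ (h + 2 + 1)) + B * ζ ^ (h + 2 + 1)) +
        (1 - p) * θ * u ^ (h + 1) * (A * (1 - ζ ^ (h + 1)) + B * ζ ^ (h + 1)) := by rw [this]
    _ = _ := by linear_combination (u ^ (h + 1) * (B - A) * ζ ^ (h + 1) * (ζ - 1)) * e

/-- The sequences `u ^ h` and `(u * ζ) ^ h` solve the recursion with factor `l`, and `potAlive` is
their combination whose value at height `-1` is `θ ^ (K + 2)`. That is the potential of `waiting (K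
+ 1)`, the state entered when the candidate is undercut. -/
theorem potAlive_step_zero (H : IsPotential p r u θ ζ c l) (K : ℕ) :
    p * potAlive u θ ζ c 1 K + (1 - p) * θ ^ (K + 2) = l * potAlive u θ ζ c 0 K := by
  unfold potAlive
  rw [H.l_eq]
  set A := c * (θ * ζ) ^ K
  have e := H.puζ
  have e2 : θ ^ (K + 2) = θ ^ (K + 1) * θ := pow_succ _ _
  rw [e2]
  set B := θ ^ (K + 1)
  simp only [pow_zero, one_mul, zero_add, pow_one]
  linear_combination ((B - A) * (ζ - 1)) * e

theorem potAlive_diag_le (H : IsPotential p r u θ ζ c l) (K : ℕ) :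
    potAlive u θ ζ c (K + 1) (K + 1) ≤ potAlive u θ ζ c (K + 1) K := by
  have e1 : u ^ (K + 1) * θ ^ (K + 1) = 1 := by rw [← mul_pow, H.uθ, one_pow]
  have e2 : u ^ (K + 1) * θ ^ K = u := by
    rw [pow_succ, mul_right_comm, ← mul_pow, H.uθ, one_pow, one_mul]
  have h4 := H.ζ_nonneg
  have key : c * ζ ^ K * u * (1 - θ * ζ) * (1 - ζ ^ (K + 2)) ≥ (θ - 1) * ζ ^ (K + 2) := by
    have h5 : ζ ^ (K + 2) ≤ ζ ^ 2 := pow_le_pow_of_le_one h4 H.ζ_le (by omega)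
    have h6 : 0 ≤ c * u * (1 - θ * ζ) := mul_nonneg (mul_nonneg H.c_nonneg H.u_nonneg)
      (by linarith [H.ζθ_le])
    have h7 := H.decay
    have h8 : c * u * (1 - θ * ζ) * (1 - ζ ^ 2) ≤ c * u * (1 - θ * ζ) * (1 - ζ ^ (K + 2)) :=
      mul_le_mul_of_nonneg_left (by linarith) h6
    have h9 := mul_le_mul_of_nonneg_left (h7.trans h8) (pow_nonneg h4 K)
    calc (θ - 1) * ζ ^ (K + 2) = ζ ^ K * ((θ - 1) * ζ ^ 2) := by ring
      _ ≤ _ := h9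
      _ = _ := by ring
  have e3 : potAlive u θ ζ c (K + 1) (K + 1) - potAlive u θ ζ c (K + 1) K =
      (θ - 1) * ζ ^ (K + 2) - c * ζ ^ K * u * (1 - θ * ζ) * (1 - ζ ^ (K + 2)) := by
    unfold potAlive
    rw [mul_pow, mul_pow, pow_succ θ (K + 1)]
    linear_combination ((θ - 1) * ζ ^ (K + 2)) * e1 -
      (c * ζ ^ K * (1 - θ * ζ) * (1 - ζ ^ (K + 2))) * e2
  linarith

theorem potSearch_nonneg (H : IsPotential p r u θ ζ c l) (z : PivotState) :
    0 ≤ potSearch u θ ζ c z := by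
  cases z with
  | waiting d => exact pow_nonneg H.θ_pos.le _
  | alive h e => exact H.potAlive_nonneg _ _

theorem potKeep_nonneg (H : IsPotential p r u θ ζ c l) (z : PivotState) : 0 ≤ potKeep r z := by
  cases z with
  | waiting d => exact zero_le_one
  | alive h e => exact pow_nonneg H.r_nonneg _

theorem potKeep_le (H : IsPotential p r u θ ζ c l) (z : PivotState) :
    potKeep r z ≤ potSearch u θ ζ c z := by
  cases z with
  | waiting d => exact one_le_pow₀ H.one_le
  | alive h e => exact H.pow_le_potAlive _ _

/-- Raising the walk by one from `alive h e`. -/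
theorem potAlive_up_le (H : IsPotential p r u θ ζ c l) (h e : ℕ) :
    potAlive u θ ζ c (h + 1) (h + 1 + (e - 1)) ≤ potAlive u θ ζ c (h + 1) (h + e) := by
  rcases e with _ | e
  · exact H.potAlive_diag_le h
  · rw [show h + 1 + (e + 1 - 1) = h + (e + 1) by omega]

theorem potSearch_mono (H : IsPotential p r u θ ζ c l) (z : PivotState) :
    potSearch u θ ζ c (z.search true) ≤ potSearch u θ ζ c (z.search false) := by
  cases z with
  | waiting d =>
    cases d with
    | zero =>
      refine (H.potAlive_zero_le 0).trans ?_
      exact pow_le_pow_right₀ H.one_le (by omega)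
    | succ d => exact pow_le_pow_right₀ H.one_le (by omega)
  | alive h e =>
    refine (H.potAlive_up_le h e).trans ((H.potAlive_succ_le h _).trans ?_)
    cases h with
    | zero =>
      refine (H.potAlive_zero_le _).trans ?_
      rw [zero_add]
      exact pow_le_pow_right₀ H.one_le (by omega)
    | succ h =>
      refine (H.potAlive_succ_le h _).trans (le_of_eq ?_)
      change _ = potAlive u θ ζ c h (h + (e + 1))
      rw [show h + (e + 1) = h + 1 + e by omega]

/-- While waiting below the maximum, `p + (1 - p) * θ ^ 2 = l * θ` gives equality. A new candidate
is accepted at cost at most `1`, which is the condition `start`. With a candidate alive, the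
potential is harmonic up to `l`, except at new maxima, where it only drops. -/
theorem potSearch_step (H : IsPotential p r u θ ζ c l) (z : PivotState) :
    p * potSearch u θ ζ c (z.search true) + (1 - p) * potSearch u θ ζ c (z.search false) ≤
      l * potSearch u θ ζ c z := by
  have hp := H.p_nonneg
  have hl := H.l_le
  cases z with
  | waiting d =>
    cases d with
    | zero =>
      have h1 : potAlive u θ ζ c 0 (0 + 0) ≤ 1 := by
        have := H.start
        simp only [potAlive, pow_zero, one_mul, zero_add, pow_one, mul_one]
        linarith
      change p * potAlive u θ ζ c 0 (0 + 0) + (1 - p) * θ ^ (0 + 1 + 1) ≤ l * θ ^ (0 + 1)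
      have h2 := mul_le_mul_of_nonneg_left h1 hp
      simp only [zero_add, pow_one] at h2 ⊢
      rw [show (1 + 1 : ℕ) = 2 from rfl]
      linarith
    | succ d =>
      change p * θ ^ (d + 1) + (1 - p) * θ ^ (d + 1 + 1 + 1) ≤ l * θ ^ (d + 1 + 1)
      have : l * θ ^ (d + 1 + 1) = θ ^ (d + 1) * (l * θ) := by ring
      rw [this, ← hl]
      apply le_of_eq
      ring
  | alive h e =>
    have h1 := mul_le_mul_of_nonneg_left (H.potAlive_up_le h e) hp
    cases h with
    | zero =>
      have h2 := H.potAlive_step_zero (0 + e)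
      change p * potAlive u θ ζ c (0 + 1) (0 + 1 + (e - 1)) + (1 - p) * θ ^ (e + 1 + 1) ≤
        l * potAlive u θ ζ c 0 (0 + e)
      simp only [zero_add] at h1 h2 ⊢
      rw [show e + 1 + 1 = e + 2 from rfl]
      linarith
    | succ h =>
      have h2 := H.potAlive_step h (h + 1 + e)
      change p * potAlive u θ ζ c (h + 1 + 1) (h + 1 + 1 + (e - 1)) +
        (1 - p) * potAlive u θ ζ c h (h + (e + 1)) ≤ l * potAlive u θ ζ c (h + 1) (h + 1 + e)
      rw [show h + (e + 1) = h + 1 + e by omega]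
      rw [show h + 1 + 1 = h + 2 by omega] at h1 ⊢
      linarith

theorem r_le (H : IsPotential p r u θ ζ c l) : r ≤ 1 := by
  have := H.ζ_le
  rw [H.hζ] at this
  exact le_trans (le_mul_of_one_le_right H.r_nonneg (one_le_pow₀ H.one_le)) this

theorem potKeep_mono (H : IsPotential p r u θ ζ c l) (z : PivotState) :
    potKeep r (z.keep true) ≤ potKeep r (z.keep false) := by
  cases z with
  | waiting d => exact le_rfl
  | alive h e =>
    cases h with
    | zero => exact pow_le_one₀ H.r_nonneg H.r_le
    | succ h => exact pow_le_pow_of_le_one H.r_nonneg H.r_le (by omega)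

theorem potKeep_search_mono (H : IsPotential p r u θ ζ c l) (z : PivotState) :
    potKeep r (z.search true) ≤ potKeep r (z.search false) := by
  cases z with
  | waiting d =>
    cases d with
    | zero => exact pow_le_one₀ H.r_nonneg H.r_le
    | succ d => exact le_rfl
  | alive h e =>
    cases h with
    | zero => exact pow_le_one₀ H.r_nonneg H.r_le
    | succ h => exact pow_le_pow_of_le_one H.r_nonneg H.r_le (by omega)

/-- Gambler's ruin: `p * r = 1 - p` makes `r ^ (h + 1)` harmonic, with boundary value `1` below the
candidate. -/
theorem potKeep_step (H : IsPotential p r u θ ζ c l) (z : PivotState) :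
    p * potKeep r (z.keep true) + (1 - p) * potKeep r (z.keep false) ≤ potKeep r z := by
  have hpr := H.pr
  cases z with
  | waiting d => simp [keep, potKeep]
  | alive h e =>
    cases h with
    | zero =>
      change p * r ^ (0 + 1 + 1) + (1 - p) * 1 ≤ r ^ (0 + 1)
      apply le_of_eq
      linear_combination (r - 1) * hpr
    | succ h =>
      change p * r ^ (h + 1 + 1 + 1) + (1 - p) * r ^ (h + 1) ≤ r ^ (h + 1 + 1)
      apply le_of_eq
      linear_combination (r ^ (h + 1) * (r - 1)) * hpr

end IsPotential

/-- The search accepts candidates during the first `n₁` steps. -/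
def pivotUpd (n₁ : ℕ) (z : ℕ × PivotState) (b : Bool) : ℕ × PivotState :=
  (z.1 + 1, if z.1 < n₁ then z.2.search b else z.2.keep b)

end PivotState

/-! ### Correctness and failure probability of the pivot search -/

open PivotState

/-- A step `c ≤ n₁` at which the walk exceeds all its previous values and the level `d`, and which
is never undercut later. -/
def HasPivot (w : ℕ → Option Bool) (s n₁ d : ℕ) : Prop :=
  ∃ c, 1 ≤ c ∧ c ≤ n₁ ∧ (d : ℤ) < stepSum w s c ∧ (∀ m < c, stepSum w s m < stepSum w s c) ∧
    ∀ m, c ≤ m → stepSum w s c ≤ stepSum w s m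

/-- What the state of the search says about the walk. -/
def PivotInv (w : ℕ → Option Bool) (s d n : ℕ) : PivotState → Prop
  | waiting d' => (d : ℤ) ≤ stepSum w s n + d' ∧ ∀ m ≤ n, stepSum w s m ≤ stepSum w s n + d'
  | alive h e => ∃ c, 1 ≤ c ∧ c ≤ n ∧ stepSum w s n = stepSum w s c + h ∧
      (d : ℤ) < stepSum w s c ∧ (∀ m < c, stepSum w s m < stepSum w s c) ∧
      ∀ m, c ≤ m → m ≤ n → stepSum w s c ≤ stepSum w s m ∧ stepSum w s m ≤ stepSum w s n + e

theorem PivotInv.search {w : ℕ → Option Bool} {s d n : ℕ} {z : PivotState}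
    (h : PivotInv w s d n z) : PivotInv w s d (n + 1) (z.search (step w s n)) := by
  have hs := stepSum_succ w s n
  have hsplit : ∀ m, m ≤ n + 1 → m ≤ n ∨ m = n + 1 := fun m hm => by omega
  cases z with
  | waiting d' =>
    obtain ⟨h1, h2⟩ := h
    cases hb : step w s n with
    | false =>
      rw [hb] at hs
      simp only [Bool.false_eq_true, if_false] at hs
      have : (waiting d').search false = waiting (d' + 1) := by cases d' <;> rfl
      rw [this]
      refine ⟨by push_cast; omega, fun m hm => ?_⟩
      rcases hsplit m hm with hm | rfl
      · have := h2 m hm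
        push_cast
        omega
      · push_cast; omega
    | true =>
      rw [hb] at hs
      simp only [if_true] at hs
      cases d' with
      | zero =>
        change PivotInv w s d (n + 1) (alive 0 0)
        refine ⟨n + 1, by omega, le_rfl, by simp, by push_cast at h1; omega, fun m hm => ?_,
          fun m h3 h4 => ?_⟩
        · have := h2 m (by omega)
          push_cast at this
          omega
        · rw [show m = n + 1 by omega]
          simp
      | succ d' =>
        change PivotInv w s d (n + 1) (waiting d')
        refine ⟨by push_cast at h1; omega, fun m hm => ?_⟩
        rcases hsplit m hm with hm | rfl
        · have := h2 m hm
          push_cast at this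
          omega
        · omega
  | alive h' e =>
    obtain ⟨c, h1, h2, h3, h4, h5, h6⟩ := h
    cases hb : step w s n with
    | true =>
      rw [hb] at hs
      simp only [if_true] at hs
      change PivotInv w s d (n + 1) (alive (h' + 1) (e - 1))
      refine ⟨c, h1, by omega, by push_cast; omega, h4, h5, fun m h7 h8 => ?_⟩
      rcases hsplit m h8 with hm | rfl
      · have := h6 m h7 hm
        omega
      · constructor <;> omega
    | false =>
      rw [hb] at hs
      simp only [Bool.false_eq_true, if_false] at hs
      cases h' with
      | zero =>
        change PivotInv w s d (n + 1) (waiting (e + 1))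
        have h0 : stepSum w s c ≤ stepSum w s (n + 1) + ((e + 1 : ℕ) : ℤ) := by
          push_cast at h3 ⊢; omega
        refine ⟨by omega, fun m hm => ?_⟩
        rcases hsplit m hm with hm | rfl
        · rcases lt_or_ge m c with hmc | hmc
          · have := h5 m hmc
            omega
          · have := (h6 m hmc hm).2
            push_cast
            omega
        · omega
      | succ h' =>
        change PivotInv w s d (n + 1) (alive h' (e + 1))
        refine ⟨c, h1, by omega, by push_cast at h3; omega, h4, h5, fun m h7 h8 => ?_⟩
        rcases hsplit m h8 with hm | rfl
        · have := h6 m h7 hm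
          push_cast
          omega
        · push_cast at h3 ⊢
          constructor <;> omega

/-- The candidate that is alive after `n₁` steps is never lost, as `keep` never leaves a waiting
state. Its height above the candidate, a natural number, then stays the exact excess of the walk, so
the walk never falls below the candidate. -/
theorem hasPivot_of_search {w : ℕ → Option Bool} {s n₁ d : ℕ}
    (h : ¬ ∃ n, runState (pivotUpd n₁) (0, waiting d) w s n ∈
      {z : ℕ × PivotState | n₁ ≤ z.1 ∧ ∃ d', z.2 = waiting d'}) : HasPivot w s n₁ d := by
  have hfst : ∀ n, (runState (pivotUpd n₁) (0, waiting d) w s n).1 = n := by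
    intro n
    induction n with
    | zero => rfl
    | succ n ih => rw [runState, pivotUpd, ih]
  have hinv : ∀ n ≤ n₁, PivotInv w s d n (runState (pivotUpd n₁) (0, waiting d) w s n).2 := by
    intro n hn
    induction n with
    | zero => exact ⟨by simp [stepSum], fun m hm => by rw [Nat.le_zero.1 hm]; omega⟩
    | succ n ih =>
      rw [runState, pivotUpd, hfst, if_pos (by omega)]
      exact (ih (by omega)).search
  rw [not_exists] at h
  have halive : ∀ n, n₁ ≤ n → ∃ h' e,
      (runState (pivotUpd n₁) (0, waiting d) w s n).2 = alive h' e := by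
    intro n hn
    have := h n
    rw [Set.mem_ofPred_eq, hfst] at this
    rcases hz : (runState (pivotUpd n₁) (0, waiting d) w s n).2 with d' | ⟨h', e⟩
    · exact absurd ⟨hn, d', hz⟩ this
    · exact ⟨h', e, rfl⟩
  obtain ⟨h₁, e₁, hz₁⟩ := halive n₁ le_rfl
  have h1 := hinv n₁ le_rfl
  rw [hz₁] at h1
  obtain ⟨c, hc1, hc2, hc3, hc4, hc5, hc6⟩ := h1
  have hkeep : ∀ n, n₁ ≤ n → ∀ h' e,
      (runState (pivotUpd n₁) (0, waiting d) w s n).2 = alive h' e →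
        stepSum w s n = stepSum w s c + h' := by
    intro n hn
    induction n, hn using Nat.le_induction with
    | base =>
      intro h' e he
      rw [hz₁] at he
      cases he
      exact hc3
    | succ n hn ih =>
      intro h' e he
      obtain ⟨h'', e'', hz⟩ := halive n hn
      have h2 := ih h'' e'' hz
      rw [runState, pivotUpd, hfst, if_neg (by omega), hz] at he
      simp only at he
      rw [stepSum_succ, h2]
      cases hb : step w s n with
      | true =>
        rw [hb] at he
        cases he
        simp only [if_true]
        push_cast
        ring
      | false =>
        rw [hb] at he
        cases h'' with
        | zero => simp [PivotState.keep] at he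
        | succ h'' =>
          cases he
          simp only [Bool.false_eq_true, if_false]
          push_cast
          ring
  refine ⟨c, hc1, hc2, hc4, hc5, fun m hm => ?_⟩
  rcases le_or_gt m n₁ with hmn | hmn
  · exact (hc6 m hm hmn).1
  · obtain ⟨h', e', hz⟩ := halive m hmn.le
    have := hkeep m hmn.le h' e' hz
    omega

namespace SlotLaw

variable {Ω : Type*} [MeasurableSpace Ω] {P : Measure Ω}
  {o : Ω → ℕ → Option Bool} {f α p : ℝ} {π : ℕ → ℝ}

/-- The search for a pivot fails with small probability. -/
theorem not_hasPivot_le [IsProbabilityMeasure P] (h : SlotLaw P o f α p π) {r u θ ζ c l : ℝ}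
    (H : IsPotential p r u θ ζ c l) (s n₁ : ℕ) :
    P {ω | ¬ HasPivot (o ω) s n₁ (drawdown (o ω) s)} ≤
      ENNReal.ofReal (l ^ n₁) * ∫⁻ ω, ENNReal.ofReal (θ ^ (drawdown (o ω) s + 1)) ∂P := by
  -- The discount `l ^ (n₁ - z.1)` makes the search potential a supermartingale; it starts at `l ^
  -- n₁ * θ ^ (drawdown + 1)` if `0 < n₁`. After `n₁` steps it is replaced by the probability of
  -- ruin, which is `1` precisely when the search has failed or `r = 1`.
  set V : ℕ × PivotState → ℝ := fun z =>
    if z.1 < n₁ then l ^ (n₁ - z.1) * potSearch u θ ζ c z.2 else potKeep r z.2 with hV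
  have hl := H.l_nonneg
  have hup : ∀ n z, n < n₁ → V (n + 1, z) ≤ l ^ (n₁ - (n + 1)) * potSearch u θ ζ c z := by
    intro n z hn
    simp only [hV]
    split_ifs with h1
    · exact le_rfl
    · rw [show n₁ - (n + 1) = 0 by omega, pow_zero, one_mul]
      exact H.potKeep_le z
  have key := h.exists_runState_le H.p_nonneg (pivotUpd n₁) s
    (z₀ := fun w => (0, waiting (drawdown w s))) (fun w w' hw => by rw [drawdown_congr hw])
    (V := V)
    (fun z => by
      simp only [hV]
      split_ifs
      · exact mul_nonneg (pow_nonneg hl _) (H.potSearch_nonneg _)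
      · exact H.potKeep_nonneg _)
    (fun z => by
      simp only [hV, pivotUpd]
      by_cases h1 : z.1 < n₁
      · simp only [h1, if_true]
        split_ifs with h2
        · exact mul_le_mul_of_nonneg_left (H.potSearch_mono _) (pow_nonneg hl _)
        · exact H.potKeep_search_mono _
      · simp only [h1, if_false, show ¬ z.1 + 1 < n₁ by omega]
        exact H.potKeep_mono _)
    (fun z => by
      by_cases h1 : z.1 < n₁
      · simp only [pivotUpd, h1, if_true]
        have a1 := mul_le_mul_of_nonneg_left (hup z.1 (z.2.search true) h1) H.p_nonneg
        have a2 := mul_le_mul_of_nonneg_left (hup z.1 (z.2.search false) h1)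
          (show 0 ≤ 1 - p by linarith [H.p_le])
        have a3 := mul_le_mul_of_nonneg_left (H.potSearch_step z.2)
          (pow_nonneg hl (n₁ - (z.1 + 1)))
        have a4 : V z = l ^ (n₁ - (z.1 + 1)) * (l * potSearch u θ ζ c z.2) := by
          simp only [hV, h1, if_true]
          rw [show n₁ - z.1 = n₁ - (z.1 + 1) + 1 by omega]
          ring
        rw [a4]
        linarith
      · simp only [hV, pivotUpd, h1, if_false, show ¬ z.1 + 1 < n₁ by omega]
        exact H.potKeep_step _)
    (S := {z | n₁ ≤ z.1 ∧ ∃ d', z.2 = waiting d'})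
    (by
      rintro ⟨n, z⟩ ⟨h1, d', h2⟩
      simp only at h1 h2
      subst h2
      simp only [hV, not_lt.2 h1, if_false, potKeep, le_refl])
  refine (measure_mono fun ω hω => ?_).trans (key.trans ?_)
  · by_contra hcon
    exact hω (hasPivot_of_search hcon)
  · rw [← lintegral_const_mul' _ _ ENNReal.ofReal_ne_top]
    refine lintegral_mono fun ω => ?_
    rw [← ENNReal.ofReal_mul (pow_nonneg hl _)]
    refine ENNReal.ofReal_le_ofReal ?_
    simp only [hV]
    split_ifs with h1
    · exact le_rfl
    · rw [show n₁ = 0 by omega, pow_zero, one_mul]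
      exact H.potKeep_le _

end SlotLaw

/-! ### Runs of unheard special slots -/

theorem exists_special (w : ℕ → Option Bool) {t i n : ℕ} (hti : t ≤ i) (hn : 1 ≤ n)
    (hni : n ≤ numSpecial w t i) :
    ∃ j, t < j ∧ j ≤ i ∧ w j = some true ∧ numSpecial w t j = n := by
  induction i, hti using Nat.le_induction with
  | base => simp at hni; omega
  | succ i hi ih =>
    by_cases h1 : n ≤ numSpecial w t i
    · obtain ⟨j, h2, h3, h4⟩ := ih h1
      exact ⟨j, h2, by omega, h4⟩
    · have h2 := numSpecial_succ w hi
      by_cases h3 : w (i + 1) = some true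
      · rw [if_pos h3] at h2
        exact ⟨i + 1, by omega, le_rfl, h3, by omega⟩
      · rw [if_neg h3] at h2
        omega

theorem numSpecial_lt (w : ℕ → Option Bool) {t j i : ℕ} (htj : t ≤ j) (hji : j < i)
    (hi : w i = some true) : numSpecial w t j < numSpecial w t i := by
  obtain ⟨i, rfl⟩ : ∃ i', i = i' + 1 := ⟨i - 1, by omega⟩
  have h1 := numSpecial_add w htj (show j ≤ i by omega)
  have h2 := numSpecial_succ w (show t ≤ i by omega)
  rw [if_pos hi] at h2
  omega

/-- `j` is the `R`-th special slot after the `a`-th non-empty slot after `s`, and `e` holds for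
those of the special slots before `j` that are less than `v` positions away from it. -/
def RunBefore (w : ℕ → Option Bool) (e : ℕ → Prop) (s a R v j : ℕ) : Prop :=
  ∃ t, IsNth w s a t ∧ t < j ∧ w j = some true ∧ numSpecial w t j = R ∧
    ∀ l, t < l → l < j → w l = some true → numSpecial w l j < v → e l

/-- `e` holds for the special slots number `R - v + 1, …, R` after the `a`-th non-empty slot
after `s`. -/
def UnheardRun (w : ℕ → Option Bool) (e : ℕ → Prop) (s a R v : ℕ) : Prop :=
  v = 0 ∨ ∃ j, RunBefore w e s a R v j ∧ e j

theorem RunBefore.unique {w : ℕ → Option Bool} {e : ℕ → Prop} {s a R v j j' : ℕ}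
    (h : RunBefore w e s a R v j) (h' : RunBefore w e s a R v j') : j = j' := by
  obtain ⟨t, h1, h2, h3, h4, _⟩ := h
  obtain ⟨t', h1', h2', h3', h4', _⟩ := h'
  obtain rfl := h1.unique h1'
  rcases lt_trichotomy j j' with h5 | h5 | h5
  · have := numSpecial_lt w h2.le h5 h3'
    omega
  · exact h5
  · have := numSpecial_lt w h2'.le h5 h3
    omega

/-- What is required before the special slot number `R + 1` is itself a run that ends at number `R`.
This closes the induction in `UnheardLaw.unheardRun_le`. -/
theorem RunBefore.unheardRun {w : ℕ → Option Bool} {e : ℕ → Prop} {s a R v j : ℕ}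
    (h : RunBefore w e s a (R + 1) (v + 1) j) (hv : v ≤ R) : UnheardRun w e s a R v := by
  rcases Nat.eq_zero_or_pos v with rfl | hv0
  · exact Or.inl rfl
  obtain ⟨t, h1, h2, h3, h4, h5⟩ := h
  obtain ⟨j', h6, h7, h8, h9⟩ := exists_special w h2.le (show 1 ≤ R by omega)
    (show R ≤ numSpecial w t j by omega)
  have hne : j' ≠ j := by rintro rfl; omega
  have h10 := numSpecial_add w h6.le h7
  refine Or.inr ⟨j', ⟨t, h1, h6, h8, h9, fun j'' k1 k2 k3 k4 => ?_⟩, ?_⟩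
  · refine h5 j'' k1 (by omega) k3 ?_
    have := numSpecial_add w k2.le h7
    omega
  · exact h5 j' h6 (by omega) h8 (by omega)

/-- If the last special slots up to slot `i` are unheard, this is visible in a run of `e`. -/
theorem unheardRun_of {w : ℕ → Option Bool} {e : ℕ → Prop} {s a t i : ℕ} (hN : IsNth w s a t)
    (hti : t ≤ i) {x : ℝ} (hx : x ≤ numSpecial w t i)
    (he : ∀ j i', t < j → w j = some true → (numSpecial w j i : ℝ) < x → j < i' → i' ≤ i →
      w i' = some true → e j) :
    UnheardRun w e s a (numSpecial w t i - 1) (⌈x⌉₊ - 1) := by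
  rcases Nat.eq_zero_or_pos (⌈x⌉₊ - 1) with h0 | hv
  · exact Or.inl h0
  have hR : ⌈x⌉₊ ≤ numSpecial w t i := Nat.ceil_le.2 hx
  -- The run ends at the last special slot but one: unheard is concluded only for blocks that are
  -- followed by a further special slot `j₁ ≤ i`. This costs one position and one unit of length.
  obtain ⟨j, h6, h7, h8, h9⟩ := exists_special w hti (show 1 ≤ numSpecial w t i - 1 by omega)
    (show numSpecial w t i - 1 ≤ numSpecial w t i by omega)
  obtain ⟨j₁, k6, k7, k8, k9⟩ := exists_special w hti (show 1 ≤ numSpecial w t i by omega) le_rfl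
  have h10 := numSpecial_add w h6.le h7
  have hlt : j < j₁ := by
    by_contra hge
    have := numSpecial_add w k6.le (not_lt.1 hge)
    omega
  have key : ∀ j', t < j' → j' ≤ j → w j' = some true → numSpecial w j' j < ⌈x⌉₊ - 1 → e j' := by
    intro j' l1 l2 l3 l4
    refine he j' j₁ l1 l3 (Nat.lt_ceil.1 ?_) (by omega) k7 k8
    have := numSpecial_add w l2 h7
    omega
  refine Or.inr ⟨j, ⟨t, hN, h6, h8, h9, fun j' l1 l2 l3 l4 => key j' l1 l2.le l3 l4⟩, ?_⟩
  exact key j h6 le_rfl h8 (by simpa using hv)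

/-- Given the past, the block of a special slot remains unheard until the next non-empty slot with
probability at most one half. -/
structure UnheardLaw {Ω : Type*} [MeasurableSpace Ω] (P : Measure Ω) (o : Ω → ℕ → Option Bool)
    (e : Ω → ℕ → Prop) : Prop where
  meas : ∀ i, MeasurableSet {ω | e ω i}
  half : ∀ t (𝒜 : Set ((ℕ → Option Bool) × (ℕ → Prop))),
    (∀ w w' ε ε', (∀ i ≤ t, w i = w' i) → (∀ i < t, ε i ↔ ε' i) → (w, ε) ∈ 𝒜 → (w', ε') ∈ 𝒜) →
    (∀ x ∈ 𝒜, x.1 t = some true) →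
    P {ω | (o ω, e ω) ∈ 𝒜 ∧ e ω t} ≤ ENNReal.ofReal (1 / 2) * P {ω | (o ω, e ω) ∈ 𝒜}

namespace UnheardLaw

variable {Ω : Type*} [MeasurableSpace Ω] {P : Measure Ω}
  {o : Ω → ℕ → Option Bool} {f α p : ℝ} {π : ℕ → ℝ} {e : Ω → ℕ → Prop}

theorem measurableSet (h : SlotLaw P o f α p π) (hu : UnheardLaw P o e) {t : ℕ}
    {𝒜 : Set ((ℕ → Option Bool) × (ℕ → Prop))}
    (hA : ∀ w w' ε ε', (∀ i ≤ t, w i = w' i) → (∀ i < t, ε i ↔ ε' i) →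
      (w, ε) ∈ 𝒜 → (w', ε') ∈ 𝒜) : MeasurableSet {ω | (o ω, e ω) ∈ 𝒜} := by
  have : {ω | (o ω, e ω) ∈ 𝒜} = ⋃ v : Fin t → Prop,
      (⋂ i : Fin t, {ω | e ω i ↔ v i}) ∩
        {ω | o ω ∈ {w | (w, fun i => if hi : i < t then v ⟨i, hi⟩ else False) ∈ 𝒜}} := by
    ext ω
    simp only [Set.mem_ofPred_eq, Set.mem_iUnion, Set.mem_inter_iff, Set.mem_iInter]
    constructor
    · intro hω
      refine ⟨fun i => e ω i, fun i => Iff.rfl, hA _ _ _ _ (fun _ _ => rfl) (fun i hi => ?_) hω⟩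
      simp [hi]
    · rintro ⟨v, hv, hv2⟩
      refine hA _ _ _ _ (fun _ _ => rfl) (fun i hi => ?_) hv2
      simp [hi, hv ⟨i, hi⟩]
  rw [this]
  refine MeasurableSet.iUnion fun v => (MeasurableSet.iInter fun i => ?_).inter
    (h.measurableSet (t := t) fun w w' hw h1 => hA _ _ _ _ hw (fun _ _ => Iff.rfl) h1)
  by_cases hv : v i
  · simp only [hv, iff_true]
    exact hu.meas i
  · simp only [hv, iff_false]
    exact (hu.meas i).compl

/-- Each further unheard block costs a factor `1 / 2`. The event before slot `j` belongs to the past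
of `j`, and for distinct `j` these events are disjoint, so the sum over the unknown position `j` of
the last block costs nothing. -/
theorem unheardRun_le [IsProbabilityMeasure P] (h : SlotLaw P o f α p π) (hu : UnheardLaw P o e)
    (s a : ℕ) {R v : ℕ} (hv : v ≤ R) :
    P {ω | UnheardRun (o ω) (e ω) s a R v} ≤ ENNReal.ofReal ((1 / 2) ^ v) := by
  induction v generalizing R with
  | zero => simpa using prob_le_one
  | succ v ih =>
    obtain ⟨R, rfl⟩ : ∃ R', R = R' + 1 := ⟨R - 1, by omega⟩
    set 𝒜 : ℕ → Set ((ℕ → Option Bool) × (ℕ → Prop)) := fun j =>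
      {x | RunBefore x.1 x.2 s a (R + 1) (v + 1) j} with h𝒜
    have hdep : ∀ j w w' ε ε', (∀ i ≤ j, w i = w' i) → (∀ i < j, ε i ↔ ε' i) →
        (w, ε) ∈ 𝒜 j → (w', ε') ∈ 𝒜 j := by
      rintro j w w' ε ε' hw hε ⟨t, h1, h2, h3, h4, h5⟩
      refine ⟨t, h1.congr fun i hi => hw i (by omega), h2, (hw j le_rfl).symm.trans h3, ?_,
        fun j' k1 k2 k3 k4 => ?_⟩
      · change numSpecial w' t j = R + 1
        rw [← numSpecial_congr hw]
        exact h4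
      · refine (hε j' k2).1 (h5 j' k1 k2 ?_ ?_)
        · change w j' = some true
          rw [hw j' k2.le]; exact k3
        · change numSpecial w j' j < v + 1
          rw [numSpecial_congr hw]
          exact k4
    have hsub : {ω | UnheardRun (o ω) (e ω) s a (R + 1) (v + 1)} ⊆
        ⋃ j, {ω | (o ω, e ω) ∈ 𝒜 j ∧ e ω j} := by
      rintro ω (h0 | ⟨j, h1, h2⟩)
      · omega
      · exact Set.mem_iUnion.2 ⟨j, h1, h2⟩
    refine (measure_mono hsub).trans ((measure_iUnion_le _).trans ?_)
    refine (ENNReal.tsum_le_tsum fun j => hu.half j (𝒜 j) (hdep j) ?_).trans ?_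
    · rintro x ⟨t, _, _, h3, _⟩
      exact h3
    rw [ENNReal.tsum_mul_left, ← measure_iUnion]
    · rw [pow_succ', ENNReal.ofReal_mul (by norm_num)]
      refine mul_le_mul_right (le_trans (measure_mono ?_) (ih (R := R) (by omega))) _
      refine Set.iUnion_subset fun j ω hω => ?_
      exact RunBefore.unheardRun hω (by omega)
    · intro j j' hne
      exact Set.disjoint_left.2 fun ω h1 h2 => hne (RunBefore.unique h1 h2)
    · exact fun j => measurableSet h hu (hdep j)

/-- Long runs of unheard special slots are unlikely, uniformly over their position. -/
theorem exists_unheardRun_le [IsProbabilityMeasure P] (h : SlotLaw P o f α p π)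
    (hu : UnheardLaw P o e) (s a : ℕ) {κ y b : ℝ} (hκ0 : 0 < κ) (hκ1 : κ ≤ 1) (hy : 0 ≤ y) :
    P {ω | ∃ R : ℕ, b ≤ κ * R - y ∧ UnheardRun (o ω) (e ω) s a (R - 1) (⌈κ * R - y⌉₊ - 1)} ≤
      ENNReal.ofReal (2 / (1 - (1 / 2 : ℝ) ^ κ) * (1 / 2 : ℝ) ^ b) := by
  -- The least `R` allowed. Each increment of `R` lengthens the run by `κ` on average, which gives a
  -- geometric series with ratio `(1 / 2) ^ κ`.
  set R₀ : ℕ := ⌈(b + y) / κ⌉₊ with hR₀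
  have hR₀b : b + y ≤ κ * R₀ := by
    have := Nat.le_ceil ((b + y) / κ)
    rw [div_le_iff₀ hκ0] at this
    linarith
  have hsub : {ω | ∃ R : ℕ, b ≤ κ * R - y ∧
      UnheardRun (o ω) (e ω) s a (R - 1) (⌈κ * R - y⌉₊ - 1)} ⊆
      ⋃ m : ℕ, {ω | UnheardRun (o ω) (e ω) s a (R₀ + m - 1)
        (⌈κ * (R₀ + m : ℕ) - y⌉₊ - 1)} := by
    rintro ω ⟨R, h1, h2⟩
    have h3 : R₀ ≤ R := Nat.ceil_le.2 (by rw [div_le_iff₀ hκ0]; linarith)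
    refine Set.mem_iUnion.2 ⟨R - R₀, ?_⟩
    rw [Set.mem_ofPred_eq, show R₀ + (R - R₀) = R by omega]
    exact h2
  set ρ : ℝ := (1 / 2 : ℝ) ^ κ with hρ
  have hρ0 : 0 ≤ ρ := Real.rpow_nonneg (by norm_num) _
  have hρ1 : ρ < 1 := Real.rpow_lt_one (by norm_num) (by norm_num) hκ0
  have hsum : HasSum (fun m : ℕ => 2 * (1 / 2 : ℝ) ^ b * ρ ^ m) (2 / (1 - ρ) * (1 / 2 : ℝ) ^ b) := by
    have := (hasSum_geometric_of_lt_one hρ0 hρ1).mul_left (2 * (1 / 2 : ℝ) ^ b)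
    rwa [show 2 / (1 - ρ) * (1 / 2 : ℝ) ^ b = 2 * (1 / 2 : ℝ) ^ b * (1 - ρ)⁻¹ by
      rw [div_eq_mul_inv]; ring]
  have hnn : ∀ m : ℕ, 0 ≤ 2 * (1 / 2 : ℝ) ^ b * ρ ^ m := fun m => by positivity
  refine (measure_mono hsub).trans ((measure_iUnion_le _).trans ?_)
  rw [← hsum.tsum_eq, ENNReal.ofReal_tsum_of_nonneg hnn hsum.summable]
  refine ENNReal.tsum_le_tsum fun m => ?_
  set x : ℝ := κ * (R₀ + m : ℕ) - y with hx
  have hxb : b + κ * m ≤ x := by rw [hx]; push_cast; linarith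
  have hxR : ⌈x⌉₊ ≤ R₀ + m := Nat.ceil_le.2 (by
    rw [hx]
    have : κ * ((R₀ + m : ℕ) : ℝ) ≤ 1 * ((R₀ + m : ℕ) : ℝ) :=
      mul_le_mul_of_nonneg_right hκ1 (Nat.cast_nonneg _)
    linarith)
  refine (unheardRun_le h hu s a (by omega)).trans (ENNReal.ofReal_le_ofReal ?_)
  -- The unit lost here is the origin of the numerator `2` in the bound.
  have h1 : (b + κ * m) - 1 ≤ ((⌈x⌉₊ - 1 : ℕ) : ℝ) := by
    have h2 := Nat.le_ceil x
    have h3 : (⌈x⌉₊ : ℝ) ≤ ((⌈x⌉₊ - 1 : ℕ) : ℝ) + 1 := by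
      exact_mod_cast (by omega : ⌈x⌉₊ ≤ ⌈x⌉₊ - 1 + 1)
    linarith
  calc (1 / 2 : ℝ) ^ (⌈x⌉₊ - 1) = (1 / 2 : ℝ) ^ ((⌈x⌉₊ - 1 : ℕ) : ℝ) := (Real.rpow_natCast _ _).symm
    _ ≤ (1 / 2 : ℝ) ^ ((b + κ * m) - 1) :=
        Real.rpow_le_rpow_of_exponent_ge (by norm_num) (by norm_num) h1
    _ = 2 * (1 / 2 : ℝ) ^ b * ρ ^ m := by
        rw [Real.rpow_sub (by norm_num), Real.rpow_add (by norm_num), Real.rpow_mul (by norm_num),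
          Real.rpow_natCast, Real.rpow_one]
        ring

end UnheardLaw

/-! ### Numerical estimates -/

open PivotState in
/-- The potential that is used to bound the search for a pivot. -/
theorem isPotential_of_bias {ε : ℝ} (h0 : 0 < ε) (h1 : ε ≤ 1) :
    IsPotential ((1 + ε) / 2) ((1 - ε) / (1 + ε)) (1 / (1 + ε ^ 2 / 2)) (1 + ε ^ 2 / 2)
      ((1 - ε) / (1 + ε) * (1 + ε ^ 2 / 2) ^ 2)
      ((1 - (1 + ε ^ 2 / 2) * ((1 - ε) / (1 + ε) * (1 + ε ^ 2 / 2) ^ 2)) /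
        (1 - (1 - ε) / (1 + ε) * (1 + ε ^ 2 / 2) ^ 2))
      ((1 + ε) / 2 * (1 / (1 + ε ^ 2 / 2)) + (1 - (1 + ε) / 2) * (1 + ε ^ 2 / 2)) := by
  set θ : ℝ := 1 + ε ^ 2 / 2 with hθ
  set r : ℝ := (1 - ε) / (1 + ε) with hr
  set ζ : ℝ := r * θ ^ 2 with hζ
  have hθ1 : 1 < θ := by rw [hθ]; have := pow_pos h0 2; linarith
  have hθ2 : θ ≤ 3 / 2 := by rw [hθ]; nlinarith
  have hr0 : 0 ≤ r := div_nonneg (by linarith) (by linarith)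
  have hζ0 : 0 ≤ ζ := mul_nonneg hr0 (sq_nonneg _)
  -- A quantitative form of `θ * ζ ≤ 1`. The constant `7 / 8` is large enough for `decay`, where `(7
  -- / 8) ^ 2` has to exceed the `3 / 4` in `(θ - 1) * θ ≤ 3 / 4 * ε ^ 2`.
  have hmain : ζ * (θ + 7 * ε / 8) ≤ 1 := by
    have h2 : (1 - ε) * θ ^ 2 * (θ + 7 * ε / 8) ≤ 1 + ε := by
      have e1 : (1 - ε) * (θ + 7 * ε / 8) ≤ 1 - ε / 8 - 3 / 8 * ε ^ 2 := by
        rw [hθ]; nlinarith [pow_pos h0 3]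
      have e2 : θ ^ 2 ≤ 1 + 5 / 4 * ε ^ 2 := by
        rw [hθ]; nlinarith [pow_pos h0 2, pow_le_one₀ h0.le h1 (n := 2)]
      have e3 : 0 ≤ (1 - ε) * (θ + 7 * ε / 8) :=
        mul_nonneg (by linarith) (by linarith)
      calc (1 - ε) * θ ^ 2 * (θ + 7 * ε / 8) = (1 - ε) * (θ + 7 * ε / 8) * θ ^ 2 := by ring
        _ ≤ (1 - ε / 8 - 3 / 8 * ε ^ 2) * (1 + 5 / 4 * ε ^ 2) :=
            mul_le_mul e1 e2 (sq_nonneg _) (e3.trans e1)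
        _ ≤ 1 + ε := by nlinarith [pow_pos h0 3, pow_pos h0 4, pow_pos h0 2]
    have h3 : ζ * (θ + 7 * ε / 8) = (1 - ε) * θ ^ 2 * (θ + 7 * ε / 8) / (1 + ε) := by
      rw [hζ, hr]; ring
    rw [h3, div_le_one (by linarith)]
    exact h2
  have hζθ : ζ * θ ≤ 1 := by nlinarith [mul_nonneg hζ0 h0.le]
  have hζ1 : ζ < 1 := by
    by_contra hge
    nlinarith [mul_nonneg hζ0 h0.le]
  have hd : 0 < 1 - ζ := by linarith
  refine ⟨by linarith, by linarith, hr0, ?_, ?_, hθ1.le, by positivity, rfl, rfl, ?_, ?_, hζθ, ?_, ?_⟩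
  · rw [hr]; field_simp; ring
  · field_simp
  · exact div_nonneg (by linarith) hd.le
  · rw [div_le_one hd]; nlinarith
  -- The parameter `c` is chosen to make `start` an equality.
  · rw [div_mul_cancel₀ _ hd.ne']; linarith
  · have hu : (2 : ℝ) / 3 ≤ 1 / θ := by
      rw [div_le_div_iff₀ (by norm_num) (by linarith)]; linarith
    have e1 : 7 * ε / 8 * ζ ≤ 1 - θ * ζ := by linarith
    have e2 : (7 * ε / 8 * ζ) ^ 2 ≤ (1 - θ * ζ) ^ 2 :=
      pow_le_pow_left₀ (mul_nonneg (by linarith) hζ0) e1 2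
    have e3 : (1 - θ * ζ) / (1 - ζ) * (1 / θ) * (1 - θ * ζ) * (1 - ζ ^ 2) =
        (1 - θ * ζ) ^ 2 * (1 + ζ) / θ := by
      field_simp
      ring
    rw [e3, le_div_iff₀ (by linarith)]
    have e4 : (θ - 1) * ζ ^ 2 * θ ≤ (7 * ε / 8 * ζ) ^ 2 := by
      have : (θ - 1) * θ ≤ 3 / 4 * ε ^ 2 := by rw [hθ] at hθ2 ⊢; nlinarith [pow_pos h0 2]
      nlinarith [mul_le_mul_of_nonneg_right this (sq_nonneg ζ), mul_nonneg (sq_nonneg ε) (sq_nonneg ζ)]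
    nlinarith [mul_nonneg (sq_nonneg (1 - θ * ζ)) hζ0]

/-- With `θ - 1 = ε ^ 2 / 2` the factor is `1 - ε ^ 3 / 2` up to order `ε ^ 4`; this is the source
of the cubic exponent. The constant `5 / 16` leaves room for all `ε ≤ 1`. -/
theorem potential_factor_le {ε : ℝ} (h0 : 0 < ε) (h1 : ε ≤ 1) :
    (1 + ε) / 2 * (1 / (1 + ε ^ 2 / 2)) + (1 - (1 + ε) / 2) * (1 + ε ^ 2 / 2) ≤
      Real.exp (-(5 / 16 * ε ^ 3)) := by
  refine le_trans ?_ (Real.add_one_le_exp _)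
  have hθ : 0 < 1 + ε ^ 2 / 2 := by positivity
  have e1 : (1 + ε) / 2 * (1 / (1 + ε ^ 2 / 2)) + (1 - (1 + ε) / 2) * (1 + ε ^ 2 / 2) =
      ((1 + ε) / 2 + (1 - (1 + ε) / 2) * (1 + ε ^ 2 / 2) ^ 2) / (1 + ε ^ 2 / 2) := by
    field_simp
  rw [e1, div_le_iff₀ hθ]
  have h3 : 0 ≤ ε ^ 3 * (ε - 1 / 2) ^ 2 := by positivity
  have h4 : 0 ≤ ε ^ 3 * (1 - ε) * ε := mul_nonneg (mul_nonneg (by positivity) (by linarith)) h0.le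
  have h5 : 0 ≤ ε ^ 3 * (1 - ε ^ 2) := mul_nonneg (by positivity) (by nlinarith)
  nlinarith [pow_pos h0 3, pow_pos h0 4, pow_pos h0 5]

theorem initial_factor_le {ε : ℝ} (h0 : 0 < ε) (h1 : ε ≤ 1) :
    (1 + ε ^ 2 / 2) * ((1 - (1 - ε) / (1 + ε)) / (1 - (1 + ε ^ 2 / 2) * ((1 - ε) / (1 + ε)))) ≤
      Real.exp ε := by
  have hd : 0 < 1 - (1 - ε) * ε / 4 := by nlinarith
  have e1 : (1 - (1 - ε) / (1 + ε)) / (1 - (1 + ε ^ 2 / 2) * ((1 - ε) / (1 + ε))) =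
      1 / (1 - (1 - ε) * ε / 4) := by
    have h2 : 1 - (1 - ε) / (1 + ε) = 2 * ε / (1 + ε) := by field_simp; ring
    have h3 : 1 - (1 + ε ^ 2 / 2) * ((1 - ε) / (1 + ε)) =
        2 * ε / (1 + ε) * (1 - (1 - ε) * ε / 4) := by field_simp; ring
    rw [h2, h3]
    field_simp
  rw [e1, mul_one_div, div_le_iff₀ hd]
  have h2 := Real.quadratic_le_exp_of_nonneg h0.le
  refine le_trans ?_ (mul_le_mul_of_nonneg_right h2 hd.le)
  nlinarith [pow_pos h0 2, pow_pos h0 3]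

namespace SlotLaw

variable {Ω : Type*} [MeasurableSpace Ω] {P : Measure Ω}
  {o : Ω → ℕ → Option Bool} {f α p : ℝ} {π : ℕ → ℝ}

/-- Summation by parts: `θ ^ d` is `1` plus the sum of `(θ - 1) * θ ^ m` over `m < d`, and the tails
of the drawdown are geometric with ratio `r`. The series converges since `θ * r < 1`. -/
theorem lintegral_pow_drawdown_le [IsProbabilityMeasure P] (h : SlotLaw P o f α p π)
    (hp : 1 / 2 < p) (s : ℕ) {θ : ℝ} (hθ : 1 ≤ θ) (hr : θ * ((1 - p) / p) < 1) :
    ∫⁻ ω, ENNReal.ofReal (θ ^ (drawdown (o ω) s + 1)) ∂P ≤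
      ENNReal.ofReal (θ * ((1 - (1 - p) / p) / (1 - θ * ((1 - p) / p)))) := by
  set r := (1 - p) / p with hrdef
  have hr0 : 0 ≤ r := div_nonneg (by linarith [h.p_le_one]) (by linarith)
  have hθ0 : 0 < θ := by linarith
  have hmeas : ∀ m, MeasurableSet {ω | m ≤ drawdown (o ω) s} := fun m =>
    h.measurableSet (t := s) (𝒜 := {w | m ≤ drawdown w s}) fun w w' hw hA => by
      rw [Set.mem_ofPred_eq, ← drawdown_congr hw]; exact hA
  have hpt : ∀ ω, ENNReal.ofReal (θ ^ drawdown (o ω) s) ≤ 1 + ∑' m : ℕ,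
      ENNReal.ofReal ((θ - 1) * θ ^ m) * {ω | m + 1 ≤ drawdown (o ω) s}.indicator 1 ω := by
    intro ω
    set d := drawdown (o ω) s with hd
    have h1 : θ ^ d = 1 + ∑ m ∈ Finset.range d, (θ - 1) * θ ^ m := by
      rw [← Finset.mul_sum, mul_geom_sum]; ring
    rw [h1, ENNReal.ofReal_add zero_le_one (Finset.sum_nonneg fun m _ =>
      mul_nonneg (by linarith) (pow_nonneg hθ0.le _)), ENNReal.ofReal_one]
    gcongr
    rw [ENNReal.ofReal_sum_of_nonneg fun m _ => mul_nonneg (by linarith) (pow_nonneg hθ0.le _)]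
    refine le_trans (le_of_eq ?_) (ENNReal.sum_le_tsum (Finset.range d))
    refine Finset.sum_congr rfl fun m hm => ?_
    rw [Set.indicator_of_mem (show ω ∈ {ω | m + 1 ≤ drawdown (o ω) s} from Finset.mem_range.1 hm)]
    simp
  have hsum : HasSum (fun m : ℕ => (θ - 1) * θ ^ m * r ^ (m + 1)) ((θ - 1) * r * (1 - θ * r)⁻¹) := by
    have := (hasSum_geometric_of_lt_one (mul_nonneg hθ0.le hr0) hr).mul_left ((θ - 1) * r)
    refine this.congr_fun fun m => ?_
    rw [mul_pow]; ring
  have hnn : ∀ m : ℕ, 0 ≤ (θ - 1) * θ ^ m * r ^ (m + 1) := fun m =>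
    mul_nonneg (mul_nonneg (by linarith) (pow_nonneg hθ0.le _)) (pow_nonneg hr0 _)
  have hE : ∫⁻ ω, ENNReal.ofReal (θ ^ drawdown (o ω) s) ∂P ≤
      ENNReal.ofReal (1 + (θ - 1) * r * (1 - θ * r)⁻¹) := by
    refine (lintegral_mono hpt).trans ?_
    rw [lintegral_add_left measurable_const, lintegral_const, measure_univ, mul_one,
      lintegral_tsum fun m => ((measurable_one.indicator (hmeas _)).const_mul _).aemeasurable,
      ENNReal.ofReal_add zero_le_one (hsum.nonneg hnn), ENNReal.ofReal_one]
    gcongr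
    rw [← hsum.tsum_eq, ENNReal.ofReal_tsum_of_nonneg hnn hsum.summable]
    refine ENNReal.tsum_le_tsum fun m => ?_
    rw [lintegral_const_mul _ (measurable_one.indicator (hmeas _)),
      lintegral_indicator_one (hmeas _), ENNReal.ofReal_mul
      (mul_nonneg (by linarith) (pow_nonneg hθ0.le _)), ← ofReal_measureReal]
    gcongr
    exact h.drawdown_le hp s (m + 1)
  have hmul : ∀ ω, ENNReal.ofReal (θ ^ (drawdown (o ω) s + 1)) =
      ENNReal.ofReal θ * ENNReal.ofReal (θ ^ drawdown (o ω) s) := fun ω => by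
    rw [pow_succ', ENNReal.ofReal_mul hθ0.le]
  simp only [hmul]
  rw [lintegral_const_mul' _ _ ENNReal.ofReal_ne_top, ENNReal.ofReal_mul hθ0.le]
  gcongr
  refine hE.trans (ENNReal.ofReal_le_ofReal (le_of_eq ?_))
  have : 1 - θ * r ≠ 0 := by linarith
  field_simp
  ring

/-- The probability that there is no pivot among the first `⌊x / 2⌋` steps. -/
theorem not_hasPivot_le_exp [IsProbabilityMeasure P] {ε : ℝ} (h : SlotLaw P o f α ((1 + ε) / 2) π)
    (h0 : 0 < ε) (h1 : ε ≤ 1) (s : ℕ) {x : ℝ} (hx : 32 ≤ x * ε ^ 2) :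
    P {ω | ¬ HasPivot (o ω) s ⌊x / 2⌋₊ (drawdown (o ω) s)} ≤
      ENNReal.ofReal (Real.exp (-(x * ε ^ 3 / 12))) := by
  have H := isPotential_of_bias h0 h1
  have hr : (1 - (1 + ε) / 2) / ((1 + ε) / 2) = (1 - ε) / (1 + ε) := by field_simp; ring
  have hθr : (1 + ε ^ 2 / 2) * ((1 - ε) / (1 + ε)) < 1 := by
    rw [mul_div_assoc', div_lt_one (by linarith)]
    nlinarith [pow_pos h0 2, pow_pos h0 3]
  have hint := h.lintegral_pow_drawdown_le (by linarith) s H.one_le (by rw [hr]; exact hθr)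
  rw [hr] at hint
  refine (h.not_hasPivot_le H s _).trans ((mul_le_mul_right hint _).trans ?_)
  rw [← ENNReal.ofReal_mul (pow_nonneg H.l_nonneg _)]
  refine ENNReal.ofReal_le_ofReal ?_
  have hfl : x / 2 - 1 ≤ ⌊x / 2⌋₊ := by linarith [Nat.lt_floor_add_one (x / 2)]
  calc _ ≤ Real.exp (-(5 / 16 * ε ^ 3)) ^ ⌊x / 2⌋₊ * Real.exp ε := by
        refine mul_le_mul (pow_le_pow_left₀ H.l_nonneg (potential_factor_le h0 h1) _)
          (initial_factor_le h0 h1) ?_ (by positivity)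
        refine mul_nonneg (by positivity) (div_nonneg ?_ (by linarith))
        rw [sub_nonneg, div_le_one (by linarith)]
        linarith
    _ = Real.exp (⌊x / 2⌋₊ * -(5 / 16 * ε ^ 3) + ε) := by
        rw [← Real.exp_nat_mul, ← Real.exp_add]
    _ ≤ Real.exp (-(x * ε ^ 3 / 12)) := by
        refine Real.exp_le_exp.2 ?_
        -- The margin `5 / 32 - 1 / 12 = 7 / 96` in the exponent, with `32 ≤ x * ε ^ 2`, exceeds the
        -- step lost by the floor and the initial factor `exp ε`.
        have h3 : 0 < ε ^ 3 := pow_pos h0 3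
        have h4 := mul_le_mul_of_nonneg_right hfl h3.le
        have h5 := mul_le_mul_of_nonneg_right hx h0.le
        have h6 : ε ^ 3 ≤ ε := by nlinarith [pow_le_one₀ h0.le h1 (n := 2)]
        nlinarith

end SlotLaw

/-! ### Probability of unsettled slots and of poor chain quality -/

/-- Passes from steps to slots. A pivot above the level `drawdown w s` beats not only the walk after
`s` but also its whole past, whose maximum is at most `walk w s + drawdown w s`. -/
theorem HasPivot.exists_slot {w : ℕ → Option Bool} {s b n : ℕ} (hp : HasPivot w s n (drawdown w s))
    (hsb : s ≤ b) (hn : n ≤ numNonempty w s b) :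
    ∃ c, s < c ∧ c ≤ b ∧ w c = some true ∧ (∀ a < c, walk w a < walk w c) ∧
      (∀ a, c ≤ a → walk w c ≤ walk w a) ∧ ∀ t, IsNth w s n t → walk w c ≤ walk w t := by
  obtain ⟨c, hc1, hcn, hd, hpast, hfut⟩ := hp
  obtain ⟨t, htb, ht⟩ := exists_isNth w hsb (hcn.trans hn)
  have hst : s < t := by
    rcases ht with h | h
    · omega
    · exact h.1
  have hwt : walk w t = walk w s + stepSum w s c := by
    rw [walk_eq_add_stepSum w ht.le, ht.numNonempty_eq]
  -- A strict record can only be reached by a step up.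
  have hlast : w t = some true := by
    obtain ⟨m, rfl⟩ : ∃ m, c = m + 1 := ⟨c - 1, by omega⟩
    rw [ht.step_eq]
    have h1 := hpast m (by omega)
    rw [stepSum_succ] at h1
    by_cases h2 : step w s m = true
    · rw [h2]
    · rw [if_neg h2] at h1
      omega
  refine ⟨t, hst, htb, hlast, fun a ha => ?_, fun a ha => ?_, fun t' ht' => ?_⟩
  · rcases le_total a s with has | hsa
    · have := walk_le_add_drawdown w has
      omega
    · have h1 := numNonempty_lt w hsa ha (by simp [hlast])
      rw [ht.numNonempty_eq] at h1
      have := hpast _ h1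
      rw [walk_eq_add_stepSum w hsa]
      omega
  · have h1 := numNonempty_mono w hst.le ha
    rw [ht.numNonempty_eq] at h1
    have := hfut _ h1
    rw [walk_eq_add_stepSum w (hst.le.trans ha)]
    omega
  · rw [walk_eq_add_stepSum w ht'.le, ht'.numNonempty_eq]
    have := hfut _ hcn
    omega

/-- With `S` special and `O` other slots, `σ * (S + O) ≤ S - O` means `(1 + σ) * O ≤ (1 - σ) * S`.
The slope per special slot is needed because runs of unheard blocks are counted in special slots. -/
theorem slope_numSpecial (w : ℕ → Option Bool) {t i : ℕ} (hti : t ≤ i) {σ : ℝ} (hσ : 0 < σ)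
    (h : σ * numNonempty w t i ≤ ((walk w i - walk w t : ℤ) : ℝ)) :
    2 * σ / (1 + σ) * numSpecial w t i ≤ ((walk w i - walk w t : ℤ) : ℝ) ∧
      σ * numNonempty w t i ≤ 2 * σ / (1 + σ) * numSpecial w t i := by
  rw [walk_sub w hti] at h ⊢
  rw [numNonempty] at *
  push_cast at *
  have h1 : 0 < 1 + σ := by linarith
  have h2 : 2 * σ / (1 + σ) * (numSpecial w t i : ℝ) = 2 * σ * numSpecial w t i / (1 + σ) := by
    ring
  rw [h2, div_le_iff₀ h1, le_div_iff₀ h1]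
  constructor <;> nlinarith

/-- Uses `1 / 2 < log 2`, and that the prefactor decreases in `κ`. -/
theorem unheard_bound_le {ε κ b c : ℝ} (hε : 0 < ε) (hκ : ε / 2 ≤ κ) (hb : 0 ≤ b)
    (hc : c ≤ b / 2) :
    2 / (1 - (1 / 2 : ℝ) ^ κ) * (1 / 2 : ℝ) ^ b ≤
      2 / (1 - (1 / 2 : ℝ) ^ (ε / 2)) * Real.exp (-c) := by
  have h1 : (1 / 2 : ℝ) ^ (ε / 2) < 1 :=
    Real.rpow_lt_one (by norm_num) (by norm_num) (by linarith)
  have h2 : (1 / 2 : ℝ) ^ κ ≤ (1 / 2 : ℝ) ^ (ε / 2) :=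
    Real.rpow_le_rpow_of_exponent_ge (by norm_num) (by norm_num) hκ
  have h3 : (1 / 2 : ℝ) ^ b ≤ Real.exp (-c) := by
    rw [Real.rpow_def_of_pos (by norm_num), Real.exp_le_exp, one_div, Real.log_inv]
    nlinarith [Real.log_two_gt_d9]
  refine mul_le_mul ?_ h3 (by positivity) (div_nonneg (by norm_num) (by linarith))
  exact div_le_div_of_nonneg_left (by norm_num) (by linarith) (by linarith)

theorem half_le_slope {ε σ : ℝ} (hσ : ε / 2 ≤ σ) (h0 : 0 ≤ σ) (h1 : σ ≤ 1) :
    ε / 2 ≤ 2 * σ / (1 + σ) := by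
  refine hσ.trans ?_
  rw [le_div_iff₀ (by linarith)]
  nlinarith

theorem slope_le_one {σ : ℝ} (h0 : 0 ≤ σ) (h1 : σ ≤ 1) : 2 * σ / (1 + σ) ≤ 1 := by
  rw [div_le_one (by linarith)]
  linarith

/-- The slot `s` is settled after `k` slots for the parties in `I`: there is a slot in `(s, s + k]`
after which the walk never returns below its record, and each party has always heard of a recent
special block. -/
def Settled {H : Type*} (w : ℕ → Option Bool) (heard : H → ℕ → ℕ → Prop) (I : Set H)
    (s k : ℕ) : Prop :=
  ∃ c, s < c ∧ c ≤ s + k ∧ w c = some true ∧ (∀ a < c, walk w a < walk w c) ∧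
    (∀ b, c ≤ b → walk w c ≤ walk w b) ∧ ∀ h ∈ I, ∀ i, s + k ≤ i →
      ∃ j ≤ i, (j = 0 ∨ w j = some true) ∧ heard h j i ∧
        (numSpecial w j i : ℤ) ≤ walk w i - walk w c

/-- The walk gains more than `y` over every interval around `(s, s + k]`, and each party in `I` has
always heard of a recent special block. -/
def HasQuality {H : Type*} (w : ℕ → Option Bool) (heard : H → ℕ → ℕ → Prop) (I : Set H)
    (s k : ℕ) (y : ℝ) : Prop :=
  (∀ a ≤ s, ∀ b, s + k ≤ b → y < ((walk w b - walk w a : ℤ) : ℝ)) ∧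
    ∀ h ∈ I, ∀ i, s + k ≤ i → ∃ j ≤ i, (j = 0 ∨ w j = some true) ∧ heard h j i ∧
      ∀ a ≤ s, y + numSpecial w j i < ((walk w i - walk w a : ℤ) : ℝ)

/-- A special block that `h` has not heard of in spite of a later special slot is counted as
unheard. -/
def UnheardCovers {H : Type*} (w : ℕ → Option Bool) (heard : H → ℕ → ℕ → Prop)
    (e : H → ℕ → Prop) : Prop :=
  ∀ h j i' i, w j = some true → j < i' → i' ≤ i → w i' = some true → ¬ heard h j i → e h j

/-- The pivot lies among the first `n` steps, and at least `x` further non-empty slots precede `s +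
k`. The line then lifts the walk above the pivot in proportion to the special slots seen since step
`n`, so a party without a sufficiently recent heard block would have missed a run of that
proportion. -/
theorem settled_of {H : Type*} {w : ℕ → Option Bool} {heard : H → ℕ → ℕ → Prop}
    {e : H → ℕ → Prop} (hcov : UnheardCovers w heard e) {I : Set H} {s k n : ℕ} {σ x : ℝ}
    (hσ : 0 < σ) (hσ1 : σ ≤ 1) (hx : 0 ≤ x)
    (hcount : n + x ≤ numNonempty w s (s + k))
    (hpiv : HasPivot w s n (drawdown w s))
    (hline : ∀ m, ⌈x⌉₊ ≤ m → σ * m ≤ ((stepSum w s (n + m) - stepSum w s n : ℤ) : ℝ))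
    (hrun : ∀ h ∈ I, ∀ R : ℕ, σ * x ≤ 2 * σ / (1 + σ) * R →
      ¬ UnheardRun w (e h) s n (R - 1) (⌈2 * σ / (1 + σ) * R⌉₊ - 1)) :
    Settled w heard I s k := by
  have hn : n ≤ numNonempty w s (s + k) := by
    exact_mod_cast (by linarith : (n : ℝ) ≤ numNonempty w s (s + k))
  obtain ⟨c, h1, h2, h3, h4, h5, h6⟩ := hpiv.exists_slot (by omega) hn
  refine ⟨c, h1, h2, h3, h4, h5, fun h hh i hi => ?_⟩
  obtain ⟨t, htb, ht⟩ := exists_isNth w (Nat.le_add_right s k) hn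
  have hti : t ≤ i := htb.trans hi
  have hadd := numNonempty_add w ht.le hti
  rw [ht.numNonempty_eq] at hadd
  have hmono := numNonempty_mono w (Nat.le_add_right s k) hi
  have hm : x ≤ numNonempty w t i := by
    have : (n : ℝ) + numNonempty w t i = numNonempty w s i := by exact_mod_cast hadd
    have : (numNonempty w s (s + k) : ℝ) ≤ numNonempty w s i := by exact_mod_cast hmono
    linarith
  have hl := hline _ (Nat.ceil_le.2 hm)
  have hwalk : walk w i - walk w t = stepSum w s (n + numNonempty w t i) - stepSum w s n := by
    rw [walk_eq_add_stepSum w (ht.le.trans hti), walk_eq_add_stepSum w ht.le, ht.numNonempty_eq, hadd]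
    ring
  rw [← hwalk] at hl
  obtain ⟨hκ1, hκ2⟩ := slope_numSpecial w hti hσ hl
  -- Otherwise every heard special block `j` has more special slots after it than the walk has
  -- gained since `c`, hence since `t`, as `walk w c ≤ walk w t`. So all special blocks after `t`
  -- that are closer to `i` than `2 * σ / (1 + σ)` times the special slots in `(t, i]`, except
  -- possibly the last one, are counted as unheard.
  by_contra hcon
  push Not at hcon
  refine hrun h hh (numSpecial w t i) ((mul_le_mul_of_nonneg_left hm hσ.le).trans hκ2) ?_
  refine unheardRun_of ht hti ?_ fun j i' htj hj hlt hji' hi'i hi' => ?_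
  · exact mul_le_of_le_one_left (by positivity) (slope_le_one hσ.le hσ1)
  · refine hcov h j i' i hj hji' hi'i hi' fun hheard => ?_
    have := hcon j (hji'.le.trans hi'i) (Or.inr hj) hheard
    have hc : (walk w i - walk w c : ℤ) < (numSpecial w j i : ℤ) := this
    have hct := h6 t ht
    have h7 : (walk w i - walk w t : ℤ) ≤ (numSpecial w j i : ℤ) := by omega
    have h8 : ((walk w i - walk w t : ℤ) : ℝ) ≤ (numSpecial w j i : ℝ) := by exact_mod_cast h7
    linarith

/-- The gain `σ * x` of the walk after `s` is divided into the target `y`, the allowance `z` for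
starting points before `s`, and the reserve `b` for blocks not yet heard. -/
theorem hasQuality_of {H : Type*} {w : ℕ → Option Bool} {heard : H → ℕ → ℕ → Prop}
    {e : H → ℕ → Prop} (hcov : UnheardCovers w heard e) {I : Set H} {s k : ℕ} {σ x y z b : ℝ}
    (hσ : 0 < σ) (hσ1 : σ ≤ 1) (hb : 0 < b) (hz : 0 ≤ z) (hy : 0 ≤ y) (hxy : y + z + b ≤ σ * x)
    (hcount : x ≤ numNonempty w s (s + k))
    (hdraw : (drawdown w s : ℝ) ≤ z)
    (hline : ∀ m, ⌈x⌉₊ ≤ m → σ * m ≤ ((stepSum w s (0 + m) - stepSum w s 0 : ℤ) : ℝ))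
    (hrun : ∀ h ∈ I, ∀ R : ℕ, b ≤ 2 * σ / (1 + σ) * R - (y + z) →
      ¬ UnheardRun w (e h) s 0 (R - 1) (⌈2 * σ / (1 + σ) * R - (y + z)⌉₊ - 1)) :
    HasQuality w heard I s k y := by
  have key : ∀ i, s + k ≤ i → σ * x ≤ σ * numNonempty w s i ∧
      σ * numNonempty w s i ≤ ((walk w i - walk w s : ℤ) : ℝ) := fun i hi => by
    have hmono := numNonempty_mono w (Nat.le_add_right s k) hi
    have hm : x ≤ numNonempty w s i := hcount.trans (by exact_mod_cast hmono)
    have hl := hline _ (Nat.ceil_le.2 hm)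
    have hwalk : walk w i - walk w s = stepSum w s (0 + numNonempty w s i) - stepSum w s 0 := by
      rw [walk_eq_add_stepSum w (show s ≤ i by omega)]
      simp [stepSum]
    rw [hwalk]
    exact ⟨mul_le_mul_of_nonneg_left hm hσ.le, hl⟩
  have hpast : ∀ a ≤ s, ∀ i, ((walk w i - walk w s : ℤ) : ℝ) - z ≤
      ((walk w i - walk w a : ℤ) : ℝ) := fun a ha i => by
    have h1 := walk_le_add_drawdown w ha
    have h2 : (walk w a : ℝ) ≤ walk w s + drawdown w s := by exact_mod_cast h1
    push_cast
    linarith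
  refine ⟨fun a ha i hi => ?_, fun h hh i hi => ?_⟩
  · have := key i hi
    have := hpast a ha i
    linarith
  · obtain ⟨hk1, hk2⟩ := key i hi
    have hsi : s ≤ i := by omega
    obtain ⟨hκ1, hκ2⟩ := slope_numSpecial w hsi hσ hk2
    have ht : IsNth w s 0 s := Or.inl ⟨rfl, rfl⟩
    by_contra hcon
    push Not at hcon
    refine hrun h hh (numSpecial w s i) (by linarith) ?_
    refine unheardRun_of ht hsi ?_ fun j i' htj hj hlt hji' hi'i hi' => ?_
    · have : 2 * σ / (1 + σ) * (numSpecial w s i : ℝ) ≤ numSpecial w s i :=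
        mul_le_of_le_one_left (by positivity) (slope_le_one hσ.le hσ1)
      linarith
    · refine hcov h j i' i hj hji' hi'i hi' fun hheard => ?_
      obtain ⟨a, ha, hle⟩ := hcon j (hji'.le.trans hi'i) (Or.inr hj) hheard
      have := hpast a ha i
      linarith

/-! ### Union bounds for settlement and chain quality -/

namespace SlotLaw

variable {Ω H : Type*} [MeasurableSpace Ω] {P : Measure Ω} [IsProbabilityMeasure P]
  {o : Ω → ℕ → Option Bool} {f α ε : ℝ} {π : ℕ → ℝ} {heard : Ω → H → ℕ → ℕ → Prop}
  {e : H → Ω → ℕ → Prop}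

/-- The pivot is sought among the first `⌊k * f / 2⌋` steps. Outside a Chernoff event there are at
least `3 / 4 * (k * f)` non-empty slots, which leaves `k * f / 4` for the line of slope `ε / 2`. The
Chernoff and line exponents are both `k * f * ε ^ 2 / 32`, and the reserve `k * f * ε / 8` yields
the unheard term. -/
theorem not_settled_le (h : SlotLaw P o f α ((1 + ε) / 2) π) (h0 : 0 < ε) (h1 : ε ≤ 1)
    (hu : ∀ h, UnheardLaw P o (e h))
    (hcov : ∀ ω, UnheardCovers (o ω) (heard ω) fun h => e h ω) (I : Finset H) (s k : ℕ) :
    P {ω | ¬ Settled (o ω) (heard ω) I s k} ≤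
      ENNReal.ofReal (pSettlement f ε k) + I.card * ENNReal.ofReal (pUnheard f ε k) := by
  have hkf : 0 ≤ k * f := mul_nonneg (Nat.cast_nonneg k) h.f_pos.le
  -- For small `k` the bound is void since `3 * exp (-1)` exceeds `1`; this is the purpose of the
  -- factor `3`, as only two such terms arise otherwise.
  rcases lt_or_ge (k * f * ε ^ 2) 32 with hsmall | hbig
  · refine prob_le_one.trans (le_add_right ?_)
    rw [ENNReal.one_le_ofReal, pSettlement]
    have h2 : Real.exp (-1) ≤ Real.exp (-(k * f * ε ^ 2 / 32)) :=
      Real.exp_le_exp.2 (by linarith)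
    have h3 : 1 / 3 ≤ Real.exp (-1) := by
      rw [Real.exp_neg, ← one_div]
      exact one_div_le_one_div_of_le (Real.exp_pos _) (by linarith [Real.exp_one_lt_d9])
    have := Real.exp_pos (-(k * f * ε ^ 3 / 12))
    linarith
  set n := ⌊k * f / 2⌋₊ with hn
  set σ := ε / 2 with hσ
  set κ := 2 * σ / (1 + σ) with hκ
  have hn2 : (n : ℝ) ≤ k * f / 2 := Nat.floor_le (by positivity)
  have hσ0 : 0 < σ := by positivity
  have hσ1 : σ ≤ 1 := by linarith
  have hsub : {ω | ¬ Settled (o ω) (heard ω) I s k} ⊆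
      (({ω | ¬ HasPivot (o ω) s n (drawdown (o ω) s)} ∪
        {ω | (numNonempty (o ω) s (s + k) : ℝ) ≤ (1 - ε / 4) * (k * f)}) ∪
        {ω | ∃ m, ⌈k * f / 4⌉₊ ≤ m ∧ ((stepSum (o ω) s (n + m) - stepSum (o ω) s n : ℤ) : ℝ) <
          (2 * ((1 + ε) / 2) - 1 - ε / 2) * m}) ∪
        ⋃ h ∈ I, {ω | ∃ R : ℕ, σ * (k * f / 4) ≤ κ * R - 0 ∧
          UnheardRun (o ω) (e h ω) s n (R - 1) (⌈κ * R - 0⌉₊ - 1)} := by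
    intro ω hω
    by_contra hnot
    simp only [Set.mem_union, Set.mem_iUnion, Set.mem_ofPred_eq, not_or, not_exists, not_not,
      not_and, not_le, not_lt, exists_prop, sub_zero] at hnot
    obtain ⟨⟨⟨hpiv, hcount⟩, hline⟩, hrun⟩ := hnot
    refine hω (settled_of (hcov ω) hσ0 hσ1 (by positivity : 0 ≤ k * f / 4) ?_ hpiv
      (fun m hm => ?_) fun h hh R hR => hrun h hh R hR)
    · nlinarith
    · refine le_trans (le_of_eq ?_) (hline m hm)
      rw [hσ]
      ring
  refine (measure_mono hsub).trans ((measure_union_le _ _).trans (add_le_add ?_ ?_))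
  · refine (measure_union_le _ _).trans ((add_le_add ((measure_union_le _ _).trans (add_le_add
      (h.not_hasPivot_le_exp h0 h1 s hbig) (h.numNonempty_le s k (by positivity : 0 ≤ ε / 4))))
      (h.exists_stepSum_lt_le (by linarith) s n ⌈k * f / 4⌉₊ hσ0.le)).trans ?_)
    rw [← ENNReal.ofReal_add (Real.exp_pos _).le (Real.exp_pos _).le,
      ← ENNReal.ofReal_add (by positivity) (Real.exp_pos _).le]
    refine ENNReal.ofReal_le_ofReal ?_
    rw [pSettlement]
    have h2 : Real.exp (-(k * f * (ε / 4) ^ 2 / 2)) = Real.exp (-(k * f * ε ^ 2 / 32)) := by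
      congr 1
      ring
    have h3 : Real.exp (-(⌈k * f / 4⌉₊ * σ ^ 2 / 2)) ≤ Real.exp (-(k * f * ε ^ 2 / 32)) := by
      refine Real.exp_le_exp.2 ?_
      have := mul_le_mul_of_nonneg_right (Nat.le_ceil (k * f / 4)) (sq_nonneg σ)
      rw [hσ] at this ⊢
      linarith
    have := Real.exp_pos (-(k * f * ε ^ 2 / 32))
    linarith
  · refine (measure_biUnion_finset_le _ _).trans ((Finset.sum_le_card_nsmul _ _
      (ENNReal.ofReal (pUnheard f ε k)) fun h' _ => ?_).trans_eq (nsmul_eq_mul _ _))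
    refine ((hu h').exists_unheardRun_le h s n (by positivity) (slope_le_one hσ0.le hσ1)
      le_rfl).trans (ENNReal.ofReal_le_ofReal ?_)
    refine unheard_bound_le h0 (half_le_slope le_rfl hσ0.le hσ1) (by positivity) (le_of_eq ?_)
    rw [hσ]
    ring

theorem not_hasQuality_le (h : SlotLaw P o f α ((1 + ε) / 2) π) (h1 : ε ≤ 1)
    (hu : ∀ h, UnheardLaw P o (e h))
    (hcov : ∀ ω, UnheardCovers (o ω) (heard ω) fun h => e h ω) {μ : ℝ} (hμ : 0 < μ) (hμε : μ < ε)
    (I : Finset H) (s k : ℕ) :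
    P {ω | ¬ HasQuality (o ω) (heard ω) I s k (k * f * μ)} ≤
      ENNReal.ofReal (pCQ f ε μ k) + I.card * ENNReal.ofReal (pUnheardCQ f ε μ k) := by
  rcases Nat.eq_zero_or_pos k with rfl | hk
  · refine prob_le_one.trans (le_add_right ?_)
    rw [ENNReal.one_le_ofReal, pCQ]
    simp
  have hkf : 0 < k * f := mul_pos (Nat.cast_pos.2 hk) h.f_pos
  have h0 : 0 < ε := hμ.trans hμε
  set δ := ε - μ with hδ
  have hδ0 : 0 < δ := by linarith
  have hδε : δ < ε := by linarith
  set σ := ε - δ / 4 with hσ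
  set κ := 2 * σ / (1 + σ) with hκ
  have hσ0 : 0 < σ := by linarith
  have hσ1 : σ ≤ 1 := by linarith
  set x := (1 - δ / 4) * (k * f) with hx
  set z := δ * (k * f) / 8 with hz
  have hx0 : 0 < x := mul_pos (by linarith) hkf
  have hz0 : 0 < z := by positivity
  have hy0 : 0 < k * f * μ := mul_pos hkf hμ
  have hsub : {ω | ¬ HasQuality (o ω) (heard ω) I s k (k * f * μ)} ⊆
      (({ω | ⌊z⌋₊ + 1 ≤ drawdown (o ω) s} ∪
        {ω | (numNonempty (o ω) s (s + k) : ℝ) ≤ (1 - δ / 4) * (k * f)}) ∪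
        {ω | ∃ m, ⌈x⌉₊ ≤ m ∧ ((stepSum (o ω) s (0 + m) - stepSum (o ω) s 0 : ℤ) : ℝ) <
          (2 * ((1 + ε) / 2) - 1 - δ / 4) * m}) ∪
        ⋃ h ∈ I, {ω | ∃ R : ℕ, 3 * z ≤ κ * R - (k * f * μ + z) ∧
          UnheardRun (o ω) (e h ω) s 0 (R - 1) (⌈κ * R - (k * f * μ + z)⌉₊ - 1)} := by
    intro ω hω
    by_contra hnot
    simp only [Set.mem_union, Set.mem_iUnion, Set.mem_ofPred_eq, not_or, not_exists,
      not_and, not_le, not_lt, exists_prop] at hnot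
    obtain ⟨⟨⟨hdraw, hcount⟩, hline⟩, hrun⟩ := hnot
    refine hω (hasQuality_of (hcov ω) hσ0 hσ1 (by positivity : 0 < 3 * z) hz0.le hy0.le ?_
      hcount.le ((Nat.le_floor_iff hz0.le).1 (by omega)) (fun m hm => ?_)
      fun h hh R hR => hrun h hh R hR)
    -- Of the slack `δ`, one quarter goes to the count of non-empty slots and one to the slope. The
    -- remaining half is `4 * z`: one `z` for the drawdown at `s` and `3 * z` for unheard blocks.
    · have h2 : μ + δ / 2 ≤ σ * (1 - δ / 4) := by
        rw [hσ, hδ] at *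
        nlinarith
      have := mul_le_mul_of_nonneg_right h2 hkf.le
      rw [hz]
      linarith
    · refine le_trans (le_of_eq ?_) (hline m hm)
      rw [hσ]
      ring
  have hdd : P {ω | ⌊z⌋₊ + 1 ≤ drawdown (o ω) s} ≤
      ENNReal.ofReal (Real.exp (-(k * f * δ ^ 2 / 48))) := by
    rw [← ofReal_measureReal (measure_ne_top _ _)]
    refine ENNReal.ofReal_le_ofReal ((h.drawdown_le (by linarith) s _).trans ?_)
    have hr : (1 - (1 + ε) / 2) / ((1 + ε) / 2) ≤ Real.exp (-ε) := by
      rw [div_le_iff₀ (by linarith)]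
      nlinarith [Real.add_one_le_exp (-ε)]
    refine (pow_le_pow_left₀ (div_nonneg (by linarith) (by linarith)) hr _).trans ?_
    rw [← Real.exp_nat_mul, Real.exp_le_exp]
    push_cast
    have h2 := mul_le_mul_of_nonneg_right (Nat.lt_floor_add_one z).le h0.le
    have h3 : δ ^ 2 * (k * f) ≤ δ * ε * (k * f) :=
      mul_le_mul_of_nonneg_right (by nlinarith) hkf.le
    have h4 : 0 < δ ^ 2 * (k * f) := by positivity
    have h5 : z * ε = δ * ε * (k * f) / 8 := by rw [hz]; ring
    linarith
  refine (measure_mono hsub).trans ((measure_union_le _ _).trans (add_le_add ?_ ?_))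
  · refine (measure_union_le _ _).trans ((add_le_add ((measure_union_le _ _).trans (add_le_add
      hdd (h.numNonempty_le s k (by positivity : 0 ≤ δ / 4))))
      (h.exists_stepSum_lt_le (by linarith) s 0 ⌈x⌉₊ (by positivity : 0 ≤ δ / 4))).trans ?_)
    rw [← ENNReal.ofReal_add (Real.exp_pos _).le (Real.exp_pos _).le,
      ← ENNReal.ofReal_add (by positivity) (Real.exp_pos _).le]
    refine ENNReal.ofReal_le_ofReal ?_
    rw [pCQ]
    have h4 : 0 < k * f * δ ^ 2 := by positivity
    have h2 : Real.exp (-(k * f * (δ / 4) ^ 2 / 2)) ≤ Real.exp (-(k * f * δ ^ 2 / 48)) :=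
      Real.exp_le_exp.2 (by linarith)
    have h3 : Real.exp (-(⌈x⌉₊ * (δ / 4) ^ 2 / 2)) ≤ Real.exp (-(k * f * δ ^ 2 / 48)) := by
      refine Real.exp_le_exp.2 ?_
      have h5 : 3 / 4 * (k * f) ≤ ⌈x⌉₊ := by
        refine le_trans ?_ (Nat.le_ceil x)
        exact mul_le_mul_of_nonneg_right (by linarith) hkf.le
      have := mul_le_mul_of_nonneg_right h5 (sq_nonneg δ)
      linarith
    have := Real.exp_pos (-(k * f * δ ^ 2 / 48))
    linarith
  · refine (measure_biUnion_finset_le _ _).trans ((Finset.sum_le_card_nsmul _ _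
      (ENNReal.ofReal (pUnheardCQ f ε μ k)) fun h' _ => ?_).trans_eq (nsmul_eq_mul _ _))
    refine ((hu h').exists_unheardRun_le h s 0 (by positivity) (slope_le_one hσ0.le hσ1)
      (by positivity)).trans (ENNReal.ofReal_le_ofReal ?_)
    refine unheard_bound_le h0 (half_le_slope (by linarith) hσ0.le hσ1) (by positivity) ?_
    have : 0 < δ * (k * f) := by positivity
    rw [hz]
    linarith

end SlotLaw

/-! ### Marking the slots

The slot `i + 1` has the symbol `x i`; `cls` tells whether a symbol stands for an empty slot
(`none`), a uniquely honest slot (`some true`) or any other slot (`some false`). The leader of a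
uniquely honest slot `i + 1` is `lead x i`, and `d (i, h, h')` is the delay of the message sent in
this slot by `h` to `h'`. -/

section Marks

variable {𝒴 H : Type*} (cls : 𝒴 → Option Bool) (lead : (ℕ → 𝒴) → ℕ → H) (x : ℕ → 𝒴)
  (d : ℕ × H × H → ℕ∞)

/-- The slot `i + 1` is uniquely honest and its leader has heard of the block of slot `l + 1`
before. -/
def Hit (i : ℕ) (l : Option ℕ) : Prop :=
  cls (x i) = some true ∧
    ∀ j ∈ l, lead x j = lead x i ∨ d (j, lead x j, lead x i) < ((i - j : ℕ) : ℕ∞)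

open Classical in
/-- The last special slot up to slot `i`, less one. -/
def lastHit : ℕ → Option ℕ
  | 0 => none
  | i + 1 => if Hit cls lead x d i (lastHit i) then some i else lastHit i

open Classical in
/-- The mark of a slot: `none` if it is empty, and otherwise whether it is special. -/
def mark : ℕ → Option Bool
  | 0 => none
  | i + 1 => if cls (x i) = none then none else some (decide (Hit cls lead x d i (lastHit cls lead x d i)))

/-- The block of a slot is late for `h`: it arrives after the next non-empty slot has begun. -/
def Late (h : H) : ℕ → Prop
  | 0 => False
  | m + 1 => ∃ g, (∀ i, m < i → i ≤ m + g → cls (x i) = none) ∧ cls (x (m + g + 1)) ≠ none ∧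
      lead x m ≠ h ∧ ((g + 1 : ℕ) : ℕ∞) ≤ d (m, lead x m, h)

variable {cls lead x d}

theorem mark_succ_eq_none {i : ℕ} : mark cls lead x d (i + 1) = none ↔ cls (x i) = none := by
  simp [mark]

theorem mark_succ_eq_true {i : ℕ} :
    mark cls lead x d (i + 1) = some true ↔ Hit cls lead x d i (lastHit cls lead x d i) := by
  rw [mark]
  split_ifs with h
  · simp [Hit, h]
  · simp

theorem lt_of_lastHit_eq_some {i j : ℕ} (h : lastHit cls lead x d i = some j) : j < i := by
  induction i with
  | zero => simp [lastHit] at h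
  | succ i ih =>
    rw [lastHit] at h
    split_ifs at h with h1
    · simp at h
      omega
    · have := ih h
      omega

theorem lastHit_eq_of_le {i j n : ℕ} (h : lastHit cls lead x d n = some j) (hji : j < i)
    (hin : i ≤ n) : lastHit cls lead x d i = some j := by
  induction n with
  | zero => simp [lastHit] at h
  | succ n ih =>
    rcases Nat.lt_or_ge n i with h1 | h1
    · obtain rfl : i = n + 1 := by omega
      exact h
    · rw [lastHit] at h
      split_ifs at h with h2
      · simp at h
        omega
      · exact ih h h1

theorem hit_lastHit_of_eq {j n : ℕ} (h : lastHit cls lead x d n = some j) :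
    Hit cls lead x d j (lastHit cls lead x d j) := by
  have h1 := lastHit_eq_of_le h (Nat.lt_succ_self j) (lt_of_lastHit_eq_some h)
  by_contra h2
  rw [lastHit, if_neg h2] at h1
  exact absurd (lt_of_lastHit_eq_some h1) (lt_irrefl _)

theorem not_hit_of_lastHit_eq {i j n : ℕ} (h : lastHit cls lead x d n = some j) (hji : j < i)
    (hin : i < n) : ¬ Hit cls lead x d i (some j) := by
  intro h2
  have h1 := lastHit_eq_of_le h (hji.trans (Nat.lt_succ_self i)) hin
  rw [lastHit, lastHit_eq_of_le h hji hin.le, if_pos h2] at h1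
  simp at h1
  omega

theorem lastHit_eq_of_forall_not {j n : ℕ} (hjn : j < n)
    (hj : Hit cls lead x d j (lastHit cls lead x d j))
    (hno : ∀ i, j < i → i < n → ¬ Hit cls lead x d i (lastHit cls lead x d i)) :
    lastHit cls lead x d n = some j := by
  induction n with
  | zero => omega
  | succ n ih =>
    rw [lastHit]
    rcases Nat.lt_or_ge j n with h | h
    · rw [if_neg (hno n h (by omega))]
      exact ih h fun i h1 h2 => hno i h1 (by omega)
    · obtain rfl : j = n := by omega
      rw [if_pos hj]

theorem lastHit_eq_none {n : ℕ} (h : ∀ i < n, cls (x i) = none) :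
    lastHit cls lead x d n = none := by
  induction n with
  | zero => rfl
  | succ n ih =>
    rw [lastHit, if_neg, ih fun i hi => h i (by omega)]
    simp [Hit, h n (Nat.lt_succ_self n)]

theorem lastHit_congr {x' : ℕ → 𝒴} {d' : ℕ × H × H → ℕ∞} {n : ℕ}
    (h : ∀ i < n, ∀ l : Option ℕ, (∀ j ∈ l, j < i) →
      (Hit cls lead x d i l ↔ Hit cls lead x' d' i l)) {i : ℕ} (hi : i ≤ n) :
    lastHit cls lead x d i = lastHit cls lead x' d' i := by
  induction i with
  | zero => rfl
  | succ i ih =>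
    have h1 := ih (by omega)
    have h2 := h i hi (lastHit cls lead x d i) fun j hj => lt_of_lastHit_eq_some hj
    rw [lastHit, lastHit, ← h1]
    by_cases h3 : Hit cls lead x d i (lastHit cls lead x d i)
    · rw [if_pos h3, if_pos (h2.1 h3)]
    · rw [if_neg h3, if_neg fun h4 => h3 (h2.2 h4)]

theorem mark_congr {x' : ℕ → 𝒴} {d' : ℕ × H × H → ℕ∞} {n : ℕ}
    (hx : ∀ i < n, cls (x i) = cls (x' i))
    (h : ∀ i < n, ∀ l : Option ℕ, (∀ j ∈ l, j < i) →
      (Hit cls lead x d i l ↔ Hit cls lead x' d' i l)) {i : ℕ} (hi : i ≤ n) :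
    mark cls lead x d i = mark cls lead x' d' i := by
  cases i with
  | zero => rfl
  | succ i =>
    have h1 := lastHit_congr h (show i ≤ n by omega)
    have h2 := h i hi (lastHit cls lead x d i) fun j hj => lt_of_lastHit_eq_some hj
    rw [mark, mark, hx i hi, ← h1, decide_eq_decide.2 h2]

theorem hit_congr_of_eqOn {x' : ℕ → 𝒴}
    (hlead : ∀ (x x' : ℕ → 𝒴) i, (∀ j ≤ i, x j = x' j) → lead x i = lead x' i) {n : ℕ}
    (h : ∀ i < n, x i = x' i) :
    ∀ i < n, ∀ l : Option ℕ, (∀ j ∈ l, j < i) →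
      (Hit cls lead x d i l ↔ Hit cls lead x' d i l) := by
  intro i hi l hl
  rw [Hit, Hit, h i hi, hlead x x' i fun j hj => h j (by omega)]
  refine and_congr_right fun _ => forall_congr' fun j => imp_congr_right fun hj => ?_
  rw [hlead x x' j fun j' hj' => h j' (by have := hl j hj; omega)]

theorem mark_congr_of_eqOn {x' : ℕ → 𝒴}
    (hlead : ∀ (x x' : ℕ → 𝒴) i, (∀ j ≤ i, x j = x' j) → lead x i = lead x' i) {n : ℕ}
    (h : ∀ i < n, x i = x' i) {i : ℕ} (hi : i ≤ n) :
    mark cls lead x d i = mark cls lead x' d i :=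
  mark_congr (fun i hi => by rw [h i hi]) (hit_congr_of_eqOn hlead h) hi

/-- Lateness looks ahead to the next non-empty slot. Since slot `n + 1` is non-empty, this wait has
ended by then for every earlier block. -/
theorem late_congr_of_eqOn {x' : ℕ → 𝒴}
    (hlead : ∀ (x x' : ℕ → 𝒴) i, (∀ j ≤ i, x j = x' j) → lead x i = lead x' i) {n : ℕ}
    (h : ∀ i ≤ n, x i = x' i) (hn : cls (x n) ≠ none) (h' : H) {i : ℕ} (hi : i < n + 1) :
    Late cls lead x d h' i ↔ Late cls lead x' d h' i := by
  cases i with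
  | zero => rfl
  | succ m =>
    have key : ∀ y y' : ℕ → 𝒴, (∀ i ≤ n, y i = y' i) → cls (y n) ≠ none →
        Late cls lead y d h' (m + 1) → Late cls lead y' d h' (m + 1) := by
      rintro y y' hy hyn ⟨g, h1, h2, h3, h4⟩
      have hg : m + g + 1 ≤ n := by
        by_contra hlt
        exact hyn (h1 n (by omega) (by omega))
      rw [hlead y y' m fun j hj => hy j (by omega)] at h3 h4
      exact ⟨g, fun i hi1 hi2 => by rw [← hy i (by omega)]; exact h1 i hi1 hi2,
        by rw [← hy _ hg]; exact h2, h3, h4⟩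
    exact ⟨key x x' h hn, key x' x (fun i hi => (h i hi).symm) (by rwa [← h n le_rfl])⟩

/-- Messages sent after slot `n` do not matter for the marks up to slot `n + 1`. -/
theorem hit_update {n : ℕ} {k : ℕ × H × H} (hk : n ≤ k.1) {i : ℕ} (hi : i ≤ n)
    {l : Option ℕ} (hl : ∀ j ∈ l, j < i) [DecidableEq (ℕ × H × H)] (v : ℕ∞) :
    Hit cls lead x (Function.update d k v) i l ↔ Hit cls lead x d i l := by
  refine and_congr_right fun _ => forall_congr' fun j => imp_congr_right fun hj => ?_
  rw [Function.update_of_ne]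
  rintro rfl
  have := hl j hj
  simp at hk
  omega

theorem late_update {n : ℕ} {k : ℕ × H × H} (hk : n ≤ k.1) {i : ℕ} (hi : i < n + 1)
    [DecidableEq (ℕ × H × H)] (v : ℕ∞) (h : H) :
    Late cls lead x (Function.update d k v) h i ↔ Late cls lead x d h i := by
  cases i with
  | zero => rfl
  | succ m =>
    have : (m, lead x m, h) ≠ k := by
      rintro rfl
      simp at hk
      omega
    simp only [Late, Function.update_of_ne this]

/-- While the block of slot `j + 1` is the last special one, all that is known about the delay of
its message to the leader of slot `n + 1` is a lower bound. -/
theorem exists_threshold {j n t : ℕ}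
    (hgap : ∀ i, t ≤ i → i < n → cls (x i) = none) :
    ∃ c : ℕ, (c = 0 ∨ ∃ i, j < i ∧ i < t ∧ c = i - j ∧ cls (x i) = some true ∧
        lead x i = lead x n) ∧
      (∀ d : ℕ × H × H → ℕ∞, lastHit cls lead x d n = some j →
        (c : ℕ∞) ≤ d (j, lead x j, lead x n)) ∧
      ∀ d : ℕ × H × H → ℕ∞, (c : ℕ∞) ≤ d (j, lead x j, lead x n) →
        ∀ [DecidableEq (ℕ × H × H)], ∀ i < n, ∀ l : Option ℕ, (∀ j ∈ l, j < i) →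
        (Hit cls lead x d i l ↔
          Hit cls lead x (Function.update d (j, lead x j, lead x n) ⊤) i l) := by
  classical
  -- The earlier attempts of the leader of slot `n + 1` to build on the block of slot `j + 1`. All
  -- of them failed if that block is still the last special one, so the delay is at least `i - j`
  -- for each; `c` is the largest of these bounds.
  set F := (Finset.range n).filter fun i => j < i ∧ cls (x i) = some true ∧ lead x i = lead x n
    with hF
  obtain ⟨c, hc1, hc2⟩ : ∃ c : ℕ, (c = 0 ∨ ∃ i ∈ F, c = i - j) ∧ ∀ i ∈ F, i - j ≤ c := by
    rcases F.eq_empty_or_nonempty with h | h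
    · exact ⟨0, Or.inl rfl, by simp [h]⟩
    · obtain ⟨i, hi, hmax⟩ := F.exists_max_image (fun i => i - j) h
      exact ⟨i - j, Or.inr ⟨i, hi, rfl⟩, hmax⟩
  refine ⟨c, ?_, fun d hd => ?_, fun d hd _ i hi l hl => ?_⟩
  · rcases hc1 with h | ⟨i, hi, h⟩
    · exact Or.inl h
    · simp only [hF, Finset.mem_filter, Finset.mem_range] at hi
      refine Or.inr ⟨i, hi.2.1, ?_, h, hi.2.2⟩
      by_contra hlt
      have := hgap i (by omega) hi.1
      simp [this] at hi
  · rcases hc1 with h | ⟨i, hi, h⟩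
    · simp [h]
    · simp only [hF, Finset.mem_filter, Finset.mem_range] at hi
      have h1 := not_hit_of_lastHit_eq hd hi.2.1 hi.1
      rw [h]
      by_contra h2
      refine h1 ⟨hi.2.2.1, fun j' hj' => Or.inr ?_⟩
      simp only [Option.mem_def, Option.some.injEq] at hj'
      subst hj'
      rw [hi.2.2.2]
      exact not_le.1 h2
  -- Only the attempts in `F` consult this delay before slot `n + 1`, and all of them fail once it
  -- is at least `c`. Its exact value can therefore be replaced by `⊤`.
  · refine and_congr_right fun hcls => forall_congr' fun j' => imp_congr_right fun hj' => ?_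
    by_cases hkey : (j', lead x j', lead x i) = (j, lead x j, lead x n)
    · have hji : j' = j ∧ lead x i = lead x n := by
        simp only [Prod.mk.injEq] at hkey
        exact ⟨hkey.1, hkey.2.2⟩
      obtain ⟨rfl, hli⟩ := hji
      have h1 := hc2 i (by
        simp only [hF, Finset.mem_filter, Finset.mem_range]
        exact ⟨hi, hl j' hj', hcls, hli⟩)
      rw [hkey, Function.update_self]
      have h2 : ¬ d (j', lead x j', lead x n) < ((i - j' : ℕ) : ℕ∞) :=
        not_lt.2 (le_trans (by exact_mod_cast h1) hd)
      rw [iff_false_intro h2, iff_false_intro (not_lt.2 le_top)]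
    · rw [Function.update_of_ne hkey]

end Marks

/-! ### Measurability of the marks -/

theorem measurableSet_of_values {Z β : Type*} [MeasurableSpace Z] [Countable β] [Inhabited β]
    {F : Z → ℕ → β} (hF : ∀ i v, MeasurableSet {z | F z i = v}) {t : ℕ} {𝒜 : Set (ℕ → β)}
    (hA : ∀ w w' : ℕ → β, (∀ i ≤ t, w i = w' i) → w ∈ 𝒜 → w' ∈ 𝒜) :
    MeasurableSet {z | F z ∈ 𝒜} := by
  have : {z | F z ∈ 𝒜} = ⋃ v ∈ {v : Fin (t + 1) → β |
      (fun i => if hi : i < t + 1 then v ⟨i, hi⟩ else default) ∈ 𝒜},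
      ⋂ i : Fin (t + 1), {z | F z i = v i} := by
    ext z
    simp only [Set.mem_ofPred_eq, Set.mem_iUnion, Set.mem_iInter, exists_prop]
    constructor
    · intro hz
      refine ⟨fun i => F z i, hA _ _ (fun i hi => ?_) hz, fun i => rfl⟩
      rw [dif_pos (by omega)]
    · rintro ⟨v, hv, hz⟩
      refine hA _ _ (fun i hi => ?_) hv
      rw [dif_pos (by omega), ← hz]
  rw [this]
  exact MeasurableSet.biUnion (Set.to_countable _) fun v _ =>
    MeasurableSet.iInter fun i => hF i (v i)

section Marks

variable {𝒴 H : Type*} (cls : 𝒴 → Option Bool) (lead : (ℕ → 𝒴) → ℕ → H) (x : ℕ → 𝒴)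

theorem measurableSet_hit (i : ℕ) (l : Option ℕ) :
    MeasurableSet {d : ℕ × H × H → ℕ∞ | Hit cls lead x d i l} := by
  rcases l with _ | j
  · by_cases h : cls (x i) = some true <;> simp [Hit, h]
  · have : {d : ℕ × H × H → ℕ∞ | Hit cls lead x d i (some j)} = {_d | cls (x i) = some true} ∩
        ({_d | lead x j = lead x i} ∪
          (fun d => d (j, lead x j, lead x i)) ⁻¹' Set.Iio ((i - j : ℕ) : ℕ∞)) := by
      ext d
      simp [Hit]
    rw [this]
    exact (MeasurableSet.const _).inter ((MeasurableSet.const _).union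
      (measurable_pi_apply (j, lead x j, lead x i) MeasurableSet.of_discrete))

theorem measurableSet_lastHit (i : ℕ) (l : Option ℕ) :
    MeasurableSet {d : ℕ × H × H → ℕ∞ | lastHit cls lead x d i = l} ∧
      MeasurableSet {d : ℕ × H × H → ℕ∞ | Hit cls lead x d i (lastHit cls lead x d i)} := by
  induction i generalizing l with
  | zero => exact ⟨MeasurableSet.const (none = l), measurableSet_hit cls lead x 0 none⟩
  | succ i ih =>
    have h1 : ∀ l, MeasurableSet {d : ℕ × H × H → ℕ∞ | lastHit cls lead x d (i + 1) = l} := by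
      intro l
      have : {d : ℕ × H × H → ℕ∞ | lastHit cls lead x d (i + 1) = l} =
          ({d | Hit cls lead x d i (lastHit cls lead x d i)} ∩ {_d | some i = l}) ∪
          ({d | Hit cls lead x d i (lastHit cls lead x d i)}ᶜ ∩
            {d | lastHit cls lead x d i = l}) := by
        ext d
        by_cases h : Hit cls lead x d i (lastHit cls lead x d i) <;> simp [lastHit, h]
      rw [this]
      exact ((ih l).2.inter (MeasurableSet.const _)).union ((ih l).2.compl.inter (ih l).1)
    refine ⟨h1 l, ?_⟩
    have : {d : ℕ × H × H → ℕ∞ | Hit cls lead x d (i + 1) (lastHit cls lead x d (i + 1))} =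
        ⋃ l, ({d | lastHit cls lead x d (i + 1) = l} ∩ {d | Hit cls lead x d (i + 1) l}) := by
      ext d
      simp
    rw [this]
    exact MeasurableSet.iUnion fun l => (h1 l).inter (measurableSet_hit cls lead x _ l)

theorem measurableSet_mark (i : ℕ) (v : Option Bool) :
    MeasurableSet {d : ℕ × H × H → ℕ∞ | mark cls lead x d i = v} := by
  cases i with
  | zero => exact MeasurableSet.const (none = v)
  | succ i =>
    have h := (measurableSet_lastHit cls lead x i none).2
    have : {d : ℕ × H × H → ℕ∞ | mark cls lead x d (i + 1) = v} =
        ({d | Hit cls lead x d i (lastHit cls lead x d i)} ∩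
          {_d | (if cls (x i) = none then none else some true) = v}) ∪
        ({d | Hit cls lead x d i (lastHit cls lead x d i)}ᶜ ∩
          {_d | (if cls (x i) = none then none else some false) = v}) := by
      ext d
      by_cases h : Hit cls lead x d i (lastHit cls lead x d i) <;> simp [mark, h]
    rw [this]
    exact (h.inter (MeasurableSet.const _)).union (h.compl.inter (MeasurableSet.const _))

theorem measurableSet_late (h : H) (i : ℕ) :
    MeasurableSet {d : ℕ × H × H → ℕ∞ | Late cls lead x d h i} := by
  cases i with
  | zero => exact MeasurableSet.const _
  | succ m =>
    have : {d : ℕ × H × H → ℕ∞ | Late cls lead x d h (m + 1)} =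
        ⋃ g, ({_d | (∀ i, m < i → i ≤ m + g → cls (x i) = none) ∧ cls (x (m + g + 1)) ≠ none ∧
          lead x m ≠ h} ∩ {d | ((g + 1 : ℕ) : ℕ∞) ≤ d (m, lead x m, h)}) := by
      ext d
      simp only [Late, Set.mem_ofPred_eq, Set.mem_iUnion, Set.mem_inter_iff, and_assoc]
    rw [this]
    refine MeasurableSet.iUnion fun g => (MeasurableSet.const _).inter ?_
    exact measurable_pi_apply (m, lead x m, h) (MeasurableSet.of_discrete (s := Set.Ici _))

end Marks

/-! ### Independence -/

theorem setOf_mem_eq_iUnion_atoms {Ω 𝒳 : Type*} (X : Ω → 𝒳) (B : 𝒳 → Set Ω) :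
    {ω | ω ∈ B (X ω)} = ⋃ v, X ⁻¹' {v} ∩ B v := by
  ext ω
  simp

theorem measure_eq_tsum_atoms {Ω 𝒳 : Type*} [MeasurableSpace Ω] {P : Measure Ω}
    [MeasurableSpace 𝒳] [Countable 𝒳] [MeasurableSingletonClass 𝒳] {X : Ω → 𝒳}
    (hX : Measurable X) {B : 𝒳 → Set Ω} (hB : ∀ v, MeasurableSet (B v)) :
    P {ω | ω ∈ B (X ω)} = ∑' v, P (X ⁻¹' {v} ∩ B v) := by
  rw [setOf_mem_eq_iUnion_atoms]
  refine measure_iUnion (fun v v' hv => Set.disjoint_left.2 fun ω h₁ h₂ => hv ?_) fun v =>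
    (hX (measurableSet_singleton v)).inter (hB v)
  exact h₁.1.symm.trans h₂.1

/-- The symbols of the slots are i.i.d., the delays are i.i.d. and independent of the symbols, and
either an unsuccessful wait for a message makes a further wait no longer, or no party leads two
uniquely honest slots. -/
structure SymbolModel {Ω 𝒴 H : Type*} [MeasurableSpace Ω] [MeasurableSpace 𝒴] (P : Measure Ω)
    (Y : Ω → ℕ → 𝒴) (D : Ω → ℕ × H × H → ℕ∞) (cls : 𝒴 → Option Bool) (lead : (ℕ → 𝒴) → ℕ → H)
    (Δ : Measure ℕ∞) (f α : ℝ) : Prop where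
  lead_congr : ∀ (x x' : ℕ → 𝒴) i, (∀ j ≤ i, x j = x' j) → lead x i = lead x' i
  meas_symbol : ∀ i, Measurable fun ω => Y ω i
  indep_symbol : iIndepFun (fun i ω => Y ω i) P
  f_pos : 0 < f
  alpha_nonneg : 0 ≤ α
  alpha_le : α ≤ 1
  nonempty : ∀ i, P.real {ω | cls (Y ω i) ≠ none} = f
  uniq : ∀ i, P.real {ω | cls (Y ω i) = some true} = f * α
  meas_delay : ∀ k, Measurable fun ω => D ω k
  law_delay : ∀ k, P.map (fun ω => D ω k) = Δ
  indep_delay : iIndepFun (fun k ω => D ω k) P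
  indep : IndepFun Y D P
  retry : (∀ a b : ℕ, Δ (Set.Ici ((a + b : ℕ) : ℕ∞)) ≤ Δ (Set.Ici (a : ℕ∞)) * Δ (Set.Ici (b : ℕ∞))) ∨
    ∀ (x : ℕ → 𝒴) i j, i < j → cls (x i) = some true → cls (x j) = some true → lead x i ≠ lead x j

namespace SymbolModel

/-- Extends a finite sequence of symbols. -/
def extend {𝒴 : Type*} [Inhabited 𝒴] {n : ℕ} (v : Fin n → 𝒴) (i : ℕ) : 𝒴 := if hi : i < n then v ⟨i, hi⟩ else default

theorem extend_apply {𝒴 : Type*} [Inhabited 𝒴] {n : ℕ} (x : ℕ → 𝒴) {i : ℕ} (hi : i < n) :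
    extend (fun j : Fin n => x j) i = x i := dif_pos hi

theorem setOf_eq_atoms {Ω 𝒴 H : Type*} [Inhabited 𝒴] {Y : Ω → ℕ → 𝒴} {D : Ω → ℕ × H × H → ℕ∞}
    {n : ℕ} {Φ : (ℕ → 𝒴) → Set (ℕ × H × H → ℕ∞)}
    (hcongr : ∀ x x', (∀ i < n, x i = x' i) → Φ x = Φ x') :
    {ω | D ω ∈ Φ (Y ω)} =
      {ω | ω ∈ (fun v : Fin n → 𝒴 => D ⁻¹' Φ (extend v)) fun i => Y ω i} := by
  ext ω
  simp only [Set.mem_ofPred_eq, Set.mem_preimage]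
  rw [hcongr (extend fun i : Fin n => Y ω i) (Y ω) fun i hi => extend_apply _ hi]

variable {Ω 𝒴 H : Type*} [MeasurableSpace Ω] [MeasurableSpace 𝒴] {P : Measure Ω}
  {Y : Ω → ℕ → 𝒴} {D : Ω → ℕ × H × H → ℕ∞} {cls : 𝒴 → Option Bool}
  {lead : (ℕ → 𝒴) → ℕ → H} {Δ : Measure ℕ∞} {f α : ℝ}

theorem measurable_delays (h : SymbolModel P Y D cls lead Δ f α) : Measurable D :=
  measurable_pi_iff.2 h.meas_delay

theorem measurable_atoms (h : SymbolModel P Y D cls lead Δ f α) (n : ℕ) :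
    Measurable fun ω (i : Fin n) => Y ω i :=
  measurable_pi_iff.2 fun i => h.meas_symbol i

theorem measure_inter_delay (h : SymbolModel P Y D cls lead Δ f α) {S : Set (ℕ → 𝒴)}
    (hS : MeasurableSet S) {C : Set (ℕ × H × H → ℕ∞)} (hC : MeasurableSet C) :
    P (Y ⁻¹' S ∩ D ⁻¹' C) = P (Y ⁻¹' S) * P (D ⁻¹' C) :=
  h.indep.measure_inter_preimage_eq_mul _ _ hS hC

-- Overwriting the coordinate `k` leaves an event about the other delays, which is independent of
-- the delay `k`.
open Classical in
theorem measure_inter_delay_eq (h : SymbolModel P Y D cls lead Δ f α) {k : ℕ × H × H}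
    {E : Set (ℕ × H × H → ℕ∞)} (hE : MeasurableSet E) {T : Set ℕ∞} (hT : MeasurableSet T) :
    P ({ω | Function.update (D ω) k ⊤ ∈ E} ∩ {ω | D ω k ∈ T}) =
      P {ω | Function.update (D ω) k ⊤ ∈ E} * Δ T := by
  have hind : iIndep (fun k => MeasurableSpace.comap (fun ω => D ω k) inferInstance) P :=
    h.indep_delay
  have hle : ∀ k, MeasurableSpace.comap (fun ω => D ω k) inferInstance ≤ ‹MeasurableSpace Ω› :=
    fun k => (h.meas_delay k).comap_le
  have := indep_iSup_of_disjoint hle hind (S := {k}ᶜ) (T := {k}) (by simp)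
  have hlaw : Δ T = P {ω | D ω k ∈ T} := by
    rw [← h.law_delay k, Measure.map_apply (h.meas_delay k) hT]
    rfl
  rw [hlaw]
  refine (Indep_iff _ _ P).1 this _ _ ?_ ?_
  · have : Measurable[⨆ i ∈ ({k}ᶜ : Set (ℕ × H × H)),
        MeasurableSpace.comap (fun ω => D ω i) inferInstance]
        fun ω => Function.update (D ω) k ⊤ := by
      refine @measurable_pi_lambda _ _ _ (_) _ _ fun i => ?_
      by_cases hi : i = k
      · subst hi
        simp only [Function.update_self]
        exact @measurable_const _ _ _ (_) _
      · simp only [Function.update_of_ne hi]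
        refine Measurable.mono (comap_measurable fun ω => D ω i) ?_ le_rfl
        exact le_iSup₂_of_le i (by simpa using hi) le_rfl
    exact this hE
  · have : MeasurableSpace.comap (fun ω => D ω k) inferInstance ≤
        ⨆ i ∈ ({k} : Set (ℕ × H × H)), MeasurableSpace.comap (fun ω => D ω i) inferInstance :=
      le_iSup₂_of_le k rfl le_rfl
    exact this _ ⟨T, hT, rfl⟩

open Classical in
/-- If an event tells about one delay only that it is at least `c`, the conditional law of this
delay is that of `Δ` given `c ≤ Δ`. -/
theorem measure_le_of_threshold (h : SymbolModel P Y D cls lead Δ f α) {k : ℕ × H × H} {c a : ℕ}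
    {E : Set (ℕ × H × H → ℕ∞)} (hE : MeasurableSet E) (h1 : ∀ d ∈ E, (c : ℕ∞) ≤ d k)
    (h2 : ∀ d, (c : ℕ∞) ≤ d k → (d ∈ E ↔ Function.update d k ⊤ ∈ E)) (hca : c ≤ a) {b : ENNReal}
    (hb : Δ (Set.Ici (a : ℕ∞)) ≤ b * Δ (Set.Ici (c : ℕ∞))) :
    P (D ⁻¹' (E ∩ {d | (a : ℕ∞) ≤ d k})) ≤ b * P (D ⁻¹' E) := by
  have e1 : D ⁻¹' E = {ω | Function.update (D ω) k ⊤ ∈ E} ∩ {ω | D ω k ∈ Set.Ici (c : ℕ∞)} := by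
    ext ω
    exact ⟨fun hω => ⟨(h2 _ (h1 _ hω)).1 hω, h1 _ hω⟩, fun hω => (h2 _ hω.2).2 hω.1⟩
  have e2 : D ⁻¹' (E ∩ {d | (a : ℕ∞) ≤ d k}) =
      {ω | Function.update (D ω) k ⊤ ∈ E} ∩ {ω | D ω k ∈ Set.Ici (a : ℕ∞)} := by
    ext ω
    refine ⟨fun hω => ⟨(h2 _ (h1 _ hω.1)).1 hω.1, hω.2⟩, fun hω => ⟨(h2 _ ?_).2 hω.1, hω.2⟩⟩
    exact le_trans (by exact_mod_cast hca) hω.2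
  rw [e1, e2, h.measure_inter_delay_eq hE MeasurableSet.of_discrete,
    h.measure_inter_delay_eq hE MeasurableSet.of_discrete]
  calc _ ≤ P {ω | Function.update (D ω) k ⊤ ∈ E} * (b * Δ (Set.Ici (c : ℕ∞))) :=
        mul_le_mul_right hb _
    _ = _ := by ring

theorem f_le [IsProbabilityMeasure P] (h : SymbolModel P Y D cls lead Δ f α) : f ≤ 1 := by
  rw [← h.nonempty 0]
  exact measureReal_le_one

variable [Countable 𝒴] [MeasurableSingletonClass 𝒴]

theorem real_empty [IsProbabilityMeasure P] (h : SymbolModel P Y D cls lead Δ f α) (i : ℕ) :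
    P.real {ω | cls (Y ω i) = none} = 1 - f := by
  have hm : MeasurableSet {ω | cls (Y ω i) ≠ none} :=
    h.meas_symbol i (Set.to_countable {y | cls y ≠ none}).measurableSet
  have := probReal_compl_eq_one_sub (μ := P) hm
  rw [h.nonempty i] at this
  rw [← this]
  congr 1
  ext ω
  simp

theorem real_other [IsProbabilityMeasure P] (h : SymbolModel P Y D cls lead Δ f α) (i : ℕ) :
    P.real {ω | cls (Y ω i) = some false} = f - f * α := by
  have hm : MeasurableSet {ω | cls (Y ω i) = some true} :=
    h.meas_symbol i (Set.to_countable {y | cls y = some true}).measurableSet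
  have := measureReal_inter_add_sdiff (μ := P) (s := {ω | cls (Y ω i) ≠ none}) hm
  rw [h.nonempty i] at this
  have e1 : {ω | cls (Y ω i) ≠ none} ∩ {ω | cls (Y ω i) = some true} =
      {ω | cls (Y ω i) = some true} := by
    ext ω
    simp only [Set.mem_inter_iff, Set.mem_ofPred_eq]
    exact ⟨fun h => h.2, fun h => ⟨by simp [h], h⟩⟩
  have e2 : {ω | cls (Y ω i) ≠ none} \ {ω | cls (Y ω i) = some true} =
      {ω | cls (Y ω i) = some false} := by
    ext ω
    simp only [Set.mem_sdiff, Set.mem_ofPred_eq]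
    rcases cls (Y ω i) with _ | _ | _ <;> simp
  rw [e1, e2, h.uniq i] at this
  linarith

variable [Inhabited 𝒴]

theorem measurableSet (h : SymbolModel P Y D cls lead Δ f α) {n : ℕ}
    {Φ : (ℕ → 𝒴) → Set (ℕ × H × H → ℕ∞)}
    (hcongr : ∀ x x', (∀ i < n, x i = x' i) → Φ x = Φ x') (hm : ∀ x, MeasurableSet (Φ x)) :
    MeasurableSet {ω | D ω ∈ Φ (Y ω)} := by
  rw [setOf_eq_atoms hcongr, setOf_mem_eq_iUnion_atoms (fun ω (i : Fin n) => Y ω i)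
    fun v => D ⁻¹' Φ (extend v)]
  exact MeasurableSet.iUnion fun v => (h.measurable_atoms n (measurableSet_singleton v)).inter
    (h.measurable_delays (hm _))

/-- An inequality that holds conditionally on the symbols. -/
theorem measure_le_of_forall (h : SymbolModel P Y D cls lead Δ f α) {n : ℕ}
    {Φ Ψ : (ℕ → 𝒴) → Set (ℕ × H × H → ℕ∞)}
    (hΦ : ∀ x x', (∀ i < n, x i = x' i) → Φ x = Φ x') (hΦm : ∀ x, MeasurableSet (Φ x))
    (hΨ : ∀ x x', (∀ i < n, x i = x' i) → Ψ x = Ψ x') (hΨm : ∀ x, MeasurableSet (Ψ x))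
    {c : ENNReal} (hle : ∀ x, P (D ⁻¹' Φ x) ≤ c * P (D ⁻¹' Ψ x)) :
    P {ω | D ω ∈ Φ (Y ω)} ≤ c * P {ω | D ω ∈ Ψ (Y ω)} := by
  -- The alphabet is countable, so conditioning on the first `n` symbols is a sum over atoms; on
  -- each atom the delays are independent of the symbols.
  rw [setOf_eq_atoms hΦ, setOf_eq_atoms hΨ,
    measure_eq_tsum_atoms (h.measurable_atoms n) fun v => h.measurable_delays (hΦm _),
    measure_eq_tsum_atoms (h.measurable_atoms n) fun v => h.measurable_delays (hΨm _),
    ← ENNReal.tsum_mul_left]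
  refine ENNReal.tsum_le_tsum fun v => ?_
  have hS : MeasurableSet {x : ℕ → 𝒴 | (fun i : Fin n => x i) = v} :=
    measurable_pi_lambda (fun (x : ℕ → 𝒴) (i : Fin n) => x i) (fun i => measurable_pi_apply (i : ℕ))
      (measurableSet_singleton v)
  have h1 := h.measure_inter_delay hS (hΦm (extend v))
  have h2 := h.measure_inter_delay hS (hΨm (extend v))
  calc _ = P (Y ⁻¹' {x : ℕ → 𝒴 | (fun i : Fin n => x i) = v}) * P (D ⁻¹' Φ (extend v)) := h1
    _ ≤ P (Y ⁻¹' {x : ℕ → 𝒴 | (fun i : Fin n => x i) = v}) * (c * P (D ⁻¹' Ψ (extend v))) :=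
      mul_le_mul_right (hle _) _
    _ = c * (P (Y ⁻¹' {x : ℕ → 𝒴 | (fun i : Fin n => x i) = v}) * P (D ⁻¹' Ψ (extend v))) := by
      ring
    _ = _ := by rw [← h2]; rfl

/-- The next symbol is independent of the past. -/
theorem measure_inter_next (h : SymbolModel P Y D cls lead Δ f α) {n : ℕ}
    {Φ : (ℕ → 𝒴) → Set (ℕ × H × H → ℕ∞)}
    (hΦ : ∀ x x', (∀ i < n, x i = x' i) → Φ x = Φ x') (hΦm : ∀ x, MeasurableSet (Φ x))
    (S : Set 𝒴) :
    P ({ω | D ω ∈ Φ (Y ω)} ∩ {ω | Y ω n ∈ S}) = P {ω | D ω ∈ Φ (Y ω)} * P {ω | Y ω n ∈ S} := by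
  have hSm : MeasurableSet {ω | Y ω n ∈ S} := h.meas_symbol n S.to_countable.measurableSet
  have hset : {ω | D ω ∈ Φ (Y ω)} ∩ {ω | Y ω n ∈ S} = {ω | ω ∈ (fun v : Fin n → 𝒴 =>
      D ⁻¹' Φ (extend v) ∩ {ω | Y ω n ∈ S}) fun i => Y ω i} := by
    rw [setOf_eq_atoms hΦ]
    rfl
  rw [hset, setOf_eq_atoms hΦ,
    measure_eq_tsum_atoms (h.measurable_atoms n) fun v => (h.measurable_delays (hΦm _)).inter hSm,
    measure_eq_tsum_atoms (h.measurable_atoms n) fun v => h.measurable_delays (hΦm _),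
    ← ENNReal.tsum_mul_right]
  refine tsum_congr fun v => ?_
  have hA : MeasurableSet {x : ℕ → 𝒴 | (fun i : Fin n => x i) = v} :=
    measurable_pi_lambda (fun (x : ℕ → 𝒴) (i : Fin n) => x i) (fun i => measurable_pi_apply (i : ℕ))
      (measurableSet_singleton v)
  have hB : MeasurableSet {x : ℕ → 𝒴 | x n ∈ S} :=
    measurable_pi_apply n S.to_countable.measurableSet
  have h1 := h.measure_inter_delay (hA.inter hB) (hΦm (extend v))
  have h2 := h.measure_inter_delay hA (hΦm (extend v))
  have h3 : P (Y ⁻¹' ({x : ℕ → 𝒴 | (fun i : Fin n => x i) = v} ∩ {x | x n ∈ S})) =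
      P (Y ⁻¹' {x : ℕ → 𝒴 | (fun i : Fin n => x i) = v}) * P {ω | Y ω n ∈ S} := by
    have hi : ∀ N (U : ℕ → Set 𝒴), P (⋂ i ∈ Finset.range N, {ω | Y ω i ∈ U i}) =
        ∏ i ∈ Finset.range N, P {ω | Y ω i ∈ U i} := fun N U =>
      h.indep_symbol.measure_inter_preimage_eq_mul (Finset.range N) fun i _ =>
        (U i).to_countable.measurableSet
    have e1 : Y ⁻¹' {x : ℕ → 𝒴 | (fun i : Fin n => x i) = v} =
        ⋂ i ∈ Finset.range n, {ω | Y ω i ∈ ({extend v i} : Set 𝒴)} := by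
      ext ω
      simp only [Set.mem_preimage, Set.mem_ofPred_eq, Set.mem_iInter, Finset.mem_range,
        Set.mem_singleton_iff]
      constructor
      · rintro rfl i hi
        exact (extend_apply (Y ω) hi).symm
      · intro hω
        ext i
        rw [hω i i.2, extend, dif_pos i.2]
    have e2 : Y ⁻¹' ({x : ℕ → 𝒴 | (fun i : Fin n => x i) = v} ∩ {x | x n ∈ S}) =
        ⋂ i ∈ Finset.range (n + 1), {ω | Y ω i ∈ if i = n then S else ({extend v i} : Set 𝒴)} := by
      rw [Set.preimage_inter, e1]
      ext ω
      simp only [Set.mem_inter_iff, Set.mem_iInter, Finset.mem_range, Set.mem_preimage,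
        Set.mem_ofPred_eq]
      constructor
      · rintro ⟨h4, h5⟩ i hi
        split_ifs with hin
        · exact hin ▸ h5
        · exact h4 i (by omega)
      · intro h4
        refine ⟨fun i hi => ?_, by simpa using h4 n (by omega)⟩
        have := h4 i (by omega)
        rwa [if_neg (by omega)] at this
    rw [e2, hi, Finset.prod_range_succ, e1, hi, if_pos rfl]
    congr 1
    refine Finset.prod_congr rfl fun i hi => ?_
    rw [if_neg (by have := Finset.mem_range.1 hi; omega)]
  calc _ = P (Y ⁻¹' ({x : ℕ → 𝒴 | (fun i : Fin n => x i) = v} ∩ {x | x n ∈ S}) ∩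
        D ⁻¹' Φ (extend v)) := by
        congr 1
        ext ω
        simp only [Set.mem_inter_iff, Set.mem_preimage, Set.mem_ofPred_eq, Set.mem_singleton_iff]
        tauto
    _ = _ := by
        rw [h1, h3, mul_right_comm, ← h2]
        rfl

/-- A gap of empty slots followed by a slot of a given kind is independent of the past. -/
theorem measure_inter_gap [IsProbabilityMeasure P] (h : SymbolModel P Y D cls lead Δ f α) {n : ℕ}
    {Φ : (ℕ → 𝒴) → Set (ℕ × H × H → ℕ∞)}
    (hΦ : ∀ x x', (∀ i < n, x i = x' i) → Φ x = Φ x') (hΦm : ∀ x, MeasurableSet (Φ x)) (g : ℕ) :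
    P.real {ω | D ω ∈ Φ (Y ω) ∧ ∀ i, n ≤ i → i < n + g → cls (Y ω i) = none} =
        P.real {ω | D ω ∈ Φ (Y ω)} * (1 - f) ^ g ∧
      ∀ S : Set 𝒴,
        P.real {ω | (D ω ∈ Φ (Y ω) ∧ ∀ i, n ≤ i → i < n + g → cls (Y ω i) = none) ∧
          Y ω (n + g) ∈ S} =
        P.real {ω | D ω ∈ Φ (Y ω)} * (1 - f) ^ g * P.real {ω | Y ω (n + g) ∈ S} := by
  have next : ∀ g (S : Set 𝒴),
      P.real {ω | (D ω ∈ Φ (Y ω) ∧ ∀ i, n ≤ i → i < n + g → cls (Y ω i) = none) ∧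
          Y ω (n + g) ∈ S} =
        P.real {ω | D ω ∈ Φ (Y ω) ∧ ∀ i, n ≤ i → i < n + g → cls (Y ω i) = none} *
          P.real {ω | Y ω (n + g) ∈ S} := by
    intro g S
    have := h.measure_inter_next (n := n + g) (Φ := fun x => Φ x ∩ {_d | ∀ i, n ≤ i → i < n + g →
      cls (x i) = none}) (fun x x' hx => ?_) (fun x => (hΦm x).inter (MeasurableSet.const _)) S
    · simp only [measureReal_def, ← ENNReal.toReal_mul]
      exact congrArg _ this
    · rw [hΦ x x' fun i hi => hx i (by omega)]
      ext d
      simp only [Set.mem_inter_iff, Set.mem_ofPred_eq]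
      refine and_congr_right fun _ => forall_congr' fun i => imp_congr_right fun _ =>
        imp_congr_right fun hi => ?_
      rw [hx i hi]
  have key : P.real {ω | D ω ∈ Φ (Y ω) ∧ ∀ i, n ≤ i → i < n + g → cls (Y ω i) = none} =
      P.real {ω | D ω ∈ Φ (Y ω)} * (1 - f) ^ g := by
    induction g with
    | zero =>
      rw [pow_zero, mul_one]
      congr 1
      ext ω
      simp only [Set.mem_ofPred_eq, and_iff_left_iff_imp]
      intro _ i h1 h2
      omega
    | succ g ih =>
      have := next g {y | cls y = none}
      rw [ih] at this
      have e : P.real {ω | Y ω (n + g) ∈ {y | cls y = none}} = 1 - f := h.real_empty (n + g)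
      rw [e] at this
      rw [pow_succ, ← mul_assoc, ← this]
      congr 1
      ext ω
      simp only [Set.mem_ofPred_eq, and_assoc]
      refine and_congr_right fun _ => ⟨fun h1 => ⟨fun i h2 h3 => h1 i h2 (by omega),
        h1 _ (by omega) (by omega)⟩, fun h1 i h2 h3 => ?_⟩
      rcases Nat.lt_or_ge i (n + g) with h4 | h4
      · exact h1.1 i h2 h4
      · obtain rfl : i = n + g := by omega
        exact h1.2
  exact ⟨key, fun S => by rw [next, key]⟩

end SymbolModel

/-! ### The law of the marks -/

theorem geomPMF_succ (f : ℝ) (g : ℕ) : geomPMF f (g + 1) = (1 - f) ^ g * f := by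
  simp [geomPMF]

theorem hasSum_geom {f : ℝ} (h0 : 0 < f) (h1 : f ≤ 1) :
    HasSum (fun g : ℕ => (1 - f) ^ g * f) 1 := by
  have := (hasSum_geometric_of_lt_one (r := 1 - f) (by linarith) (by linarith)).mul_right f
  rwa [sub_sub_cancel, inv_mul_cancel₀ h0.ne'] at this

theorem hasSum_probDelayLtGeom (Δ : Measure ℕ∞) [IsProbabilityMeasure Δ] {f : ℝ} (h0 : 0 < f)
    (h1 : f ≤ 1) :
    HasSum (fun g : ℕ => (1 - f) ^ g * f * Δ.real (Set.Iio ((g + 1 : ℕ) : ℕ∞)))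
      (probDelayLtGeom Δ f) := by
  have hs : Summable fun g : ℕ => (1 - f) ^ g * f * Δ.real (Set.Iio ((g + 1 : ℕ) : ℕ∞)) := by
    refine Summable.of_nonneg_of_le (fun g => ?_) (fun g => ?_) (hasSum_geom h0 h1).summable
    · exact mul_nonneg (mul_nonneg (pow_nonneg (by linarith) _) h0.le) measureReal_nonneg
    · exact mul_le_of_le_one_right (mul_nonneg (pow_nonneg (by linarith) _) h0.le)
        measureReal_le_one
  have hs' : HasSum (fun g : ℕ => geomPMF f (g + 1) * Δ.real (Set.Iio ((g + 1 : ℕ) : ℕ∞)))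
      (∑' g : ℕ, (1 - f) ^ g * f * Δ.real (Set.Iio ((g + 1 : ℕ) : ℕ∞))) := by
    simp only [geomPMF_succ]
    exact hs.hasSum
  have h2 := (hasSum_nat_add_iff (f := fun g : ℕ => geomPMF f g * Δ.real (Set.Iio (g : ℕ∞))) 1).1 hs'
  have h3 : geomPMF f 0 = 0 := by simp [geomPMF]
  simp only [Finset.range_one, Finset.sum_singleton, h3, zero_mul, add_zero] at h2
  rw [probDelayLtGeom, h2.tsum_eq]
  exact hs.hasSum

theorem real_Ici_eq (Δ : Measure ℕ∞) [IsProbabilityMeasure Δ] (g : ℕ) :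
    Δ.real (Set.Ici (g : ℕ∞)) = 1 - Δ.real (Set.Iio (g : ℕ∞)) := by
  rw [← Set.compl_Iio, probReal_compl_eq_one_sub MeasurableSet.of_discrete]

namespace SymbolModel

variable {Ω 𝒴 H : Type*} [MeasurableSpace Ω] [MeasurableSpace 𝒴] {P : Measure Ω}
  {Y : Ω → ℕ → 𝒴} {D : Ω → ℕ × H × H → ℕ∞} {cls : 𝒴 → Option Bool}
  {lead : (ℕ → 𝒴) → ℕ → H} {Δ : Measure ℕ∞} {f α : ℝ}

theorem mark_mem_congr (h : SymbolModel P Y D cls lead Δ f α) {n : ℕ} {𝒜 : Set (ℕ → Option Bool)}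
    (hA : DependsUpTo n 𝒜) (x x' : ℕ → 𝒴) (hx : ∀ i < n, x i = x' i) :
    {d | mark cls lead x d ∈ 𝒜} = {d | mark cls lead x' d ∈ 𝒜} := by
  ext d
  have key := fun i hi => mark_congr_of_eqOn (cls := cls) (d := d) h.lead_congr hx (i := i) hi
  exact ⟨fun hd => hA _ _ key hd, fun hd => hA _ _ (fun i hi => (key i hi).symm) hd⟩

theorem lastHit_congr (h : SymbolModel P Y D cls lead Δ f α) {n : ℕ} {x x' : ℕ → 𝒴}
    (hx : ∀ i < n, x i = x' i) (d : ℕ × H × H → ℕ∞) :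
    lastHit cls lead x d n = lastHit cls lead x' d n :=
  LongestChain.lastHit_congr (hit_congr_of_eqOn h.lead_congr hx) le_rfl

/-- If the block of slot `j + 1` is the last special one, it has reached the leader of the next
non-empty slot with at least the probability of a fresh message. -/
theorem measure_miss_le [IsProbabilityMeasure Δ] (h : SymbolModel P Y D cls lead Δ f α) {t g j : ℕ}
    {𝒜 : Set (ℕ → Option Bool)} (hA : DependsUpTo (t + g) 𝒜)
    (hgap : ∀ w ∈ 𝒜, EmptyGap w t g) (x : ℕ → 𝒴) (hx : cls (x (t + g)) = some true) :
    P (D ⁻¹' ({d | mark cls lead x d ∈ 𝒜 ∧ lastHit cls lead x d (t + g) = some j} ∩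
        {d | ((t + g - j : ℕ) : ℕ∞) ≤ d (j, lead x j, lead x (t + g))})) ≤
      Δ (Set.Ici ((g + 1 : ℕ) : ℕ∞)) *
        P (D ⁻¹' {d | mark cls lead x d ∈ 𝒜 ∧ lastHit cls lead x d (t + g) = some j}) := by
  classical
  set E := {d | mark cls lead x d ∈ 𝒜 ∧ lastHit cls lead x d (t + g) = some j} with hE
  have hEm : MeasurableSet E := (measurableSet_of_values (measurableSet_mark cls lead x) hA).inter
    (measurableSet_lastHit cls lead x _ _).1
  rcases E.eq_empty_or_nonempty with h0 | ⟨d₀, hd₀⟩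
  · simp [h0]
  have hempty : ∀ i, t ≤ i → i < t + g → cls (x i) = none := fun i h1 h2 =>
    mark_succ_eq_none.1 (hgap _ hd₀.1 (i + 1) (by omega) (by omega))
  have hjt : j < t := by
    by_contra hle
    have h1 := hempty j (by omega) (lt_of_lastHit_eq_some hd₀.2)
    have h2 := (hit_lastHit_of_eq hd₀.2).1
    simp [h1] at h2
  obtain ⟨c, hc, hc1, hc2⟩ := exists_threshold (lead := lead) (j := j) hempty
  -- The last failed attempt precedes the `g` empty slots, so the message has at least `g + 1` slots
  -- beyond the known lower bound `c`.
  have hct : c + (g + 1) ≤ t + g - j := by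
    rcases hc with rfl | ⟨i, hji, hit, rfl, -⟩ <;> omega
  refine h.measure_le_of_threshold (c := c) hEm (fun d hd => hc1 d hd.2) (fun d hd => ?_)
    (by omega) ?_
  · have hcongr := hc2 d hd
    have h1 := LongestChain.lastHit_congr hcongr le_rfl
    have h2 := fun i hi => mark_congr (fun _ _ => rfl) hcongr (i := i) hi
    simp only [hE, Set.mem_ofPred_eq]
    rw [h1]
    exact and_congr_left fun _ => ⟨fun h3 => hA _ _ h2 h3,
      fun h3 => hA _ _ (fun i hi => (h2 i hi).symm) h3⟩
  · have hmono : Δ (Set.Ici ((t + g - j : ℕ) : ℕ∞)) ≤ Δ (Set.Ici ((c + (g + 1) : ℕ) : ℕ∞)) :=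
      measure_mono (Set.Ici_subset_Ici.2 (by exact_mod_cast hct))
    refine hmono.trans ?_
    rcases h.retry with hnbu | hfresh
    · rw [mul_comm]
      exact hnbu c (g + 1)
    · obtain rfl : c = 0 := by
        rcases hc with h1 | ⟨i, _, hit, _, hcls, hl⟩
        · exact h1
        · exact absurd hl (hfresh x i (t + g) (by omega) hcls hx)
      simp

variable [Countable 𝒴] [MeasurableSingletonClass 𝒴] [Inhabited 𝒴] [IsProbabilityMeasure P]

/-- A non-empty slot fails to be special if it is not uniquely honest, which has probability `f - f
* α` independently of the past, or if its leader has missed the last special block. The second case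
is summed over the position `j` of that block by `measure_miss_le`. -/
theorem measure_other_le [IsProbabilityMeasure Δ] (h : SymbolModel P Y D cls lead Δ f α) {t g : ℕ}
    {𝒜 : Set (ℕ → Option Bool)} (hA : DependsUpTo (t + g) 𝒜)
    (hgap : ∀ w ∈ 𝒜, EmptyGap w t g) :
    P.real {ω | mark cls lead (Y ω) (D ω) ∈ 𝒜 ∧
        mark cls lead (Y ω) (D ω) (t + g + 1) = some false} ≤
      P.real {ω | mark cls lead (Y ω) (D ω) ∈ 𝒜} *
        (f * (1 - α * Δ.real (Set.Iio ((g + 1 : ℕ) : ℕ∞)))) := by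
  set n := t + g with hn
  have hΦ := h.mark_mem_congr hA
  have hΦm : ∀ x, MeasurableSet {d : ℕ × H × H → ℕ∞ | mark cls lead x d ∈ 𝒜} := fun x =>
    measurableSet_of_values (measurableSet_mark cls lead x) hA
  set A : Set Ω := {ω | mark cls lead (Y ω) (D ω) ∈ 𝒜} with hAdef
  have hnext : ∀ v, P (A ∩ {ω | cls (Y ω n) = v}) = P A * P {ω | cls (Y ω n) = v} := fun v =>
    h.measure_inter_next hΦ hΦm {y | cls y = v}
  set F : ℕ → Set Ω := fun j => {ω | D ω ∈ {d | (mark cls lead (Y ω) d ∈ 𝒜 ∧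
    lastHit cls lead (Y ω) d n = some j) ∧ cls (Y ω n) = some true}} with hF
  set c := Δ (Set.Ici ((g + 1 : ℕ) : ℕ∞)) with hc
  have hFle : ∀ j, P {ω | D ω ∈ {d | ((mark cls lead (Y ω) d ∈ 𝒜 ∧
      lastHit cls lead (Y ω) d n = some j) ∧ cls (Y ω n) = some true) ∧
      ((n - j : ℕ) : ℕ∞) ≤ d (j, lead (Y ω) j, lead (Y ω) n)}} ≤ c * P (F j) := by
    intro j
    have hm1 : ∀ x, MeasurableSet {d : ℕ × H × H → ℕ∞ | (mark cls lead x d ∈ 𝒜 ∧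
        lastHit cls lead x d n = some j) ∧ cls (x n) = some true} := fun x =>
      ((hΦm x).inter (measurableSet_lastHit cls lead x _ _).1).inter (MeasurableSet.const _)
    rcases Nat.lt_or_ge j n with hjn | hjn
    · refine h.measure_le_of_forall (n := n + 1) (Φ := fun x => {d | ((mark cls lead x d ∈ 𝒜 ∧
        lastHit cls lead x d n = some j) ∧ cls (x n) = some true) ∧
        ((n - j : ℕ) : ℕ∞) ≤ d (j, lead x j, lead x n)}) (Ψ := fun x => {d | (mark cls lead x d ∈ 𝒜 ∧
        lastHit cls lead x d n = some j) ∧ cls (x n) = some true}) ?_ ?_ ?_ hm1 ?_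
      · intro x x' hx
        have h1 := hΦ x x' fun i hi => hx i (by omega)
        ext d
        have h2 : mark cls lead x d ∈ 𝒜 ↔ mark cls lead x' d ∈ 𝒜 := Set.ext_iff.1 h1 d
        simp only [Set.mem_ofPred_eq]
        rw [h2, h.lastHit_congr (fun i hi => hx i (by omega)) d, hx n (by omega),
          h.lead_congr x x' j fun i hi => hx i (by omega),
          h.lead_congr x x' n fun i hi => hx i (by omega)]
      · intro x
        exact (hm1 x).inter (measurable_pi_apply (j, lead x j, lead x n)
          (MeasurableSet.of_discrete (s := Set.Ici _)))
      · intro x x' hx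
        have h1 := hΦ x x' fun i hi => hx i (by omega)
        ext d
        have h2 : mark cls lead x d ∈ 𝒜 ↔ mark cls lead x' d ∈ 𝒜 := Set.ext_iff.1 h1 d
        simp only [Set.mem_ofPred_eq]
        rw [h2, h.lastHit_congr (fun i hi => hx i (by omega)) d, hx n (by omega)]
      · intro x
        by_cases hx : cls (x n) = some true
        · simp only [hx, and_true]
          exact h.measure_miss_le hA hgap x hx
        · simp [hx]
    · refine le_trans (measure_mono_null ?_ (measure_empty (μ := P))).le bot_le
      rintro ω ⟨⟨⟨_, h1⟩, _⟩, _⟩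
      have := lt_of_lastHit_eq_some h1
      omega
  have hsub : {ω | mark cls lead (Y ω) (D ω) ∈ 𝒜 ∧
        mark cls lead (Y ω) (D ω) (n + 1) = some false} ⊆
      (A ∩ {ω | cls (Y ω n) = some false}) ∪
      ⋃ j ∈ Finset.range n, {ω | D ω ∈ {d | ((mark cls lead (Y ω) d ∈ 𝒜 ∧
        lastHit cls lead (Y ω) d n = some j) ∧ cls (Y ω n) = some true) ∧
        ((n - j : ℕ) : ℕ∞) ≤ d (j, lead (Y ω) j, lead (Y ω) n)}} := by
    rintro ω ⟨h1, h2⟩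
    have h3 : ¬ Hit cls lead (Y ω) (D ω) n (lastHit cls lead (Y ω) (D ω) n) := fun h4 => by
      rw [mark_succ_eq_true.2 h4] at h2
      simp at h2
    rcases hcls : cls (Y ω n) with _ | _ | _
    · rw [mark_succ_eq_none.2 hcls] at h2
      simp at h2
    · exact Or.inl ⟨h1, hcls⟩
    · right
      rcases hl : lastHit cls lead (Y ω) (D ω) n with _ | j
      · exact absurd ⟨hcls, by simp [hl]⟩ h3
      · simp only [Set.mem_iUnion, Finset.mem_range, exists_prop]
        refine ⟨j, lt_of_lastHit_eq_some hl, ⟨⟨h1, hl⟩, hcls⟩, ?_⟩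
        by_contra h4
        refine h3 ⟨hcls, fun j' hj' => Or.inr ?_⟩
        rw [hl] at hj'
        simp only [Option.mem_def, Option.some.injEq] at hj'
        subst hj'
        exact not_le.1 h4
  have hFm : ∀ j, MeasurableSet (F j) := fun j => by
    refine h.measurableSet (n := n + 1) (Φ := fun x => {d | (mark cls lead x d ∈ 𝒜 ∧
        lastHit cls lead x d n = some j) ∧ cls (x n) = some true}) ?_ fun x =>
      ((hΦm x).inter (measurableSet_lastHit cls lead x _ _).1).inter (MeasurableSet.const _)
    intro x x' hx
    have h1 := hΦ x x' fun i hi => hx i (by omega)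
    ext d
    have h2 : mark cls lead x d ∈ 𝒜 ↔ mark cls lead x' d ∈ 𝒜 := Set.ext_iff.1 h1 d
    simp only [Set.mem_ofPred_eq]
    rw [h2, h.lastHit_congr (fun i hi => hx i (by omega)) d, hx n (by omega)]
  have hsum : ∑ j ∈ Finset.range n, P (F j) ≤ P (A ∩ {ω | cls (Y ω n) = some true}) := by
    rw [← measure_biUnion_finset (fun i _ j _ hij => Set.disjoint_left.2 fun ω h1 h2 => hij ?_)
      fun j _ => hFm j]
    · refine measure_mono fun ω hω => ?_
      simp only [Set.mem_iUnion] at hω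
      obtain ⟨j, _, h1⟩ := hω
      exact ⟨h1.1.1, h1.2⟩
    · have := h1.1.2.symm.trans h2.1.2
      simpa using this
  have htot : P {ω | mark cls lead (Y ω) (D ω) ∈ 𝒜 ∧
        mark cls lead (Y ω) (D ω) (n + 1) = some false} ≤
      P A * P {ω | cls (Y ω n) = some false} + c * (P A * P {ω | cls (Y ω n) = some true}) := by
    refine (measure_mono hsub).trans ((measure_union_le _ _).trans (add_le_add (hnext _).le ?_))
    refine (measure_biUnion_finset_le _ _).trans
      ((Finset.sum_le_sum fun j _ => hFle j).trans ?_)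
    rw [← Finset.mul_sum, ← hnext]
    exact mul_le_mul_right hsum _
  have hreal := ENNReal.toReal_mono (by finiteness) htot
  rw [ENNReal.toReal_add (by finiteness) (by finiteness)] at hreal
  simp only [ENNReal.toReal_mul, ← measureReal_def] at hreal
  rw [h.real_other n, h.uniq n, hc, ← measureReal_def, real_Ici_eq] at hreal
  refine hreal.trans (le_of_eq ?_)
  ring

theorem slotLaw [IsProbabilityMeasure Δ] (h : SymbolModel P Y D cls lead Δ f α) :
    SlotLaw P (fun ω => mark cls lead (Y ω) (D ω)) f α (α * probDelayLtGeom Δ f)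
      fun g => α * Δ.real (Set.Iio (g : ℕ∞)) where
  meas i v := by
    refine h.measurableSet (n := i) (Φ := fun x => {d | mark cls lead x d i = v})
      (fun x x' hx => ?_) fun x => measurableSet_mark cls lead x i v
    ext d
    simp only [Set.mem_ofPred_eq]
    rw [mark_congr_of_eqOn h.lead_congr hx le_rfl]
  f_pos := h.f_pos
  f_le := h.f_le
  pi_nonneg g := mul_nonneg h.alpha_nonneg measureReal_nonneg
  pi_le g := mul_le_of_le_one_right h.alpha_nonneg measureReal_le_one
  alpha_le := h.alpha_le
  hasSum := by
    have := (hasSum_probDelayLtGeom Δ h.f_pos h.f_le).mul_left α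
    refine this.congr_fun fun g => ?_
    ring
  empty_gap t g 𝒜 hA := by
    have := (h.measure_inter_gap (h.mark_mem_congr hA) (fun x =>
      measurableSet_of_values (measurableSet_mark cls lead x) hA) g).1
    refine Eq.trans ?_ this
    congr 1
    ext ω
    refine and_congr_right fun _ => ⟨fun h1 i h2 h3 => ?_, fun h1 i h2 h3 => ?_⟩
    · exact mark_succ_eq_none.1 (h1 (i + 1) (by omega) (by omega))
    · obtain ⟨i, rfl⟩ : ∃ m, i = m + 1 := ⟨i - 1, by omega⟩
      exact mark_succ_eq_none.2 (h1 i (by omega) (by omega))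
  other_gap t g 𝒜 hA := by
    have hA' : DependsUpTo (t + g) {w | w ∈ 𝒜 ∧ EmptyGap w t g} := fun w w' hw hm =>
      ⟨hA w w' (fun i hi => hw i (by omega)) hm.1, fun i h1 h2 => by
        rw [← hw i h2]
        exact hm.2 i h1 h2⟩
    have h1 := h.measure_other_le hA' fun w hw => hw.2
    have h2 := (h.measure_inter_gap (h.mark_mem_congr hA) (fun x =>
      measurableSet_of_values (measurableSet_mark cls lead x) hA) g).1
    have h3 : {ω | mark cls lead (Y ω) (D ω) ∈ {w | w ∈ 𝒜 ∧ EmptyGap w t g}} =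
        {ω | D ω ∈ {d | mark cls lead (Y ω) d ∈ 𝒜} ∧
          ∀ i, t ≤ i → i < t + g → cls (Y ω i) = none} := by
      ext ω
      refine and_congr_right fun _ => ⟨fun h1 i h2 h3 => ?_, fun h1 i h2 h3 => ?_⟩
      · exact mark_succ_eq_none.1 (h1 (i + 1) (by omega) (by omega))
      · obtain ⟨i, rfl⟩ : ∃ m, i = m + 1 := ⟨i - 1, by omega⟩
        exact mark_succ_eq_none.2 (h1 i (by omega) (by omega))
    rw [h3, h2] at h1
    refine le_trans (le_of_eq ?_) (h1.trans (le_of_eq ?_))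
    · congr 1
      ext ω
      simp only [Set.mem_ofPred_eq, and_assoc]
    · simp only [Set.mem_ofPred_eq]
      ring
  first_other g := by
    have h1 := (h.measure_inter_gap (n := 0) (Φ := fun _ => Set.univ) (fun _ _ _ => rfl)
      (fun _ => MeasurableSet.univ) g).2 {y | cls y = some false}
    have h2 : P.real {ω | Y ω (0 + g) ∈ {y | cls y = some false}} = f - f * α := h.real_other _
    have h3 : {ω | D ω ∈ (Set.univ : Set (ℕ × H × H → ℕ∞))} = Set.univ := by
      ext
      simp
    rw [h2, h3, probReal_univ] at h1
    refine (measureReal_mono ?_).trans (h1.trans_le (le_of_eq (by ring)))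
    rintro ω ⟨h4, h5⟩
    -- Before the first non-empty slot there is no block to be heard of, so this slot is special as
    -- soon as it is uniquely honest.
    have h6 : ∀ i < 0 + g, cls (Y ω i) = none := fun i hi =>
      mark_succ_eq_none.1 (h4 (i + 1) (by omega) (by omega))
    refine ⟨⟨trivial, fun i _ hi => h6 i hi⟩, ?_⟩
    simp only [Set.mem_ofPred_eq]
    rcases hcls : cls (Y ω (0 + g)) with _ | _ | _
    · rw [mark_succ_eq_none.2 hcls] at h5
      simp at h5
    · rfl
    · rw [mark_succ_eq_true.2 ⟨hcls, by rw [lastHit_eq_none h6]; simp⟩] at h5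
      simp at h5

end SymbolModel

/-! ### The law of the late blocks -/

/-- The probability that a message is not received before the next non-empty slot. -/
theorem tsum_late_le (Δ : Measure ℕ∞) [IsProbabilityMeasure Δ] {f : ℝ} (h0 : 0 < f) (h1 : f ≤ 1)
    (hp : 1 / 2 ≤ probDelayLtGeom Δ f) :
    ∑' g : ℕ, ENNReal.ofReal ((1 - f) ^ g * f) * Δ (Set.Ici ((g + 1 : ℕ) : ℕ∞)) ≤
      ENNReal.ofReal (1 / 2) := by
  have h2 : ∀ g : ℕ, 0 ≤ (1 - f) ^ g * f := fun g =>
    mul_nonneg (pow_nonneg (by linarith) _) h0.le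
  have hs := (hasSum_geom h0 h1).sub (hasSum_probDelayLtGeom Δ h0 h1)
  have e : ∀ g : ℕ, ENNReal.ofReal ((1 - f) ^ g * f) * Δ (Set.Ici ((g + 1 : ℕ) : ℕ∞)) =
      ENNReal.ofReal ((1 - f) ^ g * f -
        (1 - f) ^ g * f * Δ.real (Set.Iio ((g + 1 : ℕ) : ℕ∞))) := fun g => by
    rw [← ofReal_measureReal (measure_ne_top _ _), ← ENNReal.ofReal_mul (h2 g), real_Ici_eq]
    congr 1
    ring
  simp only [e]
  rw [← ENNReal.ofReal_tsum_of_nonneg (fun g => ?_) hs.summable, hs.tsum_eq]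
  · exact ENNReal.ofReal_le_ofReal (by linarith)
  · have := mul_le_of_le_one_right (h2 g)
      (measureReal_le_one (μ := Δ) (s := Set.Iio ((g + 1 : ℕ) : ℕ∞)))
    linarith

namespace SymbolModel

variable {Ω 𝒴 H : Type*} [MeasurableSpace Ω] [MeasurableSpace 𝒴] {P : Measure Ω}
  {Y : Ω → ℕ → 𝒴} {D : Ω → ℕ × H × H → ℕ∞} {cls : 𝒴 → Option Bool}
  {lead : (ℕ → 𝒴) → ℕ → H} {Δ : Measure ℕ∞} {f α : ℝ}
  [Countable 𝒴] [MeasurableSingletonClass 𝒴] [Inhabited 𝒴]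

theorem measurableSet_lateSlot (h : SymbolModel P Y D cls lead Δ f α) (h' : H) (i : ℕ) :
    MeasurableSet {ω | Late cls lead (Y ω) (D ω) h' i} := by
  cases i with
  | zero => exact MeasurableSet.const False
  | succ m =>
    have : {ω | Late cls lead (Y ω) (D ω) h' (m + 1)} = ⋃ g, {ω | D ω ∈ {d |
        ((∀ i, m < i → i ≤ m + g → cls (Y ω i) = none) ∧ cls (Y ω (m + g + 1)) ≠ none ∧
          lead (Y ω) m ≠ h') ∧ ((g + 1 : ℕ) : ℕ∞) ≤ d (m, lead (Y ω) m, h')}} := by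
      ext ω
      simp only [Late, Set.mem_ofPred_eq, Set.mem_iUnion, and_assoc]
    rw [this]
    refine MeasurableSet.iUnion fun g => h.measurableSet (n := m + g + 2) (Φ := fun x => {d |
        ((∀ i, m < i → i ≤ m + g → cls (x i) = none) ∧ cls (x (m + g + 1)) ≠ none ∧
          lead x m ≠ h') ∧ ((g + 1 : ℕ) : ℕ∞) ≤ d (m, lead x m, h')}) (fun x x' hx => ?_)
      fun x => ?_
    · have h1 : (∀ i, m < i → i ≤ m + g → cls (x i) = none) ↔
          ∀ i, m < i → i ≤ m + g → cls (x' i) = none :=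
        forall_congr' fun i => imp_congr_right fun _ => imp_congr_right fun hi => by
          rw [hx i (by omega)]
      rw [h.lead_congr x x' m fun i hi => hx i (by omega), hx (m + g + 1) (by omega), h1]
    · exact (MeasurableSet.const _).inter (measurable_pi_apply (m, lead x m, h')
        (MeasurableSet.of_discrete (s := Set.Ici _)))

/-- The past of slot `m + 1` does not involve messages sent in that slot, and the gap that follows
is geometric and independent of the past. So the message to `h'` is late with conditional
probability at most that of `G ≤ Δ`, which is at most one half. -/
theorem unheardLaw [IsProbabilityMeasure P] [IsProbabilityMeasure Δ]
    (h : SymbolModel P Y D cls lead Δ f α) (hp : 1 / 2 ≤ probDelayLtGeom Δ f) (h' : H) :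
    UnheardLaw P (fun ω => mark cls lead (Y ω) (D ω)) fun ω => Late cls lead (Y ω) (D ω) h' where
  meas i := h.measurableSet_lateSlot h' i
  half t 𝒜 hA htrue := by
    cases t with
    | zero =>
      refine le_trans (measure_mono_null (fun ω hω => ?_) (measure_empty (μ := P))).le bot_le
      have := htrue _ hω.1
      simp [mark] at this
    | succ m =>
      classical
      set Φ : (ℕ → 𝒴) → Set (ℕ × H × H → ℕ∞) := fun x =>
        {d | (mark cls lead x d, Late cls lead x d h') ∈ 𝒜} with hΦdef
      -- Lateness of earlier blocks is decided by the symbols up to slot `m + 1` only because this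
      -- slot is special, hence non-empty.
      have hΦ : ∀ x x', (∀ i < m + 1, x i = x' i) → Φ x = Φ x' := by
        have key : ∀ x x' : ℕ → 𝒴, (∀ i < m + 1, x i = x' i) → Φ x ⊆ Φ x' := by
          intro x x' hx d hd
          have hne : cls (x m) ≠ none := fun h1 => by
            have h2 : mark cls lead x d (m + 1) = some true := htrue _ hd
            rw [mark_succ_eq_none.2 h1] at h2
            simp at h2
          exact hA _ _ _ _ (fun i hi => mark_congr_of_eqOn h.lead_congr hx hi)
            (fun i hi => late_congr_of_eqOn h.lead_congr (fun j hj => hx j (by omega)) hne h' hi) hd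
        exact fun x x' hx => (key x x' hx).antisymm (key x' x fun i hi => (hx i hi).symm)
      have hΦm : ∀ x, MeasurableSet (Φ x) := by
        intro x
        refine measurableSet_of_values (F := fun d i => (mark cls lead x d i, Late cls lead x d h' i))
          (t := m + 1) (𝒜 := {w | (fun i => (w i).1, fun i => (w i).2) ∈ 𝒜}) (fun i v => ?_)
          fun w w' hw hwA => hA _ _ _ _ (fun i hi => by rw [hw i hi])
            (fun i hi => by rw [hw i hi.le]) hwA
        have : {d : ℕ × H × H → ℕ∞ | (mark cls lead x d i, Late cls lead x d h' i) = v} =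
            {d | mark cls lead x d i = v.1} ∩ {d | Late cls lead x d h' i = v.2} := by
          ext d
          simp [Prod.ext_iff]
        rw [this]
        refine (measurableSet_mark cls lead x i v.1).inter ?_
        by_cases hv : v.2
        · simpa [hv] using measurableSet_late cls lead x h' i
        · simp only [hv, eq_iff_iff, iff_false]
          exact (measurableSet_late cls lead x h' i).compl
      have hset : ∀ g, ∀ ω, (D ω ∈ Φ (Y ω) ∧ ∀ i, m + 1 ≤ i → i < m + 1 + g →
          cls (Y ω i) = none) ∧ cls (Y ω (m + 1 + g)) ≠ none ↔
          D ω ∈ Φ (Y ω) ∧ (∀ i, m < i → i ≤ m + g → cls (Y ω i) = none) ∧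
          cls (Y ω (m + g + 1)) ≠ none := by
        intro g ω
        rw [and_assoc, show m + 1 + g = m + g + 1 by ring]
        refine and_congr_right fun _ => and_congr_left fun _ => forall_congr' fun i => ?_
        rw [Nat.lt_succ_iff]
        rfl
      have hgap : ∀ g, P {ω | D ω ∈ Φ (Y ω) ∧ (∀ i, m < i → i ≤ m + g → cls (Y ω i) = none) ∧
          cls (Y ω (m + g + 1)) ≠ none} =
          ENNReal.ofReal ((1 - f) ^ g * f) * P {ω | D ω ∈ Φ (Y ω)} := by
        intro g
        have h1 := (h.measure_inter_gap hΦ hΦm g).2 {y | cls y ≠ none}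
        have h2 : P.real {ω | Y ω (m + 1 + g) ∈ {y | cls y ≠ none}} = f := h.nonempty _
        rw [h2, mul_assoc, mul_comm] at h1
        have h3 : 0 ≤ (1 - f) ^ g * f :=
          mul_nonneg (pow_nonneg (by linarith [h.f_le]) _) h.f_pos.le
        rw [← ofReal_measureReal (measure_ne_top P {ω | D ω ∈ Φ (Y ω)}), ← ENNReal.ofReal_mul h3,
          ← h1, ofReal_measureReal (measure_ne_top _ _)]
        congr 1
        ext ω
        exact (hset g ω).symm
      have hbound : ∀ g : ℕ, P {ω | D ω ∈ {d | (d ∈ Φ (Y ω) ∧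
          (∀ i, m < i → i ≤ m + g → cls (Y ω i) = none) ∧ cls (Y ω (m + g + 1)) ≠ none) ∧
          ((g + 1 : ℕ) : ℕ∞) ≤ d (m, lead (Y ω) m, h')}} ≤
          Δ (Set.Ici ((g + 1 : ℕ) : ℕ∞)) * P {ω | D ω ∈ Φ (Y ω) ∧
          (∀ i, m < i → i ≤ m + g → cls (Y ω i) = none) ∧ cls (Y ω (m + g + 1)) ≠ none} := by
        intro g
        have hm1 : ∀ x, MeasurableSet {d | d ∈ Φ x ∧
            (∀ i, m < i → i ≤ m + g → cls (x i) = none) ∧ cls (x (m + g + 1)) ≠ none} :=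
          fun x => (hΦm x).inter (MeasurableSet.const _)
        have hc : ∀ x x' : ℕ → 𝒴, (∀ i < m + g + 2, x i = x' i) → (Φ x = Φ x' ∧
            ((∀ i, m < i → i ≤ m + g → cls (x i) = none) ↔
              ∀ i, m < i → i ≤ m + g → cls (x' i) = none) ∧ x (m + g + 1) = x' (m + g + 1) ∧
            lead x m = lead x' m) := fun x x' hx =>
          ⟨hΦ x x' fun i hi => hx i (by omega), forall_congr' fun i => imp_congr_right fun _ =>
            imp_congr_right fun hi => by rw [hx i (by omega)], hx _ (by omega),
            h.lead_congr x x' m fun i hi => hx i (by omega)⟩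
        refine h.measure_le_of_forall (n := m + g + 2) (Φ := fun x => {d | (d ∈ Φ x ∧
          (∀ i, m < i → i ≤ m + g → cls (x i) = none) ∧ cls (x (m + g + 1)) ≠ none) ∧
          ((g + 1 : ℕ) : ℕ∞) ≤ d (m, lead x m, h')}) (Ψ := fun x => {d | d ∈ Φ x ∧
          (∀ i, m < i → i ≤ m + g → cls (x i) = none) ∧ cls (x (m + g + 1)) ≠ none})
          (fun x x' hx => ?_) (fun x => ?_) (fun x x' hx => ?_) hm1 fun x => ?_
        · obtain ⟨h1, h2, h3, h4⟩ := hc x x' hx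
          rw [h1, h2, h3, h4]
        · exact (hm1 x).inter (measurable_pi_apply (m, lead x m, h')
            (MeasurableSet.of_discrete (s := Set.Ici _)))
        · obtain ⟨h1, h2, h3, h4⟩ := hc x x' hx
          rw [h1, h2, h3]
        -- Nothing is known yet about the delay of this message, so the threshold is `0`.
        · refine h.measure_le_of_threshold (c := 0) (hm1 x) (fun d _ => by simp) (fun d _ => ?_)
            (Nat.zero_le _) (by simp)
          simp only [Set.mem_ofPred_eq]
          refine and_congr_left fun _ => ?_
          have h1 : ∀ i ≤ m + 1, mark cls lead x d i =
              mark cls lead x (Function.update d (m, lead x m, h') ⊤) i := fun i hi =>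
            mark_congr (fun _ _ => rfl) (fun i hi l hl =>
              (hit_update (n := m) le_rfl (by omega) hl ⊤).symm) hi
          have h2 : ∀ i < m + 1, Late cls lead x d h' i ↔
              Late cls lead x (Function.update d (m, lead x m, h') ⊤) h' i := fun i hi =>
            (late_update (n := m) le_rfl hi ⊤ h').symm
          exact ⟨fun hd => hA _ _ _ _ h1 h2 hd,
            fun hd => hA _ _ _ _ (fun i hi => (h1 i hi).symm) (fun i hi => (h2 i hi).symm) hd⟩
      have hsub : {ω | (mark cls lead (Y ω) (D ω), Late cls lead (Y ω) (D ω) h') ∈ 𝒜 ∧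
          Late cls lead (Y ω) (D ω) h' (m + 1)} ⊆ ⋃ g : ℕ, {ω | D ω ∈ {d | (d ∈ Φ (Y ω) ∧
          (∀ i, m < i → i ≤ m + g → cls (Y ω i) = none) ∧ cls (Y ω (m + g + 1)) ≠ none) ∧
          ((g + 1 : ℕ) : ℕ∞) ≤ d (m, lead (Y ω) m, h')}} := by
        rintro ω ⟨h1, g, h2, h3, h4, h5⟩
        exact Set.mem_iUnion.2 ⟨g, ⟨h1, h2, h3⟩, h5⟩
      calc _ ≤ ∑' g : ℕ, Δ (Set.Ici ((g + 1 : ℕ) : ℕ∞)) *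
            (ENNReal.ofReal ((1 - f) ^ g * f) * P {ω | D ω ∈ Φ (Y ω)}) := by
            refine (measure_mono hsub).trans ((measure_iUnion_le _).trans
              (ENNReal.tsum_le_tsum fun g => ?_))
            rw [← hgap g]
            exact hbound g
        _ = (∑' g : ℕ, ENNReal.ofReal ((1 - f) ^ g * f) * Δ (Set.Ici ((g + 1 : ℕ) : ℕ∞))) *
            P {ω | D ω ∈ Φ (Y ω)} := by
            rw [← ENNReal.tsum_mul_right]
            refine tsum_congr fun g => ?_
            ring
        _ ≤ ENNReal.ofReal (1 / 2) * P {ω | D ω ∈ Φ (Y ω)} := by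
            gcongr
            exact tsum_late_le Δ h.f_pos h.f_le hp

end SymbolModel

/-! ### The two leader models -/

section Delay

variable {Δ : Measure ℕ∞} [IsProbabilityMeasure Δ]

theorem Ici_natCast_sdiff (n : ℕ) :
    Set.Ici (n : ℕ∞) \ {(n : ℕ∞)} = Set.Ici ((n + 1 : ℕ) : ℕ∞) := by
  ext x
  simp only [Set.mem_sdiff, Set.mem_Ici, Set.mem_singleton_iff]
  rw [Nat.cast_succ, ENat.add_one_le_iff (ENat.natCast_ne_top n), lt_iff_le_and_ne]
  exact and_congr_right fun _ => ⟨fun h => Ne.symm h, fun h => Ne.symm h⟩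

theorem real_Ici_succ (n : ℕ) :
    Δ.real (Set.Ici ((n + 1 : ℕ) : ℕ∞)) =
      Δ.real (Set.Ici (n : ℕ∞)) * (1 - failureRate Δ n) := by
  have h1 : Δ.real (Set.Ici ((n + 1 : ℕ) : ℕ∞)) =
      Δ.real (Set.Ici (n : ℕ∞)) - Δ.real {(n : ℕ∞)} := by
    rw [← Ici_natCast_sdiff, measureReal_sdiff (by simp) (measurableSet_singleton _)]
  rw [failureRate]
  split_ifs with h0
  · rw [h1]
    field_simp
  · have h2 : Δ.real (Set.Ici (n : ℕ∞)) = 0 := le_antisymm (not_lt.1 h0) measureReal_nonneg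
    have h3 : Δ.real {(n : ℕ∞)} ≤ Δ.real (Set.Ici (n : ℕ∞)) := measureReal_mono (by simp)
    have h4 : 0 ≤ Δ.real {(n : ℕ∞)} := measureReal_nonneg
    rw [h1]
    linarith

theorem failureRate_le_one (n : ℕ) : failureRate Δ n ≤ 1 := by
  rw [failureRate]
  split_ifs with h0
  · exact (div_le_one h0).2 (measureReal_mono (by simp))
  · exact le_rfl

/-- A delay with non-decreasing failure rate is new better than used. -/
theorem measure_Ici_add_le (hmono : Monotone (failureRate Δ)) (a b : ℕ) :
    Δ (Set.Ici ((a + b : ℕ) : ℕ∞)) ≤ Δ (Set.Ici (a : ℕ∞)) * Δ (Set.Ici (b : ℕ∞)) := by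
  have key : Δ.real (Set.Ici ((a + b : ℕ) : ℕ∞)) ≤
      Δ.real (Set.Ici (a : ℕ∞)) * Δ.real (Set.Ici (b : ℕ∞)) := by
    induction b with
    | zero => simp [probReal_univ]
    | succ b ih =>
      rw [← add_assoc, real_Ici_succ, real_Ici_succ, ← mul_assoc]
      exact mul_le_mul ih (by linarith [hmono (show b ≤ a + b by omega)])
        (by linarith [failureRate_le_one (Δ := Δ) (a + b)])
        (mul_nonneg measureReal_nonneg measureReal_nonneg)
  rw [← ofReal_measureReal (measure_ne_top Δ _),
    ← ofReal_measureReal (measure_ne_top Δ (Set.Ici (a : ℕ∞))),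
    ← ofReal_measureReal (measure_ne_top Δ (Set.Ici (b : ℕ∞))),
    ← ENNReal.ofReal_mul measureReal_nonneg]
  exact ENNReal.ofReal_le_ofReal key

end Delay

/-- The delays of all messages, with slots numbered from `0`. -/
def allDelays {Ω H : Type*} (R : Ω → Outcome H) (ω : Ω) (k : ℕ × H × H) : ℕ∞ :=
  (R ω).delay (k.1 + 1) k.2.1 k.2.2

/-- The symbols describe the leaders of the slots. -/
structure Describes {Ω 𝒴 H : Type*} (R : Ω → Outcome H) (Y : Ω → ℕ → 𝒴) (cls : 𝒴 → Option Bool)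
    (lead : (ℕ → 𝒴) → ℕ → H) : Prop where
  empty_iff : ∀ ω i, cls (Y ω i) = none ↔ (R ω).leaders (i + 1) = ∅ ∧ ¬ (R ω).adv (i + 1)
  uniq_iff : ∀ ω i, cls (Y ω i) = some true ↔
    ((R ω).leaders (i + 1)).encard = 1 ∧ ¬ (R ω).adv (i + 1)
  leaders_eq : ∀ ω i, cls (Y ω i) = some true → (R ω).leaders (i + 1) = {lead (Y ω) i}

theorem uniquelyHonestSlot_subset {Ω H : Type*} {R : Ω → Outcome H} :
    uniquelyHonestSlot R ⊆ nonemptySlot R := fun ω hω =>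
  Or.inl (Set.encard_ne_zero.1 (by rw [hω.1]; simp))

section Model

variable {Ω H : Type*} [MeasurableSpace Ω] {P : Measure Ω} [IsProbabilityMeasure P]
  {R : Ω → Outcome H} {Δ : Measure ℕ∞}

theorem miningRate_pos (hα : 0 < uniqueHonestProb P R) : 0 < miningRate P R := by
  refine lt_of_le_of_ne measureReal_nonneg fun h0 => hα.ne' ?_
  have h1 : P (nonemptySlot R) = 0 := (measureReal_eq_zero_iff).1 h0.symm
  rw [uniqueHonestProb, cond_eq_zero.2 (Or.inr h1)]
  simp

theorem uniqueHonestProb_le : uniqueHonestProb P R ≤ 1 := by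
  by_cases h0 : P (nonemptySlot R) = 0
  · rw [uniqueHonestProb, cond_eq_zero.2 (Or.inr h0)]
    simp
  · have := cond_isProbabilityMeasure h0
    exact measureReal_le_one

theorem miningRate_mul_uniqueHonestProb (hm : MeasurableSet (nonemptySlot R))
    (hα : 0 < uniqueHonestProb P R) :
    miningRate P R * uniqueHonestProb P R = P.real (uniquelyHonestSlot R) := by
  have h0 := miningRate_pos hα
  rw [uniqueHonestProb, measureReal_def, cond_apply hm,
    Set.inter_eq_right.2 uniquelyHonestSlot_subset, ENNReal.toReal_mul, ENNReal.toReal_inv,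
    ← measureReal_def, ← measureReal_def]
  exact mul_inv_cancel_left₀ h0.ne' _

theorem Describes.symbolModel {𝒴 : Type*} [MeasurableSpace 𝒴] [Countable 𝒴]
    [MeasurableSingletonClass 𝒴] {Y : Ω → ℕ → 𝒴} {cls : 𝒴 → Option Bool}
    {lead : (ℕ → 𝒴) → ℕ → H} (hY : Describes R Y cls lead) (hα : 0 < uniqueHonestProb P R)
    (hlead : ∀ (x x' : ℕ → 𝒴) i, (∀ j ≤ i, x j = x' j) → lead x i = lead x' i)
    (hmeas : ∀ i, Measurable fun ω => Y ω i) (hind : iIndepFun (fun i ω => Y ω i) P)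
    (hid : ∀ i, IdentDistrib (fun ω => Y ω i) (fun ω => Y ω 0) P P)
    (hD : HasRandomDelays P R Δ) (hYD : IndepFun Y (allDelays R) P)
    (hretry : (∀ a b : ℕ, Δ (Set.Ici ((a + b : ℕ) : ℕ∞)) ≤
        Δ (Set.Ici (a : ℕ∞)) * Δ (Set.Ici (b : ℕ∞))) ∨
      ∀ (x : ℕ → 𝒴) i j, i < j → cls (x i) = some true → cls (x j) = some true →
        lead x i ≠ lead x j) :
    SymbolModel P Y (allDelays R) cls lead Δ (miningRate P R) (uniqueHonestProb P R) := by
  have hne : nonemptySlot R = {ω | cls (Y ω 0) ≠ none} := by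
    ext ω
    simp only [nonemptySlot, Set.mem_ofPred_eq, ne_eq, hY.empty_iff, zero_add,
      Set.nonempty_iff_ne_empty]
    tauto
  have huq : uniquelyHonestSlot R = {ω | cls (Y ω 0) = some true} := by
    ext ω
    simp only [uniquelyHonestSlot, Set.mem_ofPred_eq, hY.uniq_iff, zero_add]
  have hSm : ∀ S : Set 𝒴, MeasurableSet S := fun S => S.to_countable.measurableSet
  refine ⟨hlead, hmeas, hind, miningRate_pos hα, hα.le, uniqueHonestProb_le, fun i => ?_,
    fun i => ?_, fun k => hD.measurable_delay _ _ _, fun k => hD.law_delay _ _ _, hD.indep_delay,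
    hYD, hretry⟩
  · rw [miningRate, hne, measureReal_def, measureReal_def]
    exact congrArg _ ((hid i).measure_mem_eq (hSm {y | cls y ≠ none}))
  · have hm : MeasurableSet (nonemptySlot R) := hne ▸ hmeas 0 (hSm {y | cls y ≠ none})
    rw [miningRate_mul_uniqueHonestProb hm hα, huq, measureReal_def, measureReal_def]
    exact congrArg _ ((hid i).measure_mem_eq (hSm {y | cls y = some true}))

end Model

/-! The i.i.d. leader model: the symbol of a slot is `none` if it is empty, `some (some h)` if `h`
is its only leader, and `some none` otherwise. -/

section IID

variable {H : Type*} (M : Set H)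

open Classical in
/-- The symbol of a slot with honest leaders `S` and adversarial leadership `a`. -/
def slotSymbol (p : Set H × Prop) : Option (Option M) :=
  if h : ∃ x : M, (x : H) ∈ p.1 ∧ (∀ y : M, y ≠ x → (y : H) ∉ p.1) ∧ ¬ p.2 then some (some h.choose)
  else if (∀ x : M, (x : H) ∉ p.1) ∧ ¬ p.2 then none else some none

/-- The kind of slot that a symbol stands for. -/
def slotClass : Option (Option M) → Option Bool
  | none => none
  | some none => some false
  | some (some _) => some true

variable {M}

theorem slotSymbol_eq_some_some {p : Set H × Prop} {x : M} :
    slotSymbol M p = some (some x) ↔ (x : H) ∈ p.1 ∧ (∀ y : M, y ≠ x → (y : H) ∉ p.1) ∧ ¬ p.2 := by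
  rw [slotSymbol]
  constructor
  · intro h
    split_ifs at h with h1
    · have := h1.choose_spec
      simp only [Option.some.injEq] at h
      rwa [h] at this
    · simp at h
  · intro h
    have h1 : ∃ x : M, (x : H) ∈ p.1 ∧ (∀ y : M, y ≠ x → (y : H) ∉ p.1) ∧ ¬ p.2 := ⟨x, h⟩
    rw [dif_pos h1]
    have h2 := h1.choose_spec
    by_contra hne
    exact h2.2.1 x (fun h3 => hne (by rw [← h3])) h.1

theorem slotSymbol_eq_none {p : Set H × Prop} :
    slotSymbol M p = none ↔ (∀ x : M, (x : H) ∉ p.1) ∧ ¬ p.2 := by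
  rw [slotSymbol]
  constructor
  · intro h
    split_ifs at h with h1 h2
    exact h2
  · intro h
    rw [dif_neg, if_pos h]
    rintro ⟨x, h1, _⟩
    exact h.1 x h1

theorem measurable_slotSymbol (hM : M.Countable) [MeasurableSpace (Option (Option M))] :
    Measurable (slotSymbol M) := by
  have := hM.to_subtype
  have hmem : ∀ x : H, MeasurableSet {p : Set H × Prop | x ∈ p.1} := fun x =>
    measurableSet_setOfPred.2 ((measurable_set_mem x).comp measurable_fst)
  have hadv : MeasurableSet {p : Set H × Prop | ¬ p.2} :=
    (measurableSet_setOfPred.2 measurable_snd).compl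
  have h1 : MeasurableSet {p : Set H × Prop | slotSymbol M p = none} := by
    simp only [slotSymbol_eq_none]
    have : {p : Set H × Prop | (∀ x : M, (x : H) ∉ p.1) ∧ ¬ p.2} =
        (⋂ x : M, {p | (x : H) ∈ p.1}ᶜ) ∩ {p | ¬ p.2} := by
      ext p
      simp
    rw [this]
    exact (MeasurableSet.iInter fun x : M => (hmem x).compl).inter hadv
  have h2 : ∀ x : M, MeasurableSet {p : Set H × Prop | slotSymbol M p = some (some x)} := by
    intro x
    simp only [slotSymbol_eq_some_some]
    have : {p : Set H × Prop | (x : H) ∈ p.1 ∧ (∀ y : M, y ≠ x → (y : H) ∉ p.1) ∧ ¬ p.2} =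
        {p | (x : H) ∈ p.1} ∩ ((⋂ y : M, ⋂ _ : y ≠ x, {p | (y : H) ∈ p.1}ᶜ) ∩ {p | ¬ p.2}) := by
      ext p
      simp
    rw [this]
    exact (hmem x).inter ((MeasurableSet.iInter fun y : M => MeasurableSet.iInter fun _ =>
      (hmem y).compl).inter hadv)
  refine measurable_to_countable' fun v => ?_
  rcases v with _ | _ | x
  · exact h1
  · have : slotSymbol M ⁻¹' {some none} = ({p | slotSymbol M p = none} ∪
        ⋃ x : M, {p | slotSymbol M p = some (some x)})ᶜ := by
      ext p
      simp only [Set.mem_preimage, Set.mem_singleton_iff, Set.mem_compl_iff, Set.mem_union,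
        Set.mem_ofPred_eq, Set.mem_iUnion]
      rcases slotSymbol M p with _ | _ | x <;> simp
    rw [this]
    exact (h1.union (MeasurableSet.iUnion h2)).compl
  · exact h2 x

end IID

/-- Leader sets may take uncountably many values, but only the kind of a slot and its unique leader
matter. These form a countable alphabet, and the failure rate provides the first alternative of
`retry`. -/
theorem IsIIDLeaderModel.exists_symbolModel {Ω H : Type*} [MeasurableSpace Ω] {P : Measure Ω}
    [IsProbabilityMeasure P] {R : Ω → Outcome H} {Δ : Measure ℕ∞} [IsProbabilityMeasure Δ]
    (h : IsIIDLeaderModel P R Δ) (hα : 0 < uniqueHonestProb P R) :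
    ∃ (M : Set H) (Y : Ω → ℕ → Option (Option M)) (lead : (ℕ → Option (Option M)) → ℕ → H),
      M.Countable ∧ Describes R Y (slotClass M) lead ∧
      let _ : MeasurableSpace (Option (Option M)) := ⊤
      SymbolModel P Y (allDelays R) (slotClass M) lead Δ (miningRate P R) (uniqueHonestProb P R) := by
  obtain ⟨M, hM, hsub⟩ := h.countable_leaders
  have : Countable M := hM.to_subtype
  let _ : MeasurableSpace (Option (Option M)) := ⊤
  have hsm := measurable_slotSymbol hM
  have hH : Nonempty H := by
    by_contra hempty
    rw [not_nonempty_iff] at hempty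
    have : uniquelyHonestSlot R = ∅ := by
      ext ω
      simp [uniquelyHonestSlot, Set.eq_empty_of_isEmpty]
    rw [uniqueHonestProb, this] at hα
    simp at hα
  -- A junk value of `lead` for slots that are not uniquely honest.
  obtain ⟨h₀⟩ := hH
  set Y : Ω → ℕ → Option (Option M) := fun ω i =>
    slotSymbol M ((R ω).leaders (i + 1), (R ω).adv (i + 1)) with hY
  set lead : (ℕ → Option (Option M)) → ℕ → H := fun x i =>
    ((x i).bind id).elim h₀ Subtype.val with hlead
  have hleaders : ∀ ω i (x : M), Y ω i = some (some x) → (R ω).leaders (i + 1) = {(x : H)} := by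
    intro ω i x hx
    rw [hY, slotSymbol_eq_some_some] at hx
    ext y
    simp only [Set.mem_singleton_iff]
    refine ⟨fun hy => ?_, fun hy => hy ▸ hx.1⟩
    by_contra hne
    exact hx.2.1 ⟨y, hsub i ω hy⟩ (fun h1 => hne (congrArg Subtype.val h1)) hy
  have hdes : Describes R Y (slotClass M) lead := by
    refine ⟨fun ω i => ?_, fun ω i => ?_, fun ω i => ?_⟩
    · have h1 : slotClass M (Y ω i) = none ↔ Y ω i = none := by
        rcases Y ω i with _ | _ | _ <;> simp [slotClass]
      rw [h1, hY, slotSymbol_eq_none, Set.eq_empty_iff_forall_notMem]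
      refine and_congr_left fun _ => ⟨fun h2 x hx => h2 ⟨x, hsub i ω hx⟩ hx, fun h2 x => h2 x⟩
    · have h1 : slotClass M (Y ω i) = some true ↔ ∃ x, Y ω i = some (some x) := by
        rcases Y ω i with _ | _ | _ <;> simp [slotClass]
      rw [h1]
      constructor
      · rintro ⟨x, hx⟩
        refine ⟨by rw [hleaders ω i x hx, Set.encard_singleton], ?_⟩
        rw [hY, slotSymbol_eq_some_some] at hx
        exact hx.2.2
      · rintro ⟨h2, h3⟩
        obtain ⟨x, hx⟩ := Set.encard_eq_one.1 h2
        have hxM : x ∈ M := hsub i ω (by rw [hx]; rfl)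
        refine ⟨⟨x, hxM⟩, ?_⟩
        rw [hY, slotSymbol_eq_some_some]
        simp only [hx, Set.mem_singleton_iff, true_and]
        exact ⟨fun y hy h4 => hy (Subtype.ext h4), h3⟩
    · intro h1
      rcases hv : Y ω i with _ | _ | x
      · simp [hv, slotClass] at h1
      · simp [hv, slotClass] at h1
      · rw [hleaders ω i x hv, hlead]
        simp [hv]
  refine ⟨M, Y, lead, hM, hdes, hdes.symbolModel hα (fun x x' i hx => ?_) (fun i => ?_) ?_
    (fun i => ?_) h.delays ?_ (Or.inl (measure_Ici_add_le h.failureRate_mono))⟩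
  · simp only [hlead, hx i le_rfl]
  · exact hsm.comp ((h.measurable_leaders i).prodMk (h.measurable_adv i))
  · exact h.indep.comp (fun _ => slotSymbol M) fun _ => hsm
  · exact (h.ident i).comp hsm
  · exact h.delays.indep_leaders.comp (φ := fun x i => slotSymbol M (x i))
      (measurable_pi_lambda _ fun i => hsm.comp (measurable_pi_apply i)) measurable_id

/-! The one-time leader model. -/

open Classical in
/-- The kind of a slot with `p.1` honest leaders and adversarial leadership `p.2`. -/
def countClass (p : ℕ × Prop) : Option Bool :=
  if p.2 then some false else if p.1 = 0 then none else some (decide (p.1 = 1))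

theorem countClass_eq_none {p : ℕ × Prop} : countClass p = none ↔ p.1 = 0 ∧ ¬ p.2 := by
  rw [countClass]
  split_ifs with h1 h2 <;> simp [*]

theorem countClass_eq_true {p : ℕ × Prop} : countClass p = some true ↔ p.1 = 1 ∧ ¬ p.2 := by
  rw [countClass]
  split_ifs with h1 h2 <;> simp [*]

open Classical in
/-- The number of indices `j` with `m j ∈ S`. -/
def indexCount {H : Type*} (m : ℕ → H) (S : Set H) : ℕ :=
  ⌊(∑' j, if m j ∈ S then (1 : ENNReal) else 0).toReal⌋₊

theorem measurable_indexCount {H : Type*} (m : ℕ → H) : Measurable (indexCount m) := by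
  classical
  refine Nat.measurable_floor.comp (ENNReal.measurable_toReal.comp ?_)
  refine Measurable.tsum fun j => ?_
  exact Measurable.ite (measurableSet_setOfPred.2 (measurable_set_mem (m j))) measurable_const
    measurable_const

theorem indexCount_image_Ico {H : Type*} {m : ℕ → H} (hm : Function.Injective m) (a b : ℕ) :
    indexCount m (m '' Set.Ico a b) = b - a := by
  classical
  rw [indexCount, tsum_eq_sum (s := Finset.Ico a b) fun j hj => ?_]
  · rw [Finset.sum_congr rfl fun j hj => if_pos ?_]
    · rw [Finset.sum_const, Nat.card_Ico, nsmul_one, ENNReal.toReal_natCast, Nat.floor_natCast]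
    · exact ⟨j, by simpa using hj, rfl⟩
  · rw [if_neg]
    rintro ⟨j', hj', h⟩
    rw [hm h] at hj'
    exact hj (by simpa using hj')

theorem IsOneTimeLeaderModel.exists_symbolModel {Ω H : Type*} [MeasurableSpace Ω] {P : Measure Ω}
    [IsProbabilityMeasure P] {R : Ω → Outcome H} {Δ : Measure ℕ∞}
    (h : IsOneTimeLeaderModel P R Δ) (hα : 0 < uniqueHonestProb P R) :
    ∃ (Y : Ω → ℕ → ℕ × Prop) (lead : (ℕ → ℕ × Prop) → ℕ → H), Describes R Y countClass lead ∧
      SymbolModel P Y (allDelays R) countClass lead Δ (miningRate P R) (uniqueHonestProb P R) := by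
  obtain ⟨m, N, hm, hN, hNm, hadv, hind, hid⟩ := h.election
  set Y : Ω → ℕ → ℕ × Prop := fun ω i => (N (i + 1) ω, (R ω).adv (i + 1)) with hY
  set lead : (ℕ → ℕ × Prop) → ℕ → H := fun x i => m (∑ j ∈ Finset.range i, (x j).1) with hlead
  have hsum : ∀ ω i, ∑ t ∈ Finset.Icc 1 i, N t ω = ∑ j ∈ Finset.range i, (Y ω j).1 := by
    intro ω i
    induction i with
    | zero => simp
    | succ i ih => rw [Finset.sum_Icc_succ_top (by omega), ih, Finset.sum_range_succ]
  have hL : ∀ ω i, (R ω).leaders (i + 1) = m '' Set.Ico (∑ j ∈ Finset.range i, (Y ω j).1)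
      (∑ j ∈ Finset.range i, (Y ω j).1 + (Y ω i).1) := by
    intro ω i
    rw [hN, hsum, hsum, Finset.sum_range_succ]
  have hcard : ∀ ω i, ((R ω).leaders (i + 1)).encard = (Y ω i).1 := by
    intro ω i
    rw [hL, hm.encard_image, ← Finset.coe_Ico, Set.encard_coe_eq_coe_finsetCard]
    simp
  have hdes : Describes R Y countClass lead := by
    refine ⟨fun ω i => ?_, fun ω i => ?_, fun ω i h1 => ?_⟩
    · rw [countClass_eq_none, ← Set.encard_eq_zero, hcard]
      simp [hY]
    · rw [countClass_eq_true, hcard]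
      simp [hY]
    · rw [countClass_eq_true] at h1
      rw [hL, h1.1, hlead]
      rw [← Finset.coe_Ico, Nat.Ico_succ_singleton]
      simp
  refine ⟨Y, lead, hdes, hdes.symbolModel hα (fun x x' i hx => ?_) (fun i => ?_) hind hid h.delays
    ?_ (Or.inr fun x i j hij h1 h2 h3 => ?_)⟩
  · simp only [hlead]
    rw [Finset.sum_congr rfl fun j hj => by rw [hx j (Finset.mem_range.1 hj).le]]
  · exact (hNm i).prodMk (hadv i)
  -- Independence of the delays is assumed for the leader sets, not for the counts `N`. The counts
  -- are recovered measurably from the sets by counting indices.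
  · have hY' : Y = (fun (x : ℕ → Set H × Prop) i => (indexCount m (x i).1, (x i).2)) ∘
        fun ω (s : ℕ) => ((R ω).leaders (s + 1), (R ω).adv (s + 1)) := by
      ext1 ω
      ext1 i
      simp only [Function.comp_apply]
      rw [hL, indexCount_image_Ico hm, Nat.add_sub_cancel_left]
    rw [hY']
    refine h.delays.indep_leaders.comp (measurable_pi_lambda _ fun i => ?_) measurable_id
    exact ((measurable_indexCount m).comp (measurable_fst.comp (measurable_pi_apply i))).prodMk
      (measurable_snd.comp (measurable_pi_apply i))
  -- The first of two uniquely honest slots uses up an index, so the index of the leader of the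
  -- second is larger.
  · have h4 := hm h3
    have h5 : ∑ l ∈ Finset.range (i + 1), (x l).1 ≤ ∑ l ∈ Finset.range j, (x l).1 :=
      Finset.sum_le_sum_of_subset (Finset.range_subset_range.2 hij)
    rw [Finset.sum_range_succ, (countClass_eq_true.1 h1).1] at h5
    omega

/-! ### Common prefix and chain quality -/

section Bounds

variable {Ω 𝒴 H Data : Type*} {R : Ω → Outcome H} {Y : Ω → ℕ → 𝒴} {cls : 𝒴 → Option Bool}
  {lead : (ℕ → 𝒴) → ℕ → H}

theorem Describes.marking (hY : Describes R Y cls lead) (ω : Ω) :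
    Marking (R ω) (mark cls lead (Y ω) (allDelays R ω)) fun i => lead (Y ω) (i - 1) where
  zero := rfl
  empty i hi h := by
    obtain ⟨i, rfl⟩ : ∃ m, i = m + 1 := ⟨i - 1, by omega⟩
    exact (hY.empty_iff ω i).1 (mark_succ_eq_none.1 h)
  uniq i h := by
    rcases i with _ | i
    · simp [mark] at h
    · have h1 := (mark_succ_eq_true.1 h).1
      exact ⟨hY.leaders_eq ω i h1, ((hY.uniq_iff ω i).1 h1).2⟩
  hears j i hji hj hi hno := by
    rcases j with _ | j
    · simp [mark] at hj
    obtain ⟨i, rfl⟩ : ∃ m, i = m + 1 := ⟨i - 1, by omega⟩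
    have h1 := lastHit_eq_of_forall_not (show j < i by omega) (mark_succ_eq_true.1 hj)
      fun t ht1 ht2 ht => hno (t + 1) (by omega) (by omega) (mark_succ_eq_true.2 ht)
    have h2 := (mark_succ_eq_true.1 hi).2 j h1
    simpa [allDelays] using h2

/-- The later special slot `i'` is non-empty, so the next non-empty slot after `j` is at most `i'`,
hence at most `i`. A message that has not arrived by slot `i` has not arrived before that slot
either. -/
theorem unheardCovers_late (ω : Ω) :
    UnheardCovers (mark cls lead (Y ω) (allDelays R ω))
      (Heard (R ω) fun i => lead (Y ω) (i - 1)) fun h => Late cls lead (Y ω) (allDelays R ω) h := by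
  classical
  intro h j i' i hj hji' hi'i hi' hheard
  rcases j with _ | m
  · simp [mark] at hj
  rw [Heard, not_or, not_or, not_le] at hheard
  obtain ⟨-, hne, hlt⟩ := hheard
  have hex : ∃ g, cls (Y ω (m + g + 1)) ≠ none := by
    refine ⟨i' - m - 2, fun h1 => ?_⟩
    have : i' = m + (i' - m - 2) + 1 + 1 := by omega
    rw [this, mark_succ_eq_none.2 h1] at hi'
    simp at hi'
  refine ⟨Nat.find hex, fun l hl1 hl2 => ?_, Nat.find_spec hex, hne, ?_⟩
  · have := Nat.find_min hex (m := l - m - 1) (by omega)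
    rwa [not_not, show m + (l - m - 1) + 1 = l by omega] at this
  · have h1 : Nat.find hex ≤ i' - m - 2 := by
      refine Nat.find_min' hex fun h1 => ?_
      have : i' = m + (i' - m - 2) + 1 + 1 := by omega
      rw [this, mark_succ_eq_none.2 h1] at hi'
      simp at hi'
    refine le_trans ?_ hlt.le
    exact_mod_cast (show Nat.find hex + 1 ≤ i - (m + 1) by omega)

theorem Describes.commonPrefix (hY : Describes R Y cls lead) {ω : Ω} {τ : Trace H Data}
    (hτ : τ.IsExecution (R ω)) {T k : ℕ} {I : Set H}
    (hs : ∀ s ∈ Finset.Icc 1 T, Settled (mark cls lead (Y ω) (allDelays R ω))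
      (Heard (R ω) fun i => lead (Y ω) (i - 1)) I s k) :
    τ.CommonPrefix T k I := by
  intro h₁ hh₁ h₂ hh₂ s i₁ i₂ h1 hT hi₁ hi₂
  obtain ⟨c, hsc, hck, hc, hpast, hfut, hh⟩ := hs s (Finset.mem_Icc.2 ⟨h1, hT⟩)
  rw [hτ.segment_eq_of_pivot (hY.marking ω) hsc (hck.trans hi₁) hc hpast hfut h₁
      (hh h₁ hh₁ i₁ hi₁),
    hτ.segment_eq_of_pivot (hY.marking ω) hsc (hck.trans (hi₁.trans hi₂)) hc hpast hfut h₂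
      (hh h₂ hh₂ i₂ (hi₁.trans hi₂))]

theorem Describes.extensiveChainQuality (hY : Describes R Y cls lead) {ω : Ω} {τ : Trace H Data}
    (hτ : τ.IsExecution (R ω)) {f μ : ℝ} {T k : ℕ} {I : Set H}
    (hs : ∀ s ∈ Finset.Icc 1 T, HasQuality (mark cls lead (Y ω) (allDelays R ω))
      (Heard (R ω) fun i => lead (Y ω) (i - 1)) I s k (k * f * μ)) :
    τ.ExtensiveChainQuality f μ T k I := by
  intro h hh s i h1 hT hi
  obtain ⟨hint, hq⟩ := hs s (Finset.mem_Icc.2 ⟨h1, hT⟩)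
  push_cast at hint hq
  exact hτ.lt_honestCount (hY.marking ω) hi h _ hint (hq h hh i hi)

/-- A union bound over the slots; it is void for infinitely many parties. -/
theorem measure_le_union_bound [MeasurableSpace Ω] {P : Measure Ω} {T : ℕ} {I : Set H}
    {B : Set Ω} {C : ℕ → Set Ω} (hB : B ⊆ ⋃ s ∈ Finset.Icc 1 T, C s) {a b : ℝ} (hb : 0 < b)
    (hC : ∀ (F : Finset H), (F : Set H) = I → ∀ s,
      P (C s) ≤ ENNReal.ofReal a + F.card * ENNReal.ofReal b) :
    P B ≤ (T : ENNReal) *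
      (ENNReal.ofReal a + (I.encard : ENNReal) * ENNReal.ofReal b) := by
  rcases Nat.eq_zero_or_pos T with rfl | hT
  · refine le_trans (measure_mono_null hB ?_).le bot_le
    simp
  rcases I.finite_or_infinite with hfin | hinf
  · have hF := hC hfin.toFinset hfin.coe_toFinset
    refine (measure_mono hB).trans ((measure_biUnion_finset_le _ _).trans
      ((Finset.sum_le_card_nsmul _ _ _ fun s _ => hF s).trans_eq ?_))
    rw [nsmul_eq_mul, Nat.card_Icc, Nat.add_sub_cancel, hfin.encard_eq_coe_toFinset_card,
      ENat.toENNReal_coe]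
  · rw [hinf.encard_eq, ENat.toENNReal_top, ENNReal.top_mul (ENNReal.ofReal_pos.2 hb).ne',
      add_top, ENNReal.mul_top (by exact_mod_cast hT.ne')]
    exact le_top

theorem unheard_factor_pos {ε : ℝ} (hε : 0 < ε) : 0 < 2 / (1 - (1 / 2 : ℝ) ^ (ε / 2)) := by
  have : (1 / 2 : ℝ) ^ (ε / 2) < 1 :=
    Real.rpow_lt_one (by norm_num) (by norm_num) (by linarith)
  exact div_pos (by norm_num) (by linarith)

theorem EpsHonestMajority.uniqueHonestProb_pos [MeasurableSpace Ω] {P : Measure Ω}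
    {Δ : Measure ℕ∞} {ε : ℝ} (hε : EpsHonestMajority P R Δ ε) : 0 < uniqueHonestProb P R := by
  refine lt_of_le_of_ne measureReal_nonneg fun h0 => ?_
  have := hε.1
  rw [← h0] at this
  norm_num at this

/-- The bounds on the violation probabilities, for leaders described by independent symbols. -/
theorem SymbolModel.violation_le [MeasurableSpace Ω] [MeasurableSpace 𝒴] [Countable 𝒴]
    [MeasurableSingletonClass 𝒴] [Inhabited 𝒴] {P : Measure Ω} [IsProbabilityMeasure P]
    {Δ : Measure ℕ∞} [IsProbabilityMeasure Δ]
    (h : SymbolModel P Y (allDelays R) cls lead Δ (miningRate P R) (uniqueHonestProb P R))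
    (hY : Describes R Y cls lead) {ε : ℝ} (hε : EpsHonestMajority P R Δ ε)
    {E : Ω → Trace H Data} (hE : ∀ ω, (E ω).IsExecution (R ω)) (I : Set H) (T k : ℕ) :
    P {ω | ¬ (E ω).CommonPrefix T k I} ≤
        (T : ENNReal) * (ENNReal.ofReal (pSettlement (miningRate P R) ε k) +
          (I.encard : ENNReal) * ENNReal.ofReal (pUnheard (miningRate P R) ε k)) ∧
      ∀ μ : ℝ, 0 < μ → μ < ε →
        P {ω | ¬ (E ω).ExtensiveChainQuality (miningRate P R) μ T k I} ≤
          (T : ENNReal) * (ENNReal.ofReal (pCQ (miningRate P R) ε μ k) +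
            (I.encard : ENNReal) * ENNReal.ofReal (pUnheardCQ (miningRate P R) ε μ k)) := by
  have hlaw := h.slotLaw
  rw [hε.2] at hlaw
  have h0 : 0 < ε := by linarith [hε.1, hε.2]
  have h1 : ε ≤ 1 := by linarith [hlaw.p_le_one]
  -- Since `α ≤ 1`, honest majority alone forces each single message to beat the next non-empty slot
  -- with probability at least one half.
  have hp : 1 / 2 ≤ probDelayLtGeom Δ (miningRate P R) := by
    have h2 := hε.1
    have h3 := h.alpha_le
    have h4 := h.alpha_nonneg
    by_contra hlt
    nlinarith
  have hu := h.unheardLaw hp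
  constructor
  · refine measure_le_union_bound (C := fun s => {ω | ¬ Settled
      (mark cls lead (Y ω) (allDelays R ω)) (Heard (R ω) fun i => lead (Y ω) (i - 1)) I s k})
      (fun ω hω => ?_) (mul_pos (unheard_factor_pos h0) (Real.exp_pos _)) fun F hF s => ?_
    · by_contra hnot
      simp only [Set.mem_iUnion, Set.mem_ofPred_eq, not_exists, not_not] at hnot
      exact hω (hY.commonPrefix (hE ω) hnot)
    · rw [← hF]
      exact hlaw.not_settled_le h0 h1 hu unheardCovers_late F s k
  · intro μ hμ hμε
    refine measure_le_union_bound (C := fun s => {ω | ¬ HasQuality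
      (mark cls lead (Y ω) (allDelays R ω)) (Heard (R ω) fun i => lead (Y ω) (i - 1)) I s k
      (k * miningRate P R * μ)})
      (fun ω hω => ?_) (mul_pos (unheard_factor_pos h0) (Real.exp_pos _)) fun F hF s => ?_
    · by_contra hnot
      simp only [Set.mem_iUnion, Set.mem_ofPred_eq, not_exists, not_not] at hnot
      exact hω (hY.extensiveChainQuality (hE ω) hnot)
    · rw [← hF]
      exact hlaw.not_hasQuality_le h1 hu unheardCovers_late hμ hμε F s k

end Bounds

end LongestChain

end

/-- `E` is the adversary: an arbitrary, possibly clairvoyant and non-measurable, choice of an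
execution for every outcome of the random components. `P` of a non-measurable set is its outer
measure, so the bounds hold for the worst case over all adversarial actions. -/
theorem corollary1 {Ω H Data : Type*} [MeasurableSpace Ω]
    (P : MeasureTheory.Measure Ω) [MeasureTheory.IsProbabilityMeasure P]
    (R : Ω → LongestChain.Outcome H)
    (Δ : MeasureTheory.Measure ℕ∞) [MeasureTheory.IsProbabilityMeasure Δ]
    (hR : LongestChain.IsIIDLeaderModel P R Δ ∨ LongestChain.IsOneTimeLeaderModel P R Δ)
    (ε : ℝ) (hε : LongestChain.EpsHonestMajority P R Δ ε)
    (E : Ω → LongestChain.Trace H Data) (hE : ∀ ω, (E ω).IsExecution (R ω))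
    (I : Set H) (T k : ℕ) :
    P {ω | ¬ (E ω).CommonPrefix T k I} ≤
        (T : ENNReal) *
          (ENNReal.ofReal (LongestChain.pSettlement (LongestChain.miningRate P R) ε k) +
            (I.encard : ENNReal) *
              ENNReal.ofReal (LongestChain.pUnheard (LongestChain.miningRate P R) ε k)) ∧
      ∀ μ : ℝ, 0 < μ → μ < 1 → μ < ε →
        P {ω | ¬ (E ω).ExtensiveChainQuality (LongestChain.miningRate P R) μ T k I} ≤
          (T : ENNReal) *
            (ENNReal.ofReal (LongestChain.pCQ (LongestChain.miningRate P R) ε μ k) +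
              (I.encard : ENNReal) *
                ENNReal.ofReal
                  (LongestChain.pUnheardCQ (LongestChain.miningRate P R) ε μ k)) := by
  have hα := hε.uniqueHonestProb_pos
  rcases hR with hR | hR
  · obtain ⟨M, Y, lead, hM, hY, h⟩ := hR.exists_symbolModel hα
    have : Countable M := hM.to_subtype
    let _ : MeasurableSpace (Option (Option M)) := ⊤
    obtain ⟨h1, h2⟩ := h.violation_le hY hε hE I T k
    exact ⟨h1, fun μ h0 _ hμ => h2 μ h0 hμ⟩
  · obtain ⟨Y, lead, hY, h⟩ := hR.exists_symbolModel hα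
    obtain ⟨h1, h2⟩ := h.violation_le hY hε hE I T k
    exact ⟨h1, fun μ h0 _ hμ => h2 μ h0 hμ⟩
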